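/- **Setting.** Let $N,d,m\ge 1$, $\alpha\le\beta$, $a\le b$ be integers, let $V\subset\mathbb C^N$ and $\Lambda\subset\mathbb C$ be nonempty connected open sets. All functions are complex-analytic. Consider the differential-difference equation $$u_t=\mathbf F(u_\alpha,\dots,u_\beta),\qquad u=(u^1,\dots,u^N),\quad u_l=u(n+l,t), \tag{1}$$ with $\mathbf F$ analytic on an open dense subset of $V^{\beta-\alpha+1}$, with the shift operator $\mathcal S(u_l)=u_{l+1}$ and the total derivative $D_t(\varphi)=\sum_{l,\gamma}\mathcal S^l(\mathbf F^\gamma)\,\partial\varphi/\partial u^\gamma_l$. Let $(M,\mathcal U)$ be a Darboux-Lax representation of (1): $M=M(u,\lambda)\in \mathrm{GL}_d(\mathbb C)$ for $u\in V$, $\lambda\in\Lambda$, and $\mathcal U=\mathcal U(u_a,\dots,u_b,\lambda)\in\mathrm{Mat}_d(\mathbb C)$ for $(u_a,\dots,u_b)$ in an open dense subset of $V^{b-a+1}$ and $\lambda\in\Lambda$, with $D_t(M)=\mathcal S(\mathcal U)M-M\mathcal U$. Let $\mathrm H_0$ be trivial, let $\mathrm H_1$ be the group generated by the matrix-functions $M(\tilde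 u,\lambda)M(u,\lambda)^{-1}$ of $\lambda$ ($u,\tilde u\in V$), and for $n\ge1$ let $\mathrm H_{n+1}$ be the group generated by $\mathrm H_n$ and all $M(u,\lambda)\,h\,M(u,\lambda)^{-1}$, $h\in\mathrm H_n$, $u\in V$. For $c_1,\dots,c_m\in\Lambda$ and integers $k_1,\dots,k_m\ge1$ let $G=\prod_{p=1}^m \mathrm{GL}_d\big(\mathbb C[\lambda]/((\lambda-c_p)^{k_p})\big)$, with elements $\big(\sum_{q<k_p}(\lambda-c_p)^qW^{p,q}\big)_p$, whose coordinates are the entries of the matrices $W^{p,q}$. A matrix-function of $\lambda$ acts on $G$ by left multiplication through its truncated Taylor expansions at the points $c_p$. The operators $\mathcal S$ (which is invertible) and $D_t$ are extended to functions of the coordinates of $G$ and of finitely many $u_l$ by $\mathcal S(W)=M(u,\lambda)W$, $D_t(W)=\mathcal U W$, where $W$ is the generic element of $G$. A point $x$ is a choice of an element of $G$ and of values $u_l\in V$ ($l\in\mathbb Z$), and $\mathcal S$ acts on points so that $(\mathcal S^j\varphi)(x)=\varphi(\mathcal S^jx)$. **Hypotheses.** Let $H\subset G$ be a closed connected complex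 Lie subgroup of codimension $r>0$. Let $\mathbf d_1,\dots,\mathbf d_N\ge0$ be integers with $\sum_i\mathbf d_i+N=r$, and let $z^1,\dots,z^N$ be analytic functions on an open dense subset of $G/H$ (regarded also as $H$-right-invariant functions on an open dense subset of $G$) such that $z^i$ is $\mathrm H_{\mathbf d_i}$-left-invariant. Suppose that * the functions $\mathcal S^k(z^i)$, $1\le i\le N$, $0\le k\le\mathbf d_i$, form a system of local coordinates almost everywhere on $G/H$, i.e. their differentials are linearly independent on an open dense subset (this makes sense by conclusion 1); * the determinant of the $N\times N$ matrix $\big(\partial\,\mathcal S^{\mathbf d_i+1}(z^i)/\partial u^j\big)$ is not identically zero. Put $z^i_k=\mathcal S^k(z^i)$, $k\in\mathbb Z$. Call a point solvable if the functions $z^i_k$, $0\le k\le\mathbf d_i+1$, are defined at it, the differentials of the $z^i_k$, $0\le k\le\mathbf d_i$, are linearly independent at it, and the above determinant is nonzero at it. **Conclusions.** 1. For $0\le k\le\mathbf d_i$ the function $z^i_k$ does not depend on the $u_l$. 2. Near every point at which the $z^i_k$, $0\le k\le \mathbf d_i$, are defined with linearly independent differentials one has, for some analytic $F^i$, $Q^i$,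 $$z^i_{\mathbf d_i+1}=F^i(z^{i'}_{k'},u),\qquad D_t(z^i)=Q^i(z^{i'}_{k'},u_a,\dots,u_b),\qquad 1\le i'\le N,\ 0\le k'\le\mathbf d_{i'},$$ provided that the respective left-hand side is defined at that point (and, for the second formula, that $\mathcal U$ is defined there). Near every solvable point one can solve for $u$: there are analytic $f^1,\dots,f^N$ with $$u^{i'}=f^{i'}(z^{\tilde\imath}_{\tilde k}),\qquad 1\le i'\le N;\quad 1\le\tilde\imath\le N,\ 0\le\tilde k\le\mathbf d_{\tilde\imath}+1 .$$ 3. Let $f$ and $Q$ be analytic functions on open sets. Put $$P^i=Q^i\big(v^{i'}_{k'},\,\mathcal S^a(f(v^{\tilde\imath}_{\tilde k})),\dots,\mathcal S^b(f(v^{\tilde\imath}_{\tilde k}))\big),$$ where $v^i_k$, $k\in\mathbb Z$, are new variables with $\mathcal S(v^i_k)=v^i_{k+1}$. Let $J$ be the interval of integers from $\min(0,a,\alpha)$ to $\max(0,b,\beta)+\max_i\mathbf d_i+1$, and let $x$ be a point such that for all $j\in J$ the point $\mathcal S^jx$ is solvable, $\mathbf F$ and $\mathcal U$ are defined at it, and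 the formulas $u=f(z^{\tilde\imath}_{\tilde k})$, $D_t(z^i)=Q^i(z^{i'}_{k'},u_a,\dots,u_b)$ hold near it. Then the formulas $u^{i'}=f^{i'}(v^{\tilde\imath}_{\tilde k})$ determine a Miura-type transformation from the modified equation $v^i_t=P^i$ to (1): the identity $$D_t\big(f^{i'}\big)=\mathbf F^{i'}\big(\mathcal S^\alpha(f),\dots,\mathcal S^\beta(f)\big),\qquad 1\le i'\le N,$$ in the variables $v^i_k$, where $D_t$ is the total derivative along $v^i_t=P^i$, is defined at the point $v^i_k=z^i_k(x)$ and is valid on the connected component of this point in the open set of all $v$ at which both sides are defined; this component is a nonempty open set. 4. The points $x$ for which there are $f$ and $Q$ as in 3 form a dense subset of the set of all points. -/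

import Mathlib

open Set Filter Topology

noncomputable section

namespace MiuraMT

/-! ## Analytic functions on open subsets, lattice variables, lattice equations -/

/-- An analytic function, with values in `F`, defined on an open subset `dom` of `X`
(the values of `toFun` outside `dom` carry no meaning). -/
structure AnalyticFun (X F : Type) [NormedAddCommGroup X] [NormedSpace ℂ X]
    [NormedAddCommGroup F] [NormedSpace ℂ F] where
  dom : Set X
  toFun : X → F
  isOpen_dom : IsOpen dom
  analytic : AnalyticOnNhd ℂ toFun dom

/-- A point of this type assigns values to all the variables `u_l^γ`, `l ∈ ℤ`, `γ = 1, …, N`. -/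
abbrev LatticeVar (N : ℕ) := ℤ → Fin N → ℂ

/-- A point of this type assigns values to the variables `u_p^γ, …, u_q^γ`. -/
abbrev Win (N : ℕ) (p q : ℤ) := Set.Icc p q → Fin N → ℂ

/-- The values of the variables `u_p, …, u_q`. -/
def win {N : ℕ} (p q : ℤ) (u : LatticeVar N) : Win N p q := fun l => u l

/-- The shift by `j`: the value of `u_l` is replaced by that of `u_{l+j}`.  Thus
`(𝒮^j φ)(u) = φ (seqShift j u)`. -/
def seqShift {N : ℕ} (j : ℤ) (u : LatticeVar N) : LatticeVar N := fun l => u (l + j)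

/-- An analytic `N`-component function `F(u_p, …, u_q)`.  It is also the right-hand side
of the differential-difference equation `u_t = F(u_p, …, u_q)`. -/
abbrev LatticeFun (N : ℕ) (p q : ℤ) := AnalyticFun (Win N p q) (Fin N → ℂ)

/-- The partial derivative `∂φ/∂u_l^γ`. -/
def pd {N : ℕ} (φ : LatticeVar N → ℂ) (l : ℤ) (γ : Fin N) (u : LatticeVar N) : ℂ :=
  deriv (fun s : ℂ => φ (Function.update u l (Function.update (u l) γ s))) (u l γ)

/-- The total derivative `D_t(φ) = ∑_{l,γ} 𝒮^l(F^γ) ∂φ/∂u_l^γ` along `u_t = F(u_α, …, u_β)`. -/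
def totalDeriv {N : ℕ} {α β : ℤ} (E : LatticeFun N α β) (φ : LatticeVar N → ℂ) (u : LatticeVar N) : ℂ :=
  ∑ᶠ q : ℤ × Fin N, E.toFun (win α β (seqShift q.1 u)) q.2 * pd φ q.1 q.2 u

/-- The set of those `v` at which both sides of
`D_t(f^i) = F^i(𝒮^α(f), …, 𝒮^β(f))` are defined, where `D_t` is the total derivative along
`v_t = F'(v_{p'}, …, v_{q'})`. -/
def miuraDom {N : ℕ} {p' q' α β p q : ℤ} (E' : LatticeFun N p' q') (E : LatticeFun N α β)
    (f : LatticeFun N p q) : Set (LatticeVar N) :=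
  {v | win p q v ∈ f.dom ∧
    (∀ l ∈ Set.Icc p q, win p' q' (seqShift l v) ∈ E'.dom) ∧
    (∀ l ∈ Set.Icc α β, win p q (seqShift l v) ∈ f.dom) ∧
    (fun l : Set.Icc α β => f.toFun (win p q (seqShift l v))) ∈ E.dom}

/-- `u = f(v_p, …, v_q)` determines a Miura-type transformation from the equation `v_t = E'`
to the equation `u_t = E`, the identity `D_t(f^i) = E^i(𝒮^α(f), …, 𝒮^β(f))` in the variables
`v_l^γ` being defined and valid on the nonempty open set `W`. -/
def IsMiuraOn {N : ℕ} {p' q' α β p q : ℤ} (E' : LatticeFun N p' q') (E : LatticeFun N α β)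
    (f : LatticeFun N p q) (W : Set (LatticeVar N)) : Prop :=
  IsOpen W ∧ W.Nonempty ∧ W ⊆ miuraDom E' E f ∧
    ∀ v ∈ W, ∀ i : Fin N,
      totalDeriv E' (fun v => f.toFun (win p q v) i) v =
        E.toFun (fun l : Set.Icc α β => f.toFun (win p q (seqShift l v))) i

/-- `dom` is contained and dense in the set of all `(u_p, …, u_q)` with all `u_l` in `V`. -/
def IsDenseIn {N : ℕ} {p q : ℤ} (V : Set (Fin N → ℂ)) (dom : Set (Win N p q)) : Prop :=
  dom ⊆ {w | ∀ l, w l ∈ V} ∧ {w | ∀ l, w l ∈ V} ⊆ closure dom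

/-! ## Darboux-Lax representations and the groups `H_0 ⊂ H_1 ⊂ H_2 ⊂ …` -/

/-- A Darboux-Lax representation `M = M(u, lam)`, `U = U(u_a, …, u_b, lam)` of the equation
`u_t = E`, with `u ∈ V` and `lam ∈ Λ`.  (Values of `M` for `u ∉ V` or `lam ∉ Λ` carry no
meaning.) -/
structure DarbouxLax {N : ℕ} (d : ℕ) (V : Set (Fin N → ℂ)) (Λ : Set ℂ) {α β : ℤ}
    (E : LatticeFun N α β) (a b : ℤ) where
  M : (Fin N → ℂ) → ℂ → GL (Fin d) ℂ
  domU : Set (Win N a b)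
  U : Win N a b → ℂ → Matrix (Fin d) (Fin d) ℂ
  analytic_M : ∀ i j : Fin d,
    AnalyticOnNhd ℂ (fun q : (Fin N → ℂ) × ℂ => (M q.1 q.2 : Matrix (Fin d) (Fin d) ℂ) i j)
      (V ×ˢ Λ)
  isOpen_domU : IsOpen domU
  domU_dense : IsDenseIn V domU
  analytic_U : ∀ i j : Fin d,
    AnalyticOnNhd ℂ (fun q : Win N a b × ℂ => U q.1 q.2 i j) (domU ×ˢ Λ)
  lax : ∀ u : LatticeVar N, (∀ l, u l ∈ V) → win α β u ∈ E.dom → win a b u ∈ domU →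
    win a b (seqShift 1 u) ∈ domU → ∀ lam ∈ Λ,
      (Matrix.of fun i j : Fin d =>
        totalDeriv E (fun u => (M (u 0) lam : Matrix (Fin d) (Fin d) ℂ) i j) u) =
      U (win a b (seqShift 1 u)) lam * (M (u 0) lam : Matrix (Fin d) (Fin d) ℂ) -
        (M (u 0) lam : Matrix (Fin d) (Fin d) ℂ) * U (win a b u) lam

/-- The subgroups `H_0 ⊂ H_1 ⊂ …` of the group of `GL_d(ℂ)`-valued functions of `lam`:
`H_0` is trivial, `H_1` is generated by the `M(u', lam) M(u, lam)⁻¹`, and for `n ≥ 1` the group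
`H_{n+1}` is generated by `H_n` and the `M(u, lam) h M(u, lam)⁻¹` with `h ∈ H_n`. -/
def laxGroup {N d : ℕ} (V : Set (Fin N → ℂ)) (M : (Fin N → ℂ) → ℂ → GL (Fin d) ℂ) :
    ℕ → Subgroup (ℂ → GL (Fin d) ℂ)
  | 0 => ⊥
  | 1 => Subgroup.closure {A | ∃ u' ∈ V, ∃ u ∈ V, A = M u' * (M u)⁻¹}
  | n + 2 => Subgroup.closure ((laxGroup V M (n + 1) : Set (ℂ → GL (Fin d) ℂ)) ∪
      {A | ∃ u ∈ V, ∃ h ∈ laxGroup V M (n + 1), A = M u * h * (M u)⁻¹})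

/-! ## The Lie group `G` -/

/-- `d × d` matrices with entries in `ℂ[lam]/((lam - c)^k)`, written as
`∑_{q<k} (lam - c)^q W^q`: the element `W` is the list of the coefficients `W^q`. -/
def JetMat (d k : ℕ) : Type := Fin k → Matrix (Fin d) (Fin d) ℂ

namespace JetMat

variable {d k : ℕ}

instance : NormedAddCommGroup (JetMat d k) :=
  inferInstanceAs (NormedAddCommGroup (Fin k → Fin d → Fin d → ℂ))

instance : NormedSpace ℂ (JetMat d k) :=
  inferInstanceAs (NormedSpace ℂ (Fin k → Fin d → Fin d → ℂ))

/-- Multiplication modulo `(lam - c)^k`. -/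
instance : Mul (JetMat d k) :=
  ⟨fun A B q => ∑ s : Fin k, ∑ t : Fin k, if (s : ℕ) + t = q then A s * B t else 0⟩

instance : One (JetMat d k) := ⟨fun q => if (q : ℕ) = 0 then 1 else 0⟩

/-- Truncation of a power series. -/
def trunc (φ : PowerSeries (Matrix (Fin d) (Fin d) ℂ)) : JetMat d k :=
  fun q => PowerSeries.coeff (q : ℕ) φ

theorem trunc_surjective :
    Function.Surjective (trunc : PowerSeries (Matrix (Fin d) (Fin d) ℂ) → JetMat d k) := by
  intro A
  refine ⟨PowerSeries.mk fun n => if h : n < k then A ⟨n, h⟩ else 0, ?_⟩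
  funext q
  simp [trunc]

theorem trunc_one : (trunc 1 : JetMat d k) = 1 := by
  funext q
  simp only [trunc, PowerSeries.coeff_one]
  rfl

theorem trunc_mul (φ ψ : PowerSeries (Matrix (Fin d) (Fin d) ℂ)) :
    (trunc (φ * ψ) : JetMat d k) = trunc φ * trunc ψ := by
  funext q
  change PowerSeries.coeff (q : ℕ) (φ * ψ) = ∑ s : Fin k, ∑ t : Fin k,
    if (s : ℕ) + t = q then PowerSeries.coeff (s : ℕ) φ * PowerSeries.coeff (t : ℕ) ψ else 0
  rw [PowerSeries.coeff_mul, ← Fintype.sum_prod_type', ← Finset.sum_filter]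
  symm
  refine Finset.sum_bij (fun x _ => ((x.1 : ℕ), (x.2 : ℕ))) ?_ ?_ ?_ ?_
  · rintro ⟨s, t⟩ h
    simpa using h
  · rintro ⟨s, t⟩ _ ⟨s', t'⟩ _ h
    simp only [Prod.mk.injEq] at h
    exact Prod.ext (Fin.ext h.1) (Fin.ext h.2)
  · rintro ⟨s, t⟩ h
    have h' : s + t = (q : ℕ) := by simpa using h
    have hq := q.2
    exact ⟨(⟨s, by omega⟩, ⟨t, by omega⟩), by simpa using h', rfl⟩
  · rintro ⟨s, t⟩ _
    rfl

instance : Monoid (JetMat d k) :=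
  { (inferInstance : Mul (JetMat d k)), (inferInstance : One (JetMat d k)) with
    mul_assoc := by
      intro A B C
      obtain ⟨φ, rfl⟩ := trunc_surjective A
      obtain ⟨ψ, rfl⟩ := trunc_surjective B
      obtain ⟨χ, rfl⟩ := trunc_surjective C
      simp only [← trunc_mul, mul_assoc]
    one_mul := by
      intro A
      obtain ⟨φ, rfl⟩ := trunc_surjective A
      rw [← trunc_one, ← trunc_mul, one_mul]
    mul_one := by
      intro A
      obtain ⟨φ, rfl⟩ := trunc_surjective A
      rw [← trunc_one, ← trunc_mul, mul_one] }

theorem isUnit_of_coeff_zero (A : JetMat d k) (hA : ∀ h : 0 < k, IsUnit (A ⟨0, h⟩)) :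
    IsUnit A := by
  obtain ⟨W, hW⟩ : ∃ W : (Matrix (Fin d) (Fin d) ℂ)ˣ,
      ∀ h : 0 < k, A ⟨0, h⟩ = (W : Matrix (Fin d) (Fin d) ℂ) := by
    by_cases h : 0 < k
    · obtain ⟨W, hW⟩ := hA h
      exact ⟨W, fun _ => hW.symm⟩
    · exact ⟨1, fun h' => absurd h' h⟩
  let φ : PowerSeries (Matrix (Fin d) (Fin d) ℂ) :=
    PowerSeries.mk fun n => if n = 0 then (W : Matrix (Fin d) (Fin d) ℂ)
      else if h : n < k then A ⟨n, h⟩ else 0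
  have hφ : (trunc φ : JetMat d k) = A := by
    funext q
    rcases q with ⟨q, hq⟩
    rcases Nat.eq_zero_or_pos q with rfl | h0
    · simp [trunc, φ, hW hq]
    · simp [trunc, φ, hq, h0.ne']
  have hc : PowerSeries.constantCoeff φ = (W : Matrix (Fin d) (Fin d) ℂ) := by
    rw [← PowerSeries.coeff_zero_eq_constantCoeff_apply]
    simp [φ]
  refine ⟨⟨A, trunc (PowerSeries.invOfUnit φ W), ?_, ?_⟩, rfl⟩
  · rw [← hφ, ← trunc_mul, PowerSeries.mul_invOfUnit φ W hc, trunc_one]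
  · rw [← hφ, ← trunc_mul, PowerSeries.invOfUnit_mul φ W hc, trunc_one]

end JetMat

/-- The algebra `∏_p Mat_d(ℂ[lam]/((lam - c_p)^{k_p}))`, as a normed vector space and a monoid. -/
abbrev JetAlg {m : ℕ} (d : ℕ) (k : Fin m → ℕ) := (p : Fin m) → JetMat d (k p)

/-- The group `G = ∏_p GL_d(ℂ[lam]/((lam - c_p)^{k_p}))` of units of that algebra; it is
open in `JetAlg d k`, and the entries of the coefficient matrices are global coordinates. -/
abbrev JetGroup {m : ℕ} (d : ℕ) (k : Fin m → ℕ) := (JetAlg d k)ˣ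

/-- The truncated Taylor expansions of a matrix function of `lam` at the points `c_p`. -/
def jet {m d : ℕ} (c : Fin m → ℂ) (k : Fin m → ℕ) (A : ℂ → Matrix (Fin d) (Fin d) ℂ) :
    JetAlg d k :=
  fun p (q : Fin (k p)) => Matrix.of fun i j =>
    ((q : ℕ).factorial : ℂ)⁻¹ * iteratedDeriv (q : ℕ) (fun lam => A lam i j) (c p)

theorem isUnit_jet {m d : ℕ} (c : Fin m → ℂ) (k : Fin m → ℕ) (A : ℂ → GL (Fin d) ℂ) :
    IsUnit (jet c k fun lam => (A lam : Matrix (Fin d) (Fin d) ℂ)) := by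
  refine Pi.isUnit_iff.2 fun p => JetMat.isUnit_of_coeff_zero _ fun h => ?_
  have : jet c k (fun lam => (A lam : Matrix (Fin d) (Fin d) ℂ)) p ⟨0, h⟩ =
      (A (c p) : Matrix (Fin d) (Fin d) ℂ) := by
    ext i j
    simp [jet]
  rw [this]
  exact (A (c p)).isUnit

/-- The map `ρ` from `GL_d(ℂ)`-valued functions of `lam` to `G` given by Taylor expansions. -/
def rho {m d : ℕ} (c : Fin m → ℂ) (k : Fin m → ℕ) (A : ℂ → GL (Fin d) ℂ) : JetGroup d k :=
  (isUnit_jet c k A).unit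

/-- A function on `G` as a function of the coordinates (extended by `0` outside `G`). -/
def inCoords {m d : ℕ} {k : Fin m → ℕ} (φ : JetGroup d k → ℂ) : JetAlg d k → ℂ :=
  Function.extend (fun g : JetGroup d k => (g : JetAlg d k)) φ 0

/-- `H` is a complex submanifold of `G` of codimension `r`: near each of its points it is the
zero set of a `ℂ^r`-valued analytic function whose differential there is onto. -/
def HasCodim {m d : ℕ} {k : Fin m → ℕ} (H : Subgroup (JetGroup d k)) (r : ℕ) : Prop :=
  ∀ h ∈ H, ∃ (O : Set (JetAlg d k)) (φ : JetAlg d k → Fin r → ℂ),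
    IsOpen O ∧ (h : JetAlg d k) ∈ O ∧ AnalyticOnNhd ℂ φ O ∧
    Function.Surjective (fderiv ℂ φ (h : JetAlg d k)) ∧
    ∀ g : JetGroup d k, (g : JetAlg d k) ∈ O → (g ∈ H ↔ φ g = 0)

/-- The function `y` is analytic on the open subset `D` of the manifold `G/H`, i.e. its pullback
under the submersion `G → G/H` is analytic on the preimage of `D`. -/
def IsAnalyticOn {m d : ℕ} {k : Fin m → ℕ} {H : Subgroup (JetGroup d k)}
    (y : JetGroup d k ⧸ H → ℂ) (D : Set (JetGroup d k ⧸ H)) : Prop :=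
  ∀ g : JetGroup d k, (g : JetGroup d k ⧸ H) ∈ D →
    AnalyticAt ℂ (inCoords fun g' : JetGroup d k => y (g' : JetGroup d k ⧸ H)) (g : JetAlg d k)

/-- The function `y` on the open subset `D` of `G/H` is `𝓗`-left-invariant, for a group `𝓗` of
`GL_d(ℂ)`-valued functions of `lam` acting on `G/H` through `ρ`. -/
def IsLeftInvariant {m d : ℕ} (c : Fin m → ℂ) {k : Fin m → ℕ} {H : Subgroup (JetGroup d k)}
    (K : Subgroup (ℂ → GL (Fin d) ℂ)) (y : JetGroup d k ⧸ H → ℂ)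
    (D : Set (JetGroup d k ⧸ H)) : Prop :=
  ∀ A ∈ K, ∀ x ∈ D, rho c k A • x ∈ D → y (rho c k A • x) = y x

/-! ## The operators `𝒮` and `D_t` on functions of the coordinates of `G` and the `u_l` -/

/-- A point of this type assigns values to the coordinates of `G` and to all the `u_l`. -/
abbrev Phase {m : ℕ} (N d : ℕ) (k : Fin m → ℕ) := JetGroup d k × LatticeVar N

/-- The substitution `W ↦ M(u, lam) W`, `u_l ↦ u_{l+1}`, with its inverse
`W ↦ M(u_{-1}, lam)⁻¹ W`, `u_l ↦ u_{l-1}`.  Thus `(𝒮^j Φ)(x) = Φ ((phaseShift M c k ^ j) x)`. -/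
def phaseShift {m N d : ℕ} (M : (Fin N → ℂ) → ℂ → GL (Fin d) ℂ) (c : Fin m → ℂ)
    (k : Fin m → ℕ) : Equiv.Perm (Phase N d k) where
  toFun x := (rho c k (M (x.2 0)) * x.1, seqShift 1 x.2)
  invFun x := ((rho c k (M (x.2 (-1))))⁻¹ * x.1, seqShift (-1) x.2)
  left_inv x := by
    refine Prod.ext ?_ (funext fun l => ?_)
    · simp [seqShift]
    · simp [seqShift]
  right_inv x := by
    refine Prod.ext ?_ (funext fun l => ?_)
    · simp [seqShift]
    · simp [seqShift]

/-- The total derivative `D_t` on functions of the coordinates of `G` and the `u_l`: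
the vector field whose `W`-component is `U(u_a, …, u_b, lam) W` and whose `u_l`-component is
`𝒮^l(F)`. -/
def phaseDeriv {m N d : ℕ} {V : Set (Fin N → ℂ)} {Λ : Set ℂ} {α β a b : ℤ}
    {E : LatticeFun N α β} (R : DarbouxLax d V Λ E a b) (c : Fin m → ℂ) {k : Fin m → ℕ}
    (Φ : Phase N d k → ℂ) (x : Phase N d k) : ℂ :=
  fderiv ℂ (inCoords fun g => Φ (g, x.2)) (x.1 : JetAlg d k)
      (jet c k (R.U (win a b x.2)) * (x.1 : JetAlg d k)) +
    totalDeriv E (fun u => Φ (x.1, u)) x.2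

section Invariants

variable {m N d : ℕ} (M : (Fin N → ℂ) → ℂ → GL (Fin d) ℂ) (c : Fin m → ℂ) {k : Fin m → ℕ}
  {H : Subgroup (JetGroup d k)}

/-- The function `z^i_j = 𝒮^j(z^i)` of the coordinates of `G` and the `u_l`, `j ∈ ℤ`. -/
def zs (z : Fin N → JetGroup d k ⧸ H → ℂ) (i : Fin N) (j : ℤ) (x : Phase N d k) : ℂ :=
  z i (((phaseShift M c k ^ j) x).1 : JetGroup d k ⧸ H)

/-- The functions `𝒮^j(z^i)` are defined at `x`, where `D ⊂ G/H` is the domain of the `z^i`. -/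
def ZDefined (D : Set (JetGroup d k ⧸ H)) (j : ℤ) (x : Phase N d k) : Prop :=
  (((phaseShift M c k ^ j) x).1 : JetGroup d k ⧸ H) ∈ D

variable (δ : Fin N → ℕ)

/-- The tuple `z^i_j`, `i = 1, …, N`, `j = 0, …, d_i`. -/
def zLow (z : Fin N → JetGroup d k ⧸ H → ℂ) (x : Phase N d k) :
    (Σ i : Fin N, Fin (δ i + 1)) → ℂ :=
  fun q => zs M c z q.1 ((q.2 : ℕ) : ℤ) x

/-- The tuple `z^i_j`, `i = 1, …, N`, `j = 0, …, d_i + 1`. -/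
def zFull (z : Fin N → JetGroup d k ⧸ H → ℂ) (x : Phase N d k) :
    (Σ i : Fin N, Fin (δ i + 2)) → ℂ :=
  fun q => zs M c z q.1 ((q.2 : ℕ) : ℤ) x

/-- For the values `u_l` given by the second component of `x`, the functions `𝒮^j(z^i)`,
`j = 0, …, d_i`, are defined at the point `x.1` and their differentials there are linearly
independent.  (The kernels of these differentials contain the tangent space of the coset
`x.1 H`, so this is linear independence on the tangent space of `G/H`.) -/
def CoordAt (D : Set (JetGroup d k ⧸ H)) (z : Fin N → JetGroup d k ⧸ H → ℂ)
    (x : Phase N d k) : Prop :=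
  (∀ i : Fin N, ∀ j : ℕ, j ≤ δ i → ZDefined M c D j x) ∧
  LinearIndependent ℂ (fun q : Σ i : Fin N, Fin (δ i + 1) =>
    fderiv ℂ (inCoords fun g => zs M c z q.1 ((q.2 : ℕ) : ℤ) (g, x.2)) (x.1 : JetAlg d k))

/-- The matrix `∂(𝒮^{d_i + 1}(z^i))/∂u^j`. -/
def jacobian (z : Fin N → JetGroup d k ⧸ H → ℂ) (x : Phase N d k) :
    Matrix (Fin N) (Fin N) ℂ :=
  Matrix.of fun i j => pd (fun u => zs M c z i ((δ i : ℤ) + 1) (x.1, u)) 0 j x.2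

/-- Near `x` one has `𝒮^{d_i+1}(z^i) = F^i(z^{i'}_{k'}, u)`, `0 ≤ k' ≤ d_{i'}`. -/
def ShiftFormula (z : Fin N → JetGroup d k ⧸ H → ℂ)
    (F : AnalyticFun (((Σ i : Fin N, Fin (δ i + 1)) → ℂ) × (Fin N → ℂ)) (Fin N → ℂ))
    (x : Phase N d k) : Prop :=
  ∀ᶠ y in 𝓝 x, (zLow M c δ z y, y.2 0) ∈ F.dom ∧
    ∀ i, zs M c z i ((δ i : ℤ) + 1) y = F.toFun (zLow M c δ z y, y.2 0) i

/-- Near `x` one has `u^{i'} = f^{i'}(z^i_j)`, `0 ≤ j ≤ d_i + 1`. -/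
def SolvedFormula (z : Fin N → JetGroup d k ⧸ H → ℂ)
    (f : AnalyticFun ((Σ i : Fin N, Fin (δ i + 2)) → ℂ) (Fin N → ℂ))
    (x : Phase N d k) : Prop :=
  ∀ᶠ y in 𝓝 x, zFull M c δ z y ∈ f.dom ∧ y.2 0 = f.toFun (zFull M c δ z y)

/-- Near `x` one has `D_t(z^i) = Q^i(z^{i'}_{k'}, u_a, …, u_b)`, `0 ≤ k' ≤ d_{i'}`. -/
def DerivFormula {V : Set (Fin N → ℂ)} {Λ : Set ℂ} {α β a b : ℤ} {E : LatticeFun N α β}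
    (R : DarbouxLax d V Λ E a b) (z : Fin N → JetGroup d k ⧸ H → ℂ)
    (Q : AnalyticFun (((Σ i : Fin N, Fin (δ i + 1)) → ℂ) × Win N a b) (Fin N → ℂ))
    (x : Phase N d k) : Prop :=
  ∀ᶠ y in 𝓝 x, (zLow R.M c δ z y, win a b y.2) ∈ Q.dom ∧
    ∀ i, phaseDeriv R c (fun y => z i (y.1 : JetGroup d k ⧸ H)) y =
      Q.toFun (zLow R.M c δ z y, win a b y.2) i

/-- `x` is a point with all `u_l` in `V` at which the `z^i_j`, `j = 0, …, d_i + 1`, are defined,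
the `z^i_j`, `j = 0, …, d_i`, form local coordinates, and the Jacobian determinant is not `0`. -/
def SolvableAt (V : Set (Fin N → ℂ)) (D : Set (JetGroup d k ⧸ H))
    (z : Fin N → JetGroup d k ⧸ H → ℂ) (x : Phase N d k) : Prop :=
  (∀ l, x.2 l ∈ V) ∧ (∀ i : Fin N, ZDefined M c D ((δ i : ℤ) + 1) x) ∧
    CoordAt M c δ D z x ∧ (jacobian M c δ z x).det ≠ 0

/-- `max_i d_i + 1`. -/
def topShift : ℕ := Finset.univ.sup δ + 1

/-- The (finite) range of the shifts `𝒮^j` that occur in the identity defining the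
Miura-type transformation. -/
def shiftRange (α β a b : ℤ) : Set ℤ :=
  Set.Icc (min 0 (min a α)) (max 0 (max b β) + topShift δ)

/-- For every `j` in the relevant finite range, `𝒮^j x` is a point as in `SolvableAt` at which
also the right-hand side of the equation and the matrix `U` are defined. -/
def RegularOrbit {V : Set (Fin N → ℂ)} {Λ : Set ℂ} {α β a b : ℤ} {E : LatticeFun N α β}
    (R : DarbouxLax d V Λ E a b) (D : Set (JetGroup d k ⧸ H))
    (z : Fin N → JetGroup d k ⧸ H → ℂ) (x : Phase N d k) : Prop :=
  ∀ j ∈ shiftRange δ α β a b,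
    SolvableAt R.M c δ V D z ((phaseShift R.M c k ^ j) x) ∧
    win α β (seqShift j x.2) ∈ E.dom ∧ win a b (seqShift j x.2) ∈ R.domU

/-- The formulas `u = f(z^i_j)` and `D_t(z^i) = Q^i(z^{i'}_{k'}, u_a, …, u_b)` hold near `𝒮^j x`
for every `j` in the relevant finite range (so `u_j = 𝒮^j(f)` near `x`). -/
def Compatible {V : Set (Fin N → ℂ)} {Λ : Set ℂ} {α β a b : ℤ} {E : LatticeFun N α β}
    (R : DarbouxLax d V Λ E a b) (z : Fin N → JetGroup d k ⧸ H → ℂ)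
    (f : AnalyticFun ((Σ i : Fin N, Fin (δ i + 2)) → ℂ) (Fin N → ℂ))
    (Q : AnalyticFun (((Σ i : Fin N, Fin (δ i + 1)) → ℂ) × Win N a b) (Fin N → ℂ))
    (x : Phase N d k) : Prop :=
  ∀ j ∈ shiftRange δ α β a b,
    SolvedFormula R.M c δ z f ((phaseShift R.M c k ^ j) x) ∧
    DerivFormula c δ R z Q ((phaseShift R.M c k ^ j) x)

end Invariants

/-! ## The modified equation and the transformation -/

section Modified

variable {N : ℕ} {δ : Fin N → ℕ}

theorem le_topShift (i : Fin N) : δ i + 1 ≤ topShift δ :=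
  Nat.succ_le_succ (Finset.le_sup (f := δ) (Finset.mem_univ i))

theorem mem_window_f (q : Σ i : Fin N, Fin (δ i + 2)) :
    ((q.2 : ℕ) : ℤ) ∈ Set.Icc (0 : ℤ) (topShift δ) := by
  have h1 := q.2.2
  have h2 := le_topShift (δ := δ) q.1
  constructor <;> omega

theorem mem_window_low (a b : ℤ) (q : Σ i : Fin N, Fin (δ i + 1)) :
    ((q.2 : ℕ) : ℤ) ∈ Set.Icc (min 0 a) (max 0 b + topShift δ) := by
  have h1 := q.2.2
  have h2 := le_topShift (δ := δ) q.1
  constructor <;> omega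

theorem mem_window_full (a b : ℤ) (j : Set.Icc a b) (q : Σ i : Fin N, Fin (δ i + 2)) :
    ((q.2 : ℕ) : ℤ) + j ∈ Set.Icc (min 0 a) (max 0 b + topShift δ) := by
  have h1 := q.2.2
  have h2 := le_topShift (δ := δ) q.1
  have h3 := j.2.1
  have h4 := j.2.2
  constructor <;> omega

theorem analyticAt_eval {p q : ℤ} {ι : Type} [Fintype ι] (g : ι → Set.Icc p q)
    (h : ι → Fin N) (w : Win N p q) :
    AnalyticAt ℂ (fun w : Win N p q => fun s : ι => w (g s) (h s)) w :=
  analyticAt_pi_iff.2 fun s =>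
    ((ContinuousLinearMap.proj (R := ℂ) (φ := fun _ : Fin N => ℂ) (h s)).comp
      (ContinuousLinearMap.proj (R := ℂ) (φ := fun _ : Set.Icc p q => Fin N → ℂ)
        (g s))).analyticAt w

/-- The function `f^{i'}(v^i_j)`, `j = 0, …, d_i + 1`, of the variables `v_l`. -/
def miuraFun (f : AnalyticFun ((Σ i : Fin N, Fin (δ i + 2)) → ℂ) (Fin N → ℂ)) :
    LatticeFun N 0 (topShift δ) where
  dom := {w | (fun q => w ⟨_, mem_window_f q⟩ q.1) ∈ f.dom}
  toFun w := f.toFun (fun q => w ⟨_, mem_window_f q⟩ q.1)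
  isOpen_dom := f.isOpen_dom.preimage (by fun_prop)
  analytic := fun w hw => by
    refine (f.analytic _ hw).comp_of_eq (f := fun w : Win N 0 (topShift δ) =>
      fun q => w ⟨_, mem_window_f q⟩ q.1) ?_ rfl
    exact analyticAt_eval _ _ _

/-- The `v^{i'}_{k'}`, `k' = 0, …, d_{i'}`. -/
def vLow (a b : ℤ) (w : Win N (min 0 a) (max 0 b + topShift δ)) :
    (Σ i : Fin N, Fin (δ i + 1)) → ℂ :=
  fun q => w ⟨_, mem_window_low a b q⟩ q.1

/-- The arguments `v^i_{l+j}`, `l = 0, …, d_i + 1`, of `𝒮^j(f)`. -/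
def vFull (a b : ℤ) (j : Set.Icc a b) (w : Win N (min 0 a) (max 0 b + topShift δ)) :
    (Σ i : Fin N, Fin (δ i + 2)) → ℂ :=
  fun q => w ⟨_, mem_window_full a b j q⟩ q.1

/-- The right-hand side `P^i = Q^i(v^{i'}_{k'}, 𝒮^a(f), …, 𝒮^b(f))` of the modified equation
`v^i_t = P^i`. -/
def modifiedEq {a b : ℤ}
    (Q : AnalyticFun (((Σ i : Fin N, Fin (δ i + 1)) → ℂ) × Win N a b) (Fin N → ℂ))
    (f : AnalyticFun ((Σ i : Fin N, Fin (δ i + 2)) → ℂ) (Fin N → ℂ)) :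
    LatticeFun N (min 0 a) (max 0 b + topShift δ) where
  dom := {w | (∀ j, vFull a b j w ∈ f.dom) ∧
    (vLow a b w, fun j => f.toFun (vFull a b j w)) ∈ Q.dom}
  toFun w := Q.toFun (vLow a b w, fun j => f.toFun (vFull a b j w))
  isOpen_dom := by
    have h1 : IsOpen {w : Win N (min 0 a) (max 0 b + topShift δ) |
        ∀ j, vFull a b j w ∈ f.dom} := by
      simp only [Set.ofPred_forall]
      exact isOpen_iInter_of_finite fun j =>
        f.isOpen_dom.preimage (by unfold vFull; fun_prop)
    have h2 : ContinuousOn (fun w : Win N (min 0 a) (max 0 b + topShift δ) =>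
        (vLow a b w, fun j => f.toFun (vFull a b j w))) {w | ∀ j, vFull a b j w ∈ f.dom} := by
      refine ContinuousOn.prodMk (by unfold vLow; fun_prop) (continuousOn_pi.2 fun j => ?_)
      exact f.analytic.continuousOn.comp (by unfold vFull; fun_prop) fun w hw => hw j
    exact h2.isOpen_inter_preimage h1 Q.isOpen_dom
  analytic := fun w hw => by
    refine (Q.analytic _ hw.2).comp_of_eq
      (f := fun w => (vLow a b w, fun j => f.toFun (vFull a b j w))) ?_ rfl
    refine AnalyticAt.prod (analyticAt_eval _ _ _) (analyticAt_pi_iff.2 fun j => ?_)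
    refine (f.analytic _ (hw.1 j)).comp_of_eq (f := fun w => vFull a b j w) ?_ rfl
    exact analyticAt_eval _ _ _

end Modified

end MiuraMT

end

open MiuraMT

/-!
The substitution `𝒮^j` multiplies the generic element of `G` on the left by
`M(u_{j-1}) ⋯ M(u_0)` (`transfer`).  For two choices of the `u_l` the quotient of two such products
lies in `H_j`, so the left invariance of `z^i` makes `z^i_j = 𝒮^j(z^i)` independent of the `u_l`
for `j ≤ d_i` (`zs_indep`).

All `z^i_j` are invariant under right multiplication by `H`, hence their differentials at `g` vanish
on the tangent space `g · T_1 H` of the coset `gH` (`exists_isTangentMap`).  Where the `r` functions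
`z^i_j`, `j ≤ d_i`, have independent differentials, the common kernel of these has codimension `r`,
so it equals that tangent space, and every other right-invariant analytic function is locally an
analytic function of the `z^i_j`, also in the presence of parameters (`IsTangentMap.exists_factor`).
This gives the formulas for `z^i_{d_i+1}` and `D_t(z^i)`, and the inverse function theorem solves
the first of them for `u`.

For the Miura-type transformation, any `v` near the values `z^i_l(x)` has, in the finitely many
variables that matter, the form `z^i_l(y)` for a point `y` (`exists_point`): an element of `G` with
given `z^i_j`, `j ≤ d_i`, exists since these functions form a submersion, and the remaining values
are reached by taking `u_l = 𝒮^l(f)(v)`.  By the Lax equation the vector field `D_t` commutes with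
the shift, so along a curve through `y` with the velocity `D_t` each `z^i_l` changes at the rate
`𝒮^l(Q^i)`, and differentiating `u = f(z)` along it is the required identity at `v`
(`identity_at_point`).  Both sides are analytic, so the identity spreads to the whole connected
component (`isMiuraOn_connectedComponentIn`).

For the density statement, note that where the `z^i_j`, `j ≤ d_i`, are coordinates at `𝒮(x)`, the
determinant of the `∂z^i_{d_i+1}/∂u^j` is non-zero exactly if `u ↦ M(u) g H` is an immersion.  The
latter condition does not involve the `z^i`: it is implied by the non-vanishing of a determinant
that is analytic on the connected manifold `G × V` and not identically zero, so it holds on an open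
dense set as soon as it holds at one point (`exists_rank_function`).  The local solutions `f` and
`Q` at the points `𝒮^j(x)` can be glued because their arguments there are distinct for generic `x`
(`isGeneric_zFull_ne`).
-/

/-! ### Inverse functions, submersions and factorization of analytic maps -/

section Analysis

variable {X Y F : Type} [NormedAddCommGroup X] [NormedSpace ℂ X] [NormedAddCommGroup Y]
  [NormedSpace ℂ Y] [NormedAddCommGroup F] [NormedSpace ℂ F]

/-- An analytic map whose differential is invertible has an analytic local inverse. -/
theorem exists_analytic_localInverse [CompleteSpace X] [CompleteSpace Y] {f : X → Y} {a : X} {e : X ≃L[ℂ] Y}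
    (hf : AnalyticAt ℂ f a) (h : fderiv ℂ f a = e) :
    ∃ g : Y → X, AnalyticAt ℂ g (f a) ∧ g (f a) = a ∧ (∀ᶠ x in 𝓝 a, g (f x) = x) ∧
      ∀ᶠ y in 𝓝 (f a), f (g y) = y := by
  have hs : HasStrictFDerivAt f (e : X →L[ℂ] Y) a := h ▸ hf.hasStrictFDerivAt
  have ha : a ∈ (hs.toOpenPartialHomeomorph f).source := hs.mem_toOpenPartialHomeomorph_source
  have hc : ((hs.toOpenPartialHomeomorph f : OpenPartialHomeomorph X Y) : X → Y) = f :=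
    hs.toOpenPartialHomeomorph_coe
  refine ⟨(hs.toOpenPartialHomeomorph f).symm, ?_, ?_, ?_, ?_⟩
  · have := (hs.toOpenPartialHomeomorph f).analyticAt_symm' (i := e) ha (by rwa [hc]) (by rwa [hc])
    rwa [hc] at this
  · have := (hs.toOpenPartialHomeomorph f).left_inv ha
    rwa [hc] at this
  · have := (hs.toOpenPartialHomeomorph f).eventually_left_inverse ha
    rwa [hc] at this
  · have := (hs.toOpenPartialHomeomorph f).eventually_right_inverse' ha
    rwa [hc] at this

/-- Local normal form of an analytic submersion `φ`: it has an analytic section `σ`, and every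
analytic `W` whose differential vanishes on the tangent spaces of the fibres of `φ` satisfies
`W = W ∘ σ ∘ φ`. -/
theorem exists_analytic_section [FiniteDimensional ℂ X] [FiniteDimensional ℂ Y] {φ : X → Y}
    {x₀ : X} (hφ : AnalyticAt ℂ φ x₀) (hs : Function.Surjective (fderiv ℂ φ x₀)) :
    ∃ σ : Y → X, AnalyticAt ℂ σ (φ x₀) ∧ σ (φ x₀) = x₀ ∧ (∀ᶠ p in 𝓝 (φ x₀), φ (σ p) = p) ∧
      ∀ (F : Type) [NormedAddCommGroup F] [NormedSpace ℂ F] [CompleteSpace F] (W : X → F),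
        AnalyticAt ℂ W x₀ →
        (∀ᶠ x in 𝓝 x₀, ∀ v, fderiv ℂ φ x v = 0 → fderiv ℂ W x v = 0) →
        ∀ᶠ x in 𝓝 x₀, W x = W (σ (φ x)) := by
  have : CompleteSpace X := FiniteDimensional.complete ℂ X
  have : CompleteSpace Y := FiniteDimensional.complete ℂ Y
  set K : Submodule ℂ X := (fderiv ℂ φ x₀).ker with hK
  have : CompleteSpace K := FiniteDimensional.complete ℂ K
  obtain ⟨P, hP⟩ : K.ClosedComplemented := Submodule.ClosedComplemented.of_finiteDimensional K
  have hbij : Function.Bijective ((fderiv ℂ φ x₀).prod P) := by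
    constructor
    · rw [injective_iff_map_eq_zero]
      intro x hx
      have h1 : fderiv ℂ φ x₀ x = 0 := congrArg Prod.fst hx
      have h2 : P x = 0 := congrArg Prod.snd hx
      have h3 := hP ⟨x, h1⟩
      rw [h2] at h3
      exact (congrArg Subtype.val h3).symm
    · rintro ⟨y, κ⟩
      obtain ⟨x, rfl⟩ := hs y
      refine ⟨x + ((κ - P x : K) : X), ?_⟩
      have h1 : fderiv ℂ φ x₀ ((κ - P x : K) : X) = 0 := (κ - P x).2
      refine Prod.ext ?_ ?_
      · simp
      · change P (x + ((κ - P x : K) : X)) = κ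
        rw [map_add, hP]
        abel
  -- the chart `x ↦ (φ x, P (x - x₀))` straightens the fibres of `φ`
  let e : X ≃L[ℂ] Y × K :=
    (LinearEquiv.ofBijective (((fderiv ℂ φ x₀).prod P : X →L[ℂ] Y × K) : X →ₗ[ℂ] Y × K)
      hbij).toContinuousLinearEquiv
  have hΘa : AnalyticAt ℂ (fun x => (φ x, P (x - x₀))) x₀ :=
    hφ.prod ((P.analyticAt _).comp (analyticAt_id.sub analyticAt_const))
  have hΘd : fderiv ℂ (fun x => (φ x, P (x - x₀))) x₀ = e := by
    have h1 : HasFDerivAt (fun x => P (x - x₀)) P x₀ :=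
      P.hasFDerivAt.comp x₀ ((hasFDerivAt_id x₀).sub_const x₀)
    rw [(hφ.differentiableAt.hasFDerivAt.prodMk h1).fderiv]
    rfl
  obtain ⟨g, hga, hg0, hgl, hgr⟩ := exists_analytic_localInverse hΘa hΘd
  simp only [sub_self, map_zero] at hga hg0 hgr
  have hi : AnalyticAt ℂ (fun p : Y => (p, (0 : K))) (φ x₀) := analyticAt_id.prod analyticAt_const
  refine ⟨fun p => g (p, 0), hga.comp_of_eq hi rfl, hg0, ?_, ?_⟩
  · have := hi.continuousAt.eventually hgr
    filter_upwards [this] with p hp using congrArg Prod.fst hp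
  · intro F _ _ _ W hW hker
    have hgt : Tendsto g (𝓝 (φ x₀, 0)) (𝓝 x₀) := by
      have := hga.continuousAt.tendsto
      rwa [hg0] at this
    have hev : ∀ᶠ q in 𝓝 (φ x₀, (0 : K)), AnalyticAt ℂ g q ∧
        (∀ᶠ q' in 𝓝 q, φ (g q') = q'.1) ∧ AnalyticAt ℂ W (g q) ∧ AnalyticAt ℂ φ (g q) ∧
        ∀ v, fderiv ℂ φ (g q) v = 0 → fderiv ℂ W (g q) v = 0 := by
      refine hga.eventually_analyticAt.and (Filter.Eventually.and ?_ ?_)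
      · filter_upwards [hgr.eventually_nhds] with q hq
        filter_upwards [hq] with q' h using congrArg Prod.fst h
      · exact (hgt.eventually hW.eventually_analyticAt).and
          ((hgt.eventually hφ.eventually_analyticAt).and (hgt.eventually hker))
    obtain ⟨ε, hε, hball⟩ := Metric.eventually_nhds_iff_ball.1 hev
    have hΘc : Tendsto (fun x => (φ x, P (x - x₀))) (𝓝 x₀) (𝓝 (φ x₀, 0)) := by
      simpa using hΘa.continuousAt.tendsto
    filter_upwards [hgl, hΘc.eventually (Metric.ball_mem_nhds _ hε)] with x hx hxb
    have hxb' : φ x ∈ Metric.ball (φ x₀) ε ∧ P (x - x₀) ∈ Metric.ball (0 : K) ε := by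
      have : (φ x, P (x - x₀)) ∈ Metric.ball (φ x₀, (0 : K)) ε := hxb
      rwa [← ball_prod_same] at this
    have hmem : ∀ κ ∈ Metric.ball (0 : K) ε, (φ x, κ) ∈ Metric.ball (φ x₀, (0 : K)) ε := by
      intro κ hκ
      rw [← ball_prod_same]
      exact ⟨hxb'.1, hκ⟩
    -- the restriction of `W ∘ g` to the fibre has zero derivative
    have hder : ∀ κ ∈ Metric.ball (0 : K) ε,
        HasFDerivAt (fun κ : K => W (g (φ x, κ))) (0 : K →L[ℂ] F) κ := by
      intro κ hκ
      obtain ⟨h1, h2, h3, h4, h5⟩ := hball _ (hmem κ hκ)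
      have hin : HasFDerivAt (fun κ : K => (φ x, κ)) (ContinuousLinearMap.inr ℂ Y K) κ :=
        hasFDerivAt_prodMk_right _ _
      have hgd : HasFDerivAt (fun κ : K => g (φ x, κ))
          ((fderiv ℂ g (φ x, κ)).comp (ContinuousLinearMap.inr ℂ Y K)) κ :=
        h1.differentiableAt.hasFDerivAt.comp κ hin
      have hφd := (h4.differentiableAt.hasFDerivAt (f := φ)).comp κ hgd
      have hφ0 : HasFDerivAt (φ ∘ fun κ : K => g (φ x, κ)) (0 : K →L[ℂ] Y) κ := by
        refine (hasFDerivAt_const (φ x) κ).congr_of_eventuallyEq ?_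
        have := hin.continuousAt.eventually h2
        filter_upwards [this] with κ' h' using h'
      have heq := hφd.unique hφ0
      refine ((h3.differentiableAt.hasFDerivAt (f := W)).comp κ hgd).congr_fderiv ?_
      ext v
      exact h5 _ (congrArg (fun L : K →L[ℂ] Y => L v) heq)
    have := IsOpen.is_const_of_fderiv_eq_zero (𝕜 := ℂ) (f := fun κ : K => W (g (φ x, κ)))
      Metric.isOpen_ball (convex_ball (0 : K) ε).isPreconnected
      (fun κ hκ => (hder κ hκ).differentiableAt.differentiableWithinAt)
      (fun κ hκ => (hder κ hκ).fderiv) hxb'.2 (Metric.mem_ball_self hε)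
    simp only [hx] at this
    exact this

/-- Surjectivity of the differential is an open condition. -/
theorem AnalyticAt.eventually_surjective_fderiv [FiniteDimensional ℂ X] [FiniteDimensional ℂ Y]
    {φ : X → Y} {x₀ : X} (hφ : AnalyticAt ℂ φ x₀) (hs : Function.Surjective (fderiv ℂ φ x₀)) :
    ∀ᶠ x in 𝓝 x₀, Function.Surjective (fderiv ℂ φ x) := by
  have : CompleteSpace Y := FiniteDimensional.complete ℂ Y
  have : CompleteSpace X := FiniteDimensional.complete ℂ X
  obtain ⟨s, hs'⟩ := (fderiv ℂ φ x₀ : X →ₗ[ℂ] Y).exists_rightInverse_of_surjective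
    (LinearMap.range_eq_top.2 hs)
  let s' : Y →L[ℂ] X := LinearMap.toContinuousLinearMap s
  have h1 : (fderiv ℂ φ x₀).comp s' = 1 := by
    ext y
    exact LinearMap.congr_fun hs' y
  have hc : ContinuousAt (fun x => (fderiv ℂ φ x).comp s') x₀ :=
    hφ.fderiv.continuousAt.clm_comp continuousAt_const
  have h2 : ∀ᶠ T in 𝓝 ((fderiv ℂ φ x₀).comp s'), IsUnit T :=
    Units.isOpen.mem_nhds (by rw [h1]; exact isUnit_one)
  filter_upwards [hc.eventually h2] with x hx y
  obtain ⟨T, hT⟩ := hx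
  refine ⟨s' ((↑T⁻¹ : Y →L[ℂ] Y) y), ?_⟩
  have := congrArg (fun L : Y →L[ℂ] Y => L ((↑T⁻¹ : Y →L[ℂ] Y) y)) hT
  have h3 : (T : Y →L[ℂ] Y) ((↑T⁻¹ : Y →L[ℂ] Y) y) = y := by
    rw [← mul_apply_eq_comp, T.mul_inv, one_apply_eq_self]
  rw [h3] at this
  exact this.symm

/-- The equation `F (p, u) = q` can be solved for `u` near a point at which the partial
differential of `F` in `u` is injective. -/
theorem exists_analytic_solution {P U : Type} [NormedAddCommGroup P] [NormedSpace ℂ P]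
    [NormedAddCommGroup U] [NormedSpace ℂ U] [FiniteDimensional ℂ P] [FiniteDimensional ℂ U]
    {G : P × U → U} {p₀ : P} {u₀ : U} (hG : AnalyticAt ℂ G (p₀, u₀))
    (hinj : ∀ e, fderiv ℂ G (p₀, u₀) (0, e) = 0 → e = 0) :
    ∃ f : P × U → U, AnalyticAt ℂ f (p₀, G (p₀, u₀)) ∧ f (p₀, G (p₀, u₀)) = u₀ ∧
      (∀ᶠ x in 𝓝 (p₀, u₀), f (x.1, G x) = x.2) ∧
      ∀ᶠ y in 𝓝 (p₀, G (p₀, u₀)), G (y.1, f y) = y.2 := by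
  have : CompleteSpace P := FiniteDimensional.complete ℂ P
  have : CompleteSpace U := FiniteDimensional.complete ℂ U
  have hΘa : AnalyticAt ℂ (fun x : P × U => (x.1, G x)) (p₀, u₀) := analyticAt_fst.prod hG
  set L : P × U →L[ℂ] P × U := (ContinuousLinearMap.fst ℂ P U).prod (fderiv ℂ G (p₀, u₀)) with hL
  have hLinj : Function.Injective (L : P × U →ₗ[ℂ] P × U) := by
    rw [injective_iff_map_eq_zero]
    rintro ⟨p, u⟩ h
    have h1 : p = 0 := congrArg Prod.fst h
    subst h1
    have h2 : fderiv ℂ G (p₀, u₀) (0, u) = 0 := congrArg Prod.snd h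
    rw [hinj u h2]
    rfl
  let e : (P × U) ≃L[ℂ] P × U :=
    (LinearEquiv.ofInjectiveEndo (L : P × U →ₗ[ℂ] P × U) hLinj).toContinuousLinearEquiv
  have hΘd : fderiv ℂ (fun x : P × U => (x.1, G x)) (p₀, u₀) = e := by
    rw [(hasFDerivAt_fst.prodMk hG.differentiableAt.hasFDerivAt).fderiv]
    rfl
  obtain ⟨g, hga, hg0, hgl, hgr⟩ := exists_analytic_localInverse hΘa hΘd
  refine ⟨fun y => (g y).2, ?_, ?_, ?_, ?_⟩
  · exact analyticAt_snd.comp hga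
  · exact congrArg Prod.snd hg0
  · filter_upwards [hgl] with x hx using congrArg Prod.snd hx
  · filter_upwards [hgr] with y (hy : ((g y).1, G (g y)) = y)
    have h1 : (g y).1 = y.1 := (Prod.ext_iff.1 hy).1
    have h2 : G (g y) = y.2 := (Prod.ext_iff.1 hy).2
    rw [← h1]
    exact h2

/-- The function `f` on the open set of all points at which it is analytic. -/
def AnalyticFun.ofFun [CompleteSpace F] (f : X → F) : AnalyticFun X F where
  dom := {x | AnalyticAt ℂ f x}
  toFun := f
  isOpen_dom := isOpen_analyticAt ℂ f
  analytic := fun _ hx => hx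

/-- Germs of analytic functions at finitely many distinct points are germs of one function. -/
theorem exists_common_germ {X F : Type} [TopologicalSpace X] [T2Space X] [Zero F] {ι : Type} [Finite ι]
    {p : ι → X} (hp : Function.Injective p)
    (g : ι → X → F) : ∃ f : X → F, ∀ i, f =ᶠ[𝓝 (p i)] g i := by
  classical
  obtain ⟨U, hU, hd⟩ := (Set.finite_range p).t2_separation
  refine ⟨fun x => if h : ∃ i, x ∈ U (p i) then g h.choose x else 0, fun i => ?_⟩
  filter_upwards [(hU (p i)).2.mem_nhds (hU (p i)).1] with x hx
  have h : ∃ i, x ∈ U (p i) := ⟨i, hx⟩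
  have hi : h.choose = i := by
    by_contra hne
    exact Set.disjoint_left.1 (hd ⟨_, rfl⟩ ⟨_, rfl⟩ fun h' => hne (hp h')) h.choose_spec hx
  simp only [dif_pos h, hi]

/-- Linearly independent functionals are the components of a surjective map. -/
theorem surjective_pi_of_linearIndependent {ι : Type} [Fintype ι] {L : X →L[ℂ] (ι → ℂ)}
    (h : LinearIndependent ℂ fun i => (ContinuousLinearMap.proj (R := ℂ) (φ := fun _ : ι => ℂ) i).comp L) :
    Function.Surjective L := by
  classical
  by_contra hs
  have hr : (L : X →ₗ[ℂ] ι → ℂ).range < ⊤ := by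
    rw [lt_top_iff_ne_top]
    intro h'
    exact hs (LinearMap.range_eq_top.1 h')
  obtain ⟨f, hf, hle⟩ := Submodule.exists_le_ker_of_lt_top _ hr
  apply hf
  have hfx : ∀ w : ι → ℂ, f w = ∑ i, f (Pi.single i 1) * w i := by
    intro w
    conv_lhs => rw [← Finset.univ_sum_single w]
    rw [map_sum]
    refine Finset.sum_congr rfl fun i _ => ?_
    have : (Pi.single i (w i) : ι → ℂ) = w i • Pi.single i 1 := by
      rw [← Pi.single_smul, smul_eq_mul, mul_one]
    rw [this, map_smul, smul_eq_mul, mul_comm]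
  have hz := Fintype.linearIndependent_iff.1 h (fun i => f (Pi.single i 1)) (by
    ext x
    have : f (L x) = 0 := hle ⟨x, rfl⟩
    rw [hfx] at this
    simpa using this)
  ext w
  simp [hz]

end Analysis

/-! ### The algebra of matrix jets and its group of units -/

section JetAlgebra

variable {m d : ℕ} {k : Fin m → ℕ}

instance {l : ℕ} : FiniteDimensional ℂ (JetMat d l) :=
  inferInstanceAs (FiniteDimensional ℂ (Fin l → Fin d → Fin d → ℂ))

theorem JetMat.mul_apply' {l : ℕ} (A B : JetMat d l) (q : Fin l) :
    (A * B) q = ∑ s : Fin l, ∑ t : Fin l,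
      if (s : ℕ) + t = q then (A s * B t : Matrix (Fin d) (Fin d) ℂ) else 0 := rfl

theorem JetMat.mul_add' {l : ℕ} (A B C : JetMat d l) : A * (B + C) = A * B + A * C := by
  funext q
  change (A * (B + C)) q = (A * B) q + (A * C) q
  simp only [JetMat.mul_apply', ← Finset.sum_add_distrib]
  refine Finset.sum_congr rfl fun s _ => Finset.sum_congr rfl fun t _ => ?_
  split_ifs
  · exact mul_add _ _ _
  · exact (add_zero _).symm

theorem JetMat.add_mul' {l : ℕ} (A B C : JetMat d l) : (A + B) * C = A * C + B * C := by
  funext q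
  change ((A + B) * C) q = (A * C) q + (B * C) q
  simp only [JetMat.mul_apply', ← Finset.sum_add_distrib]
  refine Finset.sum_congr rfl fun s _ => Finset.sum_congr rfl fun t _ => ?_
  split_ifs
  · exact add_mul _ _ _
  · exact (add_zero _).symm

theorem JetMat.smul_mul' {l : ℕ} (x : ℂ) (A B : JetMat d l) : (x • A) * B = x • (A * B) := by
  funext q
  change ((x • A) * B) q = (x • (A * B) q : Matrix (Fin d) (Fin d) ℂ)
  simp only [JetMat.mul_apply', Finset.smul_sum]
  refine Finset.sum_congr rfl fun s _ => Finset.sum_congr rfl fun t _ => ?_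
  split_ifs
  · exact Matrix.smul_mul x (A s : Matrix (Fin d) (Fin d) ℂ) (B t)
  · exact (smul_zero x).symm

theorem JetMat.mul_smul' {l : ℕ} (x : ℂ) (A B : JetMat d l) : A * (x • B) = x • (A * B) := by
  funext q
  change (A * (x • B)) q = (x • (A * B) q : Matrix (Fin d) (Fin d) ℂ)
  simp only [JetMat.mul_apply', Finset.smul_sum]
  refine Finset.sum_congr rfl fun s _ => Finset.sum_congr rfl fun t _ => ?_
  split_ifs
  · exact Matrix.mul_smul (A s : Matrix (Fin d) (Fin d) ℂ) x (B t)
  · exact (smul_zero x).symm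

/-- Multiplication of jets as a continuous bilinear map. -/
noncomputable def jetMul : JetAlg d k →L[ℂ] JetAlg d k →L[ℂ] JetAlg d k :=
  LinearMap.toContinuousLinearMap
    ((LinearMap.toContinuousLinearMap (𝕜 := ℂ) (E := JetAlg d k) (F' := JetAlg d k)).toLinearMap ∘ₗ
      LinearMap.mk₂ ℂ (fun A B : JetAlg d k => A * B)
        (fun A B C => funext fun p => JetMat.add_mul' (A p) (B p) (C p))
        (fun x A B => funext fun p => JetMat.smul_mul' x (A p) (B p))
        (fun A B C => funext fun p => JetMat.mul_add' (A p) (B p) (C p))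
        (fun x A B => funext fun p => JetMat.mul_smul' x (A p) (B p)))

theorem jetMul_apply (A B : JetAlg d k) : jetMul A B = A * B := rfl

theorem JetAlg.sub_mul (A B C : JetAlg d k) : (A - B) * C = A * C - B * C := by
  simp only [← jetMul_apply, map_sub, sub_apply]

theorem JetAlg.mul_zero (A : JetAlg d k) : A * 0 = 0 := (jetMul A).map_zero

section

variable {X : Type} [NormedAddCommGroup X] [NormedSpace ℂ X]

theorem AnalyticAt.jetMul {f g : X → JetAlg d k} {x : X} (hf : AnalyticAt ℂ f x)
    (hg : AnalyticAt ℂ g x) : AnalyticAt ℂ (fun x => f x * g x) x :=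
  ((_root_.jetMul (d := d) (k := k)).analyticAt_bilinear (f x, g x)).comp_of_eq
    (f := fun x => (f x, g x)) (hf.prod hg) rfl

theorem HasFDerivAt.jetMul {f g : X → JetAlg d k} {f' g' : X →L[ℂ] JetAlg d k} {x : X}
    (hf : HasFDerivAt f f' x) (hg : HasFDerivAt g g' x) :
    HasFDerivAt (fun x => f x * g x)
      ((_root_.jetMul (f x)).comp g' + ((_root_.jetMul (d := d) (k := k)).flip (g x)).comp f') x := by
  have := ((_root_.jetMul (d := d) (k := k)).hasFDerivAt (x := f x)).comp x hf |>.clm_apply hg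
  exact this

end

theorem HasDerivAt.jetMul {f g : ℂ → JetAlg d k} {f' g' : JetAlg d k} {x : ℂ}
    (hf : HasDerivAt f f' x) (hg : HasDerivAt g g' x) :
    HasDerivAt (fun x => f x * g x) (f x * g' + f' * g x) x := by
  have := (HasFDerivAt.jetMul hf.hasFDerivAt hg.hasFDerivAt).hasDerivAt
  simpa [jetMul_apply] using this

instance : ContinuousMul (JetAlg d k) :=
  ⟨(_root_.jetMul (d := d) (k := k)).continuous₂⟩

theorem isUnit_jetMul_iff (A : JetAlg d k) : IsUnit (jetMul A) ↔ IsUnit A := by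
  constructor
  · rintro ⟨T, hT⟩
    have h1 : A * (↑T⁻¹ : JetAlg d k →L[ℂ] JetAlg d k) 1 = 1 := by
      rw [← jetMul_apply, ← hT, ← mul_apply_eq_comp, T.mul_inv, one_apply_eq_self]
    have hinj : Function.Injective (jetMul A) := by
      intro B C h
      have := congrArg (↑T⁻¹ : JetAlg d k →L[ℂ] JetAlg d k) h
      rwa [← hT, ← mul_apply_eq_comp, ← mul_apply_eq_comp, T.inv_mul, one_apply_eq_self,
        one_apply_eq_self] at this
    refine ⟨⟨A, _, h1, hinj ?_⟩, rfl⟩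
    rw [jetMul_apply, jetMul_apply, ← mul_assoc, h1, one_mul, mul_one]
  · rintro ⟨g, rfl⟩
    refine ⟨⟨jetMul (g : JetAlg d k), jetMul (↑g⁻¹ : JetAlg d k), ?_, ?_⟩, rfl⟩ <;>
    · ext1 B
      simp only [mul_apply_eq_comp, jetMul_apply, ← mul_assoc, Units.mul_inv, Units.inv_mul, one_mul,
        one_apply_eq_self]

/-- Inversion in the algebra of jets, through the inverse of left multiplication. -/
noncomputable def jetInv (A : JetAlg d k) : JetAlg d k := Ring.inverse (jetMul A) 1

theorem jetInv_coe (g : JetGroup d k) : jetInv (g : JetAlg d k) = ↑g⁻¹ := by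
  obtain ⟨T, hT⟩ := (isUnit_jetMul_iff (g : JetAlg d k)).2 g.isUnit
  have h1 : (↑T⁻¹ : JetAlg d k →L[ℂ] JetAlg d k) (jetMul (g : JetAlg d k) ↑g⁻¹) = ↑g⁻¹ := by
    rw [← hT, ← mul_apply_eq_comp, T.inv_mul, one_apply_eq_self]
  rw [jetInv, ← hT, Ring.inverse_unit]
  rwa [jetMul_apply, Units.mul_inv] at h1

theorem analyticAt_jetInv (g : JetGroup d k) : AnalyticAt ℂ jetInv (g : JetAlg d k) := by
  obtain ⟨T, hT⟩ := (isUnit_jetMul_iff (g : JetAlg d k)).2 g.isUnit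
  have h : AnalyticAt ℂ (fun A : JetAlg d k => Ring.inverse (jetMul A)) (g : JetAlg d k) :=
    (analyticAt_inverse (𝕜 := ℂ) T).comp_of_eq ((jetMul (d := d) (k := k)).analyticAt _) hT.symm
  exact ((ContinuousLinearMap.apply ℂ (JetAlg d k) (1 : JetAlg d k)).analyticAt _).comp h

theorem isOpen_isUnit_jetAlg : IsOpen {A : JetAlg d k | IsUnit A} := by
  have : {A : JetAlg d k | IsUnit A} = jetMul ⁻¹' {T | IsUnit T} := by
    ext A
    exact (isUnit_jetMul_iff A).symm
  rw [this]
  exact Units.isOpen.preimage (jetMul (d := d) (k := k)).continuous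

theorem isOpenEmbedding_jetVal :
    IsOpenEmbedding (fun g : JetGroup d k => (g : JetAlg d k)) where
  toIsEmbedding := Units.isEmbedding_val_mk' (f := jetInv)
    (fun A hA => by
      obtain ⟨g, rfl⟩ := hA
      exact (analyticAt_jetInv g).continuousAt.continuousWithinAt) jetInv_coe
  isOpen_range := isOpen_isUnit_jetAlg

open Classical in
/-- A jet as an element of the group, if it is invertible (and `1` otherwise). -/
noncomputable def toJetGroup (A : JetAlg d k) : JetGroup d k := if h : IsUnit A then h.unit else 1

theorem toJetGroup_coe (g : JetGroup d k) : toJetGroup (g : JetAlg d k) = g := by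
  unfold toJetGroup
  rw [dif_pos g.isUnit]
  exact Units.ext rfl

theorem eventually_toJetGroup (g : JetGroup d k) :
    ∀ᶠ A in 𝓝 (g : JetAlg d k), (toJetGroup A : JetAlg d k) = A := by
  filter_upwards [isOpen_isUnit_jetAlg.mem_nhds g.isUnit] with A hA
  obtain ⟨g', rfl⟩ := hA
  rw [toJetGroup_coe]

theorem continuousAt_toJetGroup (g : JetGroup d k) : ContinuousAt toJetGroup (g : JetAlg d k) := by
  rw [isOpenEmbedding_jetVal.isInducing.continuousAt_iff]
  refine continuousAt_id.congr ?_
  filter_upwards [eventually_toJetGroup g] with A hA using hA.symm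

theorem inCoords_coe (φ : JetGroup d k → ℂ) (g : JetGroup d k) :
    inCoords φ (g : JetAlg d k) = φ g :=
  Units.val_injective.extend_apply φ 0 g

/-- Outside `G` both sides have the value `0`, as `A` is invertible exactly if `t A` is. -/
theorem inCoords_mul_left (φ : JetGroup d k → ℂ) (t : JetGroup d k) :
    (inCoords fun g => φ (t * g)) = fun A => inCoords φ ((t : JetAlg d k) * A) := by
  funext A
  by_cases hA : IsUnit A
  · obtain ⟨g, rfl⟩ := hA
    rw [← Units.val_mul, inCoords_coe, inCoords_coe]
  · have h2 : ¬ ∃ g : JetGroup d k, (g : JetAlg d k) = A := fun ⟨g, hg⟩ => hA ⟨g, hg⟩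
    have h3 : ¬ ∃ g : JetGroup d k, (g : JetAlg d k) = (t : JetAlg d k) * A := by
      rintro ⟨g, hg⟩
      refine h2 ⟨t⁻¹ * g, ?_⟩
      rw [Units.val_mul, hg, ← mul_assoc, Units.inv_mul, one_mul]
    rw [inCoords, inCoords, Function.extend_apply' _ _ _ h2, Function.extend_apply' _ _ _ h3]
    rfl

/-- The group `G` is connected: two of its elements lie on a complex line, which meets the set of
non-invertible jets in a finite set. -/
theorem isPreconnected_isUnit_jetAlg : IsPreconnected {A : JetAlg d k | IsUnit A} := by
  refine isPreconnected_of_forall_pair ?_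
  rintro _ ⟨A, rfl⟩ _ ⟨B, rfl⟩
  -- `A⁻¹ (A + t (B - A)) = 1 + t T` with `T = A⁻¹ B - 1` is singular only if `-1/t` is an
  -- eigenvalue of `T`
  let T : Module.End ℂ (JetAlg d k) := (jetMul ((A⁻¹ * B : JetGroup d k) : JetAlg d k) : _ →ₗ[ℂ] _) - 1
  let γ : ℂ → JetAlg d k := fun t => (A : JetAlg d k) + t • ((B : JetAlg d k) - A)
  let S : Set ℂ := (fun μ => -μ⁻¹) '' (spectrum ℂ T \ {0})
  have hS : S.Countable := ((Module.End.finite_spectrum T).subset sdiff_subset).countable.image _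
  have hunit : ∀ t ∈ Sᶜ, IsUnit (γ t) := by
    intro t ht
    rcases eq_or_ne t 0 with rfl | h0
    · simp [γ]
    have h1 : -t⁻¹ ∉ spectrum ℂ T := fun h => ht ⟨_, ⟨h, by simpa using h0⟩, by simp⟩
    have h2 : IsUnit (algebraMap ℂ (Module.End ℂ (JetAlg d k)) (-t⁻¹) - T) := by
      simpa [spectrum.mem_iff] using h1
    have hinj : Function.Injective (jetMul (γ t) : JetAlg d k →ₗ[ℂ] JetAlg d k) := by
      rw [injective_iff_map_eq_zero]
      intro C hC
      have hC' : γ t * C = 0 := hC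
      have h3 : (algebraMap ℂ (Module.End ℂ (JetAlg d k)) (-t⁻¹) - T) C = 0 := by
        have h4 : (C : JetAlg d k) + t • (((A⁻¹ * B : JetGroup d k) : JetAlg d k) * C - C) = 0 := by
          have h5 : ((A⁻¹ : JetGroup d k) : JetAlg d k) * (γ t * C) = 0 := by
            rw [hC', JetAlg.mul_zero]
          rw [← h5]
          simp only [γ, ← jetMul_apply, map_add, map_sub, map_smul, add_apply, smul_apply, sub_apply]
          simp only [jetMul_apply, ← mul_assoc, Units.val_mul, Units.inv_mul, one_mul]
        have h6 : C = -(t • (((A⁻¹ * B : JetGroup d k) : JetAlg d k) * C - C)) :=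
          eq_neg_of_add_eq_zero_left h4
        change (-t⁻¹) • C - (((A⁻¹ * B : JetGroup d k) : JetAlg d k) * C - C) = 0
        nth_rewrite 1 [h6]
        rw [smul_neg, neg_smul, neg_neg, smul_smul, inv_mul_cancel₀ h0, one_smul, sub_self]
      have h7 := (Module.End.isUnit_iff _).1 h2
      exact h7.1 (by rw [h3, map_zero])
    rw [← isUnit_jetMul_iff]
    exact ⟨ContinuousLinearEquiv.toUnit
      (LinearEquiv.ofInjectiveEndo _ hinj).toContinuousLinearEquiv, rfl⟩
  have hconn : IsPreconnected Sᶜ :=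
    (hS.isPathConnected_compl_of_one_lt_rank (by simp)).isConnected.isPreconnected
  refine ⟨γ '' Sᶜ, ?_, ?_, ?_, hconn.image γ (by fun_prop)⟩
  · rintro _ ⟨t, ht, rfl⟩
    exact hunit t ht
  · refine ⟨0, ?_, by simp [γ]⟩
    rintro ⟨μ, hμ, h⟩
    exact hμ.2 (by simpa using h)
  · refine ⟨1, ?_, by simp [γ]⟩
    rintro ⟨μ, hμ, h⟩
    have h0 : μ = -1 := by
      have : -μ⁻¹ = 1 := h
      rw [← inv_inv μ, ← neg_neg μ⁻¹, this]
      norm_num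
    subst h0
    refine spectrum.mem_iff.1 hμ.1 ?_
    have h1 : algebraMap ℂ (Module.End ℂ (JetAlg d k)) (-1) - T =
        -(jetMul ((A⁻¹ * B : JetGroup d k) : JetAlg d k) : JetAlg d k →ₗ[ℂ] JetAlg d k) := by
      simp only [T, map_neg, map_one]
      abel
    rw [h1]
    exact (((isUnit_jetMul_iff _).2 (A⁻¹ * B).isUnit).map
      (ContinuousLinearMap.toLinearMapRingHom (R₁ := ℂ) (M₁ := JetAlg d k))).neg

end JetAlgebra

/-! ### Taylor expansions of matrix functions depending on parameters -/

section Jets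

variable {m d : ℕ} {c : Fin m → ℂ} {k : Fin m → ℕ}

/-- The Taylor series at `x` of a matrix function. -/
noncomputable def taylorSeries (A : ℂ → Matrix (Fin d) (Fin d) ℂ) (x : ℂ) :
    PowerSeries (Matrix (Fin d) (Fin d) ℂ) :=
  PowerSeries.mk fun n => Matrix.of fun i j =>
    ((n.factorial : ℂ))⁻¹ * iteratedDeriv n (fun lam => A lam i j) x

theorem jet_apply_eq_trunc (A : ℂ → Matrix (Fin d) (Fin d) ℂ) (p : Fin m) :
    jet c k A p = JetMat.trunc (taylorSeries A (c p)) := by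
  funext q
  simp [jet, JetMat.trunc, taylorSeries]

theorem taylorSeries_mul {A B : ℂ → Matrix (Fin d) (Fin d) ℂ} {x : ℂ}
    (hA : ∀ i j, AnalyticAt ℂ (fun lam => A lam i j) x)
    (hB : ∀ i j, AnalyticAt ℂ (fun lam => B lam i j) x) :
    taylorSeries (fun lam => A lam * B lam) x = taylorSeries A x * taylorSeries B x := by
  ext n i j
  rw [PowerSeries.coeff_mul, Matrix.sum_apply,
    Finset.Nat.sum_antidiagonal_eq_sum_range_succ_mk]
  simp only [taylorSeries, PowerSeries.coeff_mk, Matrix.of_apply, Matrix.mul_apply]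
  have hsum : iteratedDeriv n (fun lam => ∑ l, A lam i l * B lam l j) x =
      ∑ l, iteratedDeriv n (fun lam => A lam i l * B lam l j) x :=
    iteratedDeriv_fun_sum fun l _ => ((hA i l).mul (hB l j)).contDiffAt
  rw [Finset.sum_comm, hsum, Finset.mul_sum]
  refine Finset.sum_congr rfl fun l _ => ?_
  rw [iteratedDeriv_fun_mul (hA i l).contDiffAt (hB l j).contDiffAt, Finset.mul_sum]
  refine Finset.sum_congr rfl fun s hs => ?_
  have hs' : s ≤ n := Nat.lt_succ_iff.1 (Finset.mem_range.1 hs)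
  rw [Nat.cast_choose ℂ hs']
  have h1 : (n.factorial : ℂ) ≠ 0 := by exact_mod_cast n.factorial_ne_zero
  field_simp

theorem jet_mul {A B : ℂ → Matrix (Fin d) (Fin d) ℂ}
    (hA : ∀ p i j, AnalyticAt ℂ (fun lam => A lam i j) (c p))
    (hB : ∀ p i j, AnalyticAt ℂ (fun lam => B lam i j) (c p)) :
    jet c k (fun lam => A lam * B lam) = jet c k A * jet c k B := by
  funext p
  rw [Pi.mul_apply]
  simp only [jet_apply_eq_trunc, taylorSeries_mul (hA p) (hB p), JetMat.trunc_mul]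

theorem jet_one : jet c k (fun _ => (1 : Matrix (Fin d) (Fin d) ℂ)) = 1 := by
  funext p
  rw [jet_apply_eq_trunc, Pi.one_apply, ← JetMat.trunc_one]
  congr 1
  ext n i j
  rw [PowerSeries.coeff_one]
  rcases Nat.eq_zero_or_pos n with rfl | hn
  · simp [taylorSeries]
  · simp [taylorSeries, iteratedDeriv_const, hn.ne']

theorem jet_sub {A B : ℂ → Matrix (Fin d) (Fin d) ℂ}
    (hA : ∀ p i j, AnalyticAt ℂ (fun lam => A lam i j) (c p))
    (hB : ∀ p i j, AnalyticAt ℂ (fun lam => B lam i j) (c p)) :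
    jet c k (fun lam => A lam - B lam) = jet c k A - jet c k B := by
  funext p q
  ext i j
  change ((q : ℕ).factorial : ℂ)⁻¹ * iteratedDeriv (q : ℕ) (fun lam => A lam i j - B lam i j) (c p) =
    ((q : ℕ).factorial : ℂ)⁻¹ * iteratedDeriv (q : ℕ) (fun lam => A lam i j) (c p) -
    ((q : ℕ).factorial : ℂ)⁻¹ * iteratedDeriv (q : ℕ) (fun lam => B lam i j) (c p)
  rw [iteratedDeriv_fun_sub (hA p i j).contDiffAt (hB p i j).contDiffAt, mul_sub]

theorem jet_congr {A B : ℂ → Matrix (Fin d) (Fin d) ℂ} (h : ∀ p, A =ᶠ[𝓝 (c p)] B) :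
    jet c k A = jet c k B := by
  funext p q
  ext i j
  change ((q : ℕ).factorial : ℂ)⁻¹ * iteratedDeriv (q : ℕ) (fun lam => A lam i j) (c p) =
    ((q : ℕ).factorial : ℂ)⁻¹ * iteratedDeriv (q : ℕ) (fun lam => B lam i j) (c p)
  rw [Filter.EventuallyEq.iteratedDeriv_eq]
  filter_upwards [h p] with lam hl
  rw [hl]

theorem rho_coe (A : ℂ → GL (Fin d) ℂ) :
    (rho c k A : JetAlg d k) = jet c k fun lam => (A lam : Matrix (Fin d) (Fin d) ℂ) := rfl

theorem rho_mul {A B : ℂ → GL (Fin d) ℂ}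
    (hA : ∀ p i j, AnalyticAt ℂ (fun lam => (A lam : Matrix (Fin d) (Fin d) ℂ) i j) (c p))
    (hB : ∀ p i j, AnalyticAt ℂ (fun lam => (B lam : Matrix (Fin d) (Fin d) ℂ) i j) (c p)) :
    rho c k (A * B) = rho c k A * rho c k B :=
  Units.ext (jet_mul hA hB)

theorem rho_one : rho c k (1 : ℂ → GL (Fin d) ℂ) = 1 := Units.ext jet_one

theorem AnalyticAt.matrix_det {X : Type} [NormedAddCommGroup X] [NormedSpace ℂ X]
    {A : X → Matrix (Fin d) (Fin d) ℂ} {x : X} (hA : ∀ i j, AnalyticAt ℂ (fun x => A x i j) x) :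
    AnalyticAt ℂ (fun x => (A x).det) x := by
  simp only [Matrix.det_apply, zsmul_eq_mul, Units.smul_def]
  exact Finset.analyticAt_fun_sum _ fun σ _ =>
    analyticAt_const.mul (Finset.analyticAt_fun_prod _ fun i _ => hA _ _)

theorem AnalyticAt.coe_GL_mul {A B : ℂ → GL (Fin d) ℂ} {x : ℂ}
    (hA : ∀ i j, AnalyticAt ℂ (fun lam => (A lam : Matrix (Fin d) (Fin d) ℂ) i j) x)
    (hB : ∀ i j, AnalyticAt ℂ (fun lam => (B lam : Matrix (Fin d) (Fin d) ℂ) i j) x) (i j : Fin d) :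
    AnalyticAt ℂ (fun lam => ((A * B) lam : Matrix (Fin d) (Fin d) ℂ) i j) x := by
  simp only [Pi.mul_apply, Units.val_mul, Matrix.mul_apply]
  exact Finset.analyticAt_fun_sum _ fun l _ => (hA i l).mul (hB l j)

theorem AnalyticAt.coe_GL_inv {A : ℂ → GL (Fin d) ℂ} {x : ℂ}
    (hA : ∀ i j, AnalyticAt ℂ (fun lam => (A lam : Matrix (Fin d) (Fin d) ℂ) i j) x) (i j : Fin d) :
    AnalyticAt ℂ (fun lam => (A⁻¹ lam : Matrix (Fin d) (Fin d) ℂ) i j) x := by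
  simp only [Pi.inv_apply, Matrix.coe_units_inv, Matrix.inv_def, Matrix.smul_apply, smul_eq_mul,
    Ring.inverse_eq_inv', Matrix.adjugate_apply]
  refine ((AnalyticAt.matrix_det hA).inv ?_).mul (AnalyticAt.matrix_det fun i' j' => ?_)
  · exact ((Matrix.isUnit_iff_isUnit_det _).1 (A x).isUnit).ne_zero
  · simp only [Matrix.updateRow_apply]
    split_ifs
    · exact analyticAt_const
    · exact hA _ _

theorem rho_inv {A : ℂ → GL (Fin d) ℂ}
    (hA : ∀ p i j, AnalyticAt ℂ (fun lam => (A lam : Matrix (Fin d) (Fin d) ℂ) i j) (c p)) :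
    rho c k A⁻¹ = (rho c k A)⁻¹ := by
  refine eq_inv_of_mul_eq_one_left ?_
  rw [← rho_mul (fun p => AnalyticAt.coe_GL_inv (hA p)) hA, inv_mul_cancel, rho_one]

section Parameters

variable {X : Type} [NormedAddCommGroup X] [NormedSpace ℂ X] {S : Set X} {Λ : Set ℂ}

theorem deriv_param {f : X × ℂ → ℂ} {x : X} {lam : ℂ} (hf : AnalyticAt ℂ f (x, lam)) :
    deriv (fun l => f (x, l)) lam = fderiv ℂ f (x, lam) (0, 1) := by
  have h := hf.differentiableAt.hasFDerivAt.comp (f := fun l => (x, l)) lam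
    (hasFDerivAt_prodMk_right x lam)
  exact h.hasDerivAt.deriv

theorem fderiv_param {f : X × ℂ → ℂ} {x : X} {lam : ℂ} (hf : AnalyticAt ℂ f (x, lam)) (e : X) :
    fderiv ℂ (fun y => f (y, lam)) x e = fderiv ℂ f (x, lam) (e, 0) := by
  have h := hf.differentiableAt.hasFDerivAt.comp (f := fun y => (y, lam)) x
    (hasFDerivAt_prodMk_left x lam)
  exact congrArg (fun L : X →L[ℂ] ℂ => L e) h.fderiv

theorem analyticOnNhd_fderiv_apply {f : X × ℂ → ℂ} (hf : AnalyticOnNhd ℂ f (S ×ˢ Λ)) (w : X × ℂ) :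
    AnalyticOnNhd ℂ (fun y => fderiv ℂ f y w) (S ×ˢ Λ) := fun y hy =>
  ((ContinuousLinearMap.apply ℂ ℂ w).analyticAt _).comp (hf y hy).fderiv

theorem analyticOnNhd_iteratedDeriv_param (hS : IsOpen S) (hΛ : IsOpen Λ) {f : X × ℂ → ℂ}
    (hf : AnalyticOnNhd ℂ f (S ×ˢ Λ)) (q : ℕ) :
    AnalyticOnNhd ℂ (fun y : X × ℂ => iteratedDeriv q (fun l => f (y.1, l)) y.2) (S ×ˢ Λ) := by
  induction q generalizing f with
  | zero => simpa using hf
  | succ q ih =>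
    refine (ih (analyticOnNhd_fderiv_apply hf (0, 1))).congr (hS.prod hΛ) ?_
    rintro ⟨x, lam⟩ ⟨hx, hl⟩
    simp only [iteratedDeriv_succ']
    refine Filter.EventuallyEq.iteratedDeriv_eq _ ?_
    filter_upwards [hΛ.mem_nhds hl] with l hl'
    exact (deriv_param (hf (x, l) ⟨hx, hl'⟩)).symm

/-- Differentiation in the parameter commutes with the derivatives in `lam`. -/
theorem fderiv_iteratedDeriv_param (hS : IsOpen S) (hΛ : IsOpen Λ) {f : X × ℂ → ℂ}
    (hf : AnalyticOnNhd ℂ f (S ×ˢ Λ)) (q : ℕ) {x : X} (hx : x ∈ S) {lam : ℂ} (hl : lam ∈ Λ) (e : X) :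
    fderiv ℂ (fun y => iteratedDeriv q (fun l => f (y, l)) lam) x e =
      iteratedDeriv q (fun l => fderiv ℂ (fun y => f (y, l)) x e) lam := by
  induction q generalizing f with
  | zero => simp
  | succ q ih =>
    have h1 : (fun y => iteratedDeriv (q + 1) (fun l => f (y, l)) lam) =ᶠ[𝓝 x]
        fun y => iteratedDeriv q (fun l => fderiv ℂ f (y, l) (0, 1)) lam := by
      filter_upwards [hS.mem_nhds hx] with y hy
      rw [iteratedDeriv_succ']
      refine Filter.EventuallyEq.iteratedDeriv_eq _ ?_
      filter_upwards [hΛ.mem_nhds hl] with l hl'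
      exact deriv_param (hf _ ⟨hy, hl'⟩)
    rw [h1.fderiv_eq, ih (analyticOnNhd_fderiv_apply hf (0, 1)), iteratedDeriv_succ']
    refine Filter.EventuallyEq.iteratedDeriv_eq _ ?_
    filter_upwards [hΛ.mem_nhds hl] with l hl'
    have hxl := hf (x, l) ⟨hx, hl'⟩
    have hsymm : IsSymmSndFDerivAt ℂ f (x, l) :=
      ContDiffAt.isSymmSndFDerivAt_of_omega hxl.contDiffAt
    have h2 : ∀ w w' : X × ℂ, fderiv ℂ (fun y => fderiv ℂ f y w) (x, l) w' =
        fderiv ℂ (fderiv ℂ f) (x, l) w' w := by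
      intro w w'
      have := hxl.fderiv.differentiableAt.hasFDerivAt.clm_apply (hasFDerivAt_const w (x, l))
      rw [this.fderiv]
      simp
    have h3 : (fun l => fderiv ℂ (fun y => f (y, l)) x e) =ᶠ[𝓝 l]
        fun l => fderiv ℂ f (x, l) (e, 0) := by
      filter_upwards [hΛ.mem_nhds hl'] with l' hl''
      exact fderiv_param (hf _ ⟨hx, hl''⟩) e
    rw [h3.deriv_eq, fderiv_param (analyticOnNhd_fderiv_apply hf (0, 1) _ ⟨hx, hl'⟩),
      deriv_param (analyticOnNhd_fderiv_apply hf (e, 0) _ ⟨hx, hl'⟩), h2, h2, hsymm.eq]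

theorem analyticAt_jetAlg {f : X → JetAlg d k} {x : X}
    (h : ∀ p q i j, AnalyticAt ℂ (fun x => f x p q i j) x) : AnalyticAt ℂ f x := by
  refine analyticAt_pi_iff.2 fun p => ?_
  have : AnalyticAt ℂ (fun x => (f x p : Fin (k p) → Fin d → Fin d → ℂ)) x :=
    (analyticAt_pi_iff (Fm := fun _ : Fin (k p) => Fin d → Fin d → ℂ)).2 fun q =>
      analyticAt_pi_iff.2 fun i => analyticAt_pi_iff.2 fun j => h p q i j
  exact this

/-- An entry of a coefficient of a jet, as a linear functional. -/
noncomputable def jetEntry (p : Fin m) (q : Fin (k p)) (i j : Fin d) : JetAlg d k →L[ℂ] ℂ :=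
  LinearMap.toContinuousLinearMap
    { toFun := fun A => A p q i j, map_add' := fun _ _ => rfl, map_smul' := fun _ _ => rfl }

variable {B : X → ℂ → Matrix (Fin d) (Fin d) ℂ}

theorem analyticOnNhd_jet (hS : IsOpen S) (hΛ : IsOpen Λ) (hc : ∀ p, c p ∈ Λ)
    (hB : ∀ i j, AnalyticOnNhd ℂ (fun y : X × ℂ => B y.1 y.2 i j) (S ×ˢ Λ)) :
    AnalyticOnNhd ℂ (fun x => jet c k (B x)) S := by
  intro x hx
  refine analyticAt_jetAlg fun p q i j => ?_
  refine analyticAt_const.mul ?_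
  exact (analyticOnNhd_iteratedDeriv_param hS hΛ (hB i j) q (x, c p) ⟨hx, hc p⟩).comp_of_eq
    (f := fun x : X => (x, c p)) (analyticAt_id.prod analyticAt_const) rfl

theorem fderiv_jet (hS : IsOpen S) (hΛ : IsOpen Λ) (hc : ∀ p, c p ∈ Λ)
    (hB : ∀ i j, AnalyticOnNhd ℂ (fun y : X × ℂ => B y.1 y.2 i j) (S ×ˢ Λ)) {x : X} (hx : x ∈ S)
    (e : X) :
    fderiv ℂ (fun x => jet c k (B x)) x e =
      jet c k fun lam => Matrix.of fun i j => fderiv ℂ (fun x => B x lam i j) x e := by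
  funext p q
  ext i j
  have h1 := (jetEntry p q i j).hasFDerivAt.comp x
    (analyticOnNhd_jet (k := k) hS hΛ hc hB x hx).differentiableAt.hasFDerivAt
  have h2 : jetEntry p q i j (fderiv ℂ (fun x => jet c k (B x)) x e) =
      fderiv ℂ (fun x => ((q : ℕ).factorial : ℂ)⁻¹ *
        iteratedDeriv (q : ℕ) (fun lam => B x lam i j) (c p)) x e :=
    (congrArg (fun L : X →L[ℂ] ℂ => L e) h1.fderiv).symm
  change jetEntry p q i j (fderiv ℂ (fun x => jet c k (B x)) x e) = _
  have h3 : DifferentiableAt ℂ (fun x => iteratedDeriv (q : ℕ) (fun lam => B x lam i j) (c p)) x :=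
    ((analyticOnNhd_iteratedDeriv_param hS hΛ (hB i j) q (x, c p) ⟨hx, hc p⟩).comp_of_eq
      (f := fun x : X => (x, c p)) (analyticAt_id.prod analyticAt_const) rfl).differentiableAt
  rw [h2, (h3.hasFDerivAt.const_mul _).fderiv]
  change _ * fderiv ℂ (fun x => iteratedDeriv (q : ℕ) (fun lam => B x lam i j) (c p)) x e =
    _ * _
  rw [fderiv_iteratedDeriv_param hS hΛ (hB i j) q hx (hc p) e]
  rfl

end Parameters

end Jets

/-! ### Powers of the shift operator -/

section Shift

variable {m N d : ℕ} {M : (Fin N → ℂ) → ℂ → GL (Fin d) ℂ} {c : Fin m → ℂ} {k : Fin m → ℕ}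
  {H : Subgroup (JetGroup d k)} {V : Set (Fin N → ℂ)} {Λ : Set ℂ}

/-- The matrix function `M(u_{j-1}, lam) ⋯ M(u_0, lam)`. -/
def transferFun (M : (Fin N → ℂ) → ℂ → GL (Fin d) ℂ) : ℕ → LatticeVar N → ℂ → GL (Fin d) ℂ
  | 0, _ => 1
  | j + 1, u => M (u j) * transferFun M j u

/-- The element of `G` given by the matrix function `M(u_{j-1}, lam) ⋯ M(u_0, lam)`: the operator
`𝒮^j` acts on the coordinates of `G` as multiplication by it. -/
noncomputable def transfer (M : (Fin N → ℂ) → ℂ → GL (Fin d) ℂ) (c : Fin m → ℂ) (k : Fin m → ℕ) :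
    ℕ → LatticeVar N → JetGroup d k
  | 0, _ => 1
  | j + 1, u => rho c k (M (u j)) * transfer M c k j u

theorem seqShift_seqShift (i j : ℤ) (u : LatticeVar N) :
    seqShift i (seqShift j u) = seqShift (i + j) u := by
  funext l
  simp only [seqShift, add_assoc]

theorem seqShift_zero (u : LatticeVar N) : seqShift 0 u = u := by
  funext l
  simp only [seqShift, add_zero]

theorem continuous_seqShift (j : ℤ) : Continuous (seqShift (N := N) j) :=
  continuous_pi fun l => continuous_apply (l + j)

theorem phaseShift_natCast (j : ℕ) (x : Phase N d k) :
    (phaseShift M c k ^ (j : ℤ)) x = (transfer M c k j x.2 * x.1, seqShift j x.2) := by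
  rw [zpow_natCast]
  induction j with
  | zero => simp [transfer, seqShift_zero]
  | succ j ih =>
    rw [pow_succ', Equiv.Perm.mul_apply, ih]
    refine Prod.ext ?_ ?_
    · change rho c k (M (seqShift (j : ℤ) x.2 0)) * (transfer M c k j x.2 * x.1) = _
      simp only [seqShift, zero_add, transfer, mul_assoc]
    · change seqShift 1 (seqShift j x.2) = _
      rw [seqShift_seqShift]
      push_cast
      rw [add_comm]

theorem phaseShift_zpow_add (i j : ℤ) (x : Phase N d k) :
    (phaseShift M c k ^ (i + j)) x = (phaseShift M c k ^ i) ((phaseShift M c k ^ j) x) := by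
  rw [zpow_add, Equiv.Perm.mul_apply]

theorem phaseShift_zpow_snd (j : ℤ) (x : Phase N d k) :
    ((phaseShift M c k ^ j) x).2 = seqShift j x.2 := by
  have h1 : ∀ (n : ℕ) (y : Phase N d k), ((phaseShift M c k ^ (n : ℤ)) y).2 = seqShift n y.2 :=
    fun n y => by rw [phaseShift_natCast]
  obtain ⟨n, rfl | rfl⟩ := j.eq_nat_or_neg
  · exact h1 n x
  · have h2 := h1 n ((phaseShift M c k ^ (-(n : ℤ))) x)
    rw [← phaseShift_zpow_add, add_neg_cancel, zpow_zero, Equiv.Perm.one_apply] at h2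
    rw [h2, seqShift_seqShift, neg_add_cancel, seqShift_zero]

theorem zs_add (z : Fin N → JetGroup d k ⧸ H → ℂ) (i : Fin N) (j l : ℤ) (x : Phase N d k) :
    zs M c z i (j + l) x = zs M c z i j ((phaseShift M c k ^ l) x) := by
  rw [zs, zs, phaseShift_zpow_add]

theorem zDefined_add (D : Set (JetGroup d k ⧸ H)) (j l : ℤ) (x : Phase N d k) :
    ZDefined M c D (j + l) x ↔ ZDefined M c D j ((phaseShift M c k ^ l) x) := by
  rw [ZDefined, ZDefined, phaseShift_zpow_add]

theorem zs_natCast (z : Fin N → JetGroup d k ⧸ H → ℂ) (i : Fin N) (j : ℕ) (x : Phase N d k) :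
    zs M c z i j x = z i ((transfer M c k j x.2 * x.1 : JetGroup d k) : JetGroup d k ⧸ H) := by
  rw [zs, phaseShift_natCast]

theorem zDefined_natCast (D : Set (JetGroup d k ⧸ H)) (j : ℕ) (x : Phase N d k) :
    ZDefined M c D j x ↔
      ((transfer M c k j x.2 * x.1 : JetGroup d k) : JetGroup d k ⧸ H) ∈ D := by
  rw [ZDefined, phaseShift_natCast]

theorem transfer_congr {j : ℕ} {u u' : LatticeVar N} (h : ∀ l : ℤ, 0 ≤ l → l < j → u l = u' l) :
    transfer M c k j u = transfer M c k j u' := by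
  induction j with
  | zero => rfl
  | succ j ih =>
    rw [transfer, transfer, ih fun l h0 h1 => h l h0 (by push_cast; omega),
      h j (by positivity) (by push_cast; omega)]

theorem transfer_succ' (j : ℕ) (u : LatticeVar N) :
    transfer M c k (j + 1) u = transfer M c k j (seqShift 1 u) * rho c k (M (u 0)) := by
  induction j with
  | zero => simp [transfer]
  | succ j ih =>
    rw [transfer, ih, transfer, mul_assoc]
    simp [seqShift]

/-! ### The invariance groups and the independence of the lattice variables -/

theorem analyticAt_transferFun (hc : ∀ p, c p ∈ Λ)
    (hM : ∀ i j : Fin d, AnalyticOnNhd ℂ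
      (fun q : (Fin N → ℂ) × ℂ => (M q.1 q.2 : Matrix (Fin d) (Fin d) ℂ) i j) (V ×ˢ Λ))
    {j : ℕ} {u : LatticeVar N} (hu : ∀ l : ℤ, 0 ≤ l → l < j → u l ∈ V) (p : Fin m) (i i' : Fin d) :
    AnalyticAt ℂ (fun lam => (transferFun M j u lam : Matrix (Fin d) (Fin d) ℂ) i i') (c p) := by
  induction j generalizing i i' with
  | zero => exact analyticAt_const
  | succ j ih =>
    refine AnalyticAt.coe_GL_mul (fun i i' => ?_)
      (fun i i' => ih (fun l h0 h1 => hu l h0 (by push_cast; omega)) i i') i i'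
    exact (hM i i' (u j, c p) ⟨hu j (by positivity) (by push_cast; omega), hc p⟩).comp_of_eq
      (f := fun lam : ℂ => (u j, lam)) (analyticAt_const.prod analyticAt_id) rfl

theorem rho_transferFun (hc : ∀ p, c p ∈ Λ)
    (hM : ∀ i j : Fin d, AnalyticOnNhd ℂ
      (fun q : (Fin N → ℂ) × ℂ => (M q.1 q.2 : Matrix (Fin d) (Fin d) ℂ) i j) (V ×ˢ Λ))
    {j : ℕ} {u : LatticeVar N} (hu : ∀ l : ℤ, 0 ≤ l → l < j → u l ∈ V) :
    rho c k (transferFun M j u) = transfer M c k j u := by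
  induction j with
  | zero => exact rho_one
  | succ j ih =>
    have hu' : ∀ l : ℤ, 0 ≤ l → l < j → u l ∈ V := fun l h0 h1 => hu l h0 (by push_cast; omega)
    rw [transfer, transferFun, rho_mul _ (analyticAt_transferFun hc hM hu'), ih hu']
    intro p i i'
    exact (hM i i' (u j, c p) ⟨hu j (by positivity) (by push_cast; omega), hc p⟩).comp_of_eq
      (f := fun lam : ℂ => (u j, lam)) (analyticAt_const.prod analyticAt_id) rfl

theorem laxGroup_le_succ (n : ℕ) : laxGroup V M n ≤ laxGroup V M (n + 1) := by
  cases n with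
  | zero => exact bot_le
  | succ n => exact fun A hA => Subgroup.subset_closure (Or.inl hA)

/-- With `A_j = M(u'_{j-1}) ⋯ M(u'_0) (M(u_{j-1}) ⋯ M(u_0))⁻¹` one has
`A_{j+1} = (M(u'_j) A_j M(u'_j)⁻¹) (M(u'_j) M(u_j)⁻¹)`, and both factors are in `H_{j+1}`. -/
theorem transferFun_mul_inv_mem {j : ℕ} {u u' : LatticeVar N}
    (hu : ∀ l : ℤ, 0 ≤ l → l < j → u l ∈ V) (hu' : ∀ l : ℤ, 0 ≤ l → l < j → u' l ∈ V) :
    transferFun M j u' * (transferFun M j u)⁻¹ ∈ laxGroup V M j := by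
  induction j with
  | zero => simp [transferFun, laxGroup]
  | succ j ih =>
    have h1 : u j ∈ V := hu j (by positivity) (by push_cast; omega)
    have h1' : u' j ∈ V := hu' j (by positivity) (by push_cast; omega)
    have hgen : M (u' j) * (M (u j))⁻¹ ∈ laxGroup V M (j + 1) :=
      monotone_nat_of_le_succ (fun n => laxGroup_le_succ (V := V) (M := M) n) (Nat.le_add_left 1 j)
        (Subgroup.subset_closure ⟨_, h1', _, h1, rfl⟩)
    have ih' := ih (fun l h0 h2 => hu l h0 (by push_cast; omega))
      (fun l h0 h2 => hu' l h0 (by push_cast; omega))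
    have heq : transferFun M (j + 1) u' * (transferFun M (j + 1) u)⁻¹ =
        (M (u' j) * (transferFun M j u' * (transferFun M j u)⁻¹) * (M (u' j))⁻¹) *
          (M (u' j) * (M (u j))⁻¹) := by
      simp only [transferFun]
      group
    rw [heq]
    refine mul_mem ?_ hgen
    cases j with
    | zero => simp [transferFun]
    | succ j => exact Subgroup.subset_closure (Or.inr ⟨_, h1', _, ih', rfl⟩)

/-- An `H_n`-left-invariant function stays independent of the `u_l` under `𝒮^j`, `j ≤ n`: for two
choices of the `u_l` the arguments of `z^i` differ by the left action of an element of `H_j`. -/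
theorem zs_indep {α β a b : ℤ} {E : LatticeFun N α β} (R : DarbouxLax d V Λ E a b)
    (hc : ∀ p, c p ∈ Λ) {D : Set (JetGroup d k ⧸ H)} {z : Fin N → JetGroup d k ⧸ H → ℂ}
    {i : Fin N} {n : ℕ} (hinv : IsLeftInvariant c (laxGroup V R.M n) (z i) D) {j : ℕ} (hj : j ≤ n)
    {g : JetGroup d k} {u u' : LatticeVar N} (hu : ∀ l : ℤ, 0 ≤ l → l < j → u l ∈ V)
    (hu' : ∀ l : ℤ, 0 ≤ l → l < j → u' l ∈ V) (hD : ZDefined R.M c D j (g, u))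
    (hD' : ZDefined R.M c D j (g, u')) : zs R.M c z i j (g, u) = zs R.M c z i j (g, u') := by
  rw [zDefined_natCast] at hD hD'
  rw [zs_natCast, zs_natCast]
  have hmem : transferFun R.M j u' * (transferFun R.M j u)⁻¹ ∈ laxGroup V R.M n :=
    monotone_nat_of_le_succ (fun n => laxGroup_le_succ (V := V) (M := R.M) n) hj
      (transferFun_mul_inv_mem hu hu')
  have hT := fun p => analyticAt_transferFun hc R.analytic_M hu p
  have hT' := fun p => analyticAt_transferFun hc R.analytic_M hu' p
  have hrho : rho c k (transferFun R.M j u' * (transferFun R.M j u)⁻¹) *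
      (transfer R.M c k j u * g) = transfer R.M c k j u' * g := by
    rw [rho_mul hT' (fun p => AnalyticAt.coe_GL_inv (hT p)), rho_inv hT,
      rho_transferFun hc R.analytic_M hu, rho_transferFun hc R.analytic_M hu']
    group
  have heq : rho c k (transferFun R.M j u' * (transferFun R.M j u)⁻¹) •
      ((transfer R.M c k j u * g : JetGroup d k) : JetGroup d k ⧸ H) =
      ((transfer R.M c k j u' * g : JetGroup d k) : JetGroup d k ⧸ H) := by
    rw [← hrho]
    rfl
  have := hinv _ hmem _ hD (heq ▸ hD')
  rw [heq] at this
  exact this.symm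

/-! ### Analyticity and continuity of the shift -/

theorem analyticOnNhd_rho (hVo : IsOpen V) (hΛo : IsOpen Λ) (hc : ∀ p, c p ∈ Λ)
    (hM : ∀ i j : Fin d, AnalyticOnNhd ℂ
      (fun q : (Fin N → ℂ) × ℂ => (M q.1 q.2 : Matrix (Fin d) (Fin d) ℂ) i j) (V ×ˢ Λ)) :
    AnalyticOnNhd ℂ (fun u => (rho c k (M u) : JetAlg d k)) V :=
  analyticOnNhd_jet hVo hΛo hc hM

theorem analyticAt_transfer (hVo : IsOpen V) (hΛo : IsOpen Λ) (hc : ∀ p, c p ∈ Λ)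
    (hM : ∀ i j : Fin d, AnalyticOnNhd ℂ
      (fun q : (Fin N → ℂ) × ℂ => (M q.1 q.2 : Matrix (Fin d) (Fin d) ℂ) i j) (V ×ˢ Λ))
    {X : Type} [NormedAddCommGroup X] [NormedSpace ℂ X] {j : ℕ}
    {u : X → LatticeVar N} {x : X} (hu : ∀ l : ℤ, 0 ≤ l → l < j → u x l ∈ V)
    (hua : ∀ l : ℤ, 0 ≤ l → l < j → AnalyticAt ℂ (fun x => u x l) x) :
    AnalyticAt ℂ (fun x => (transfer M c k j (u x) : JetAlg d k)) x := by
  induction j with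
  | zero => exact analyticAt_const
  | succ j ih =>
    have h1 : AnalyticAt ℂ (fun x => (rho c k (M (u x j)) : JetAlg d k)) x :=
      (analyticOnNhd_rho hVo hΛo hc hM _ (hu j (by positivity) (by push_cast; omega))).comp_of_eq
        (hua j (by positivity) (by push_cast; omega)) rfl
    simp only [transfer, Units.val_mul]
    exact h1.jetMul (ih (fun l h0 h1 => hu l h0 (by push_cast; omega))
      (fun l h0 h1 => hua l h0 (by push_cast; omega)))

theorem continuousAt_rho (hVo : IsOpen V) (hΛo : IsOpen Λ) (hc : ∀ p, c p ∈ Λ)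
    (hM : ∀ i j : Fin d, AnalyticOnNhd ℂ
      (fun q : (Fin N → ℂ) × ℂ => (M q.1 q.2 : Matrix (Fin d) (Fin d) ℂ) i j) (V ×ˢ Λ))
    {u : Fin N → ℂ} (hu : u ∈ V) :
    ContinuousAt (fun u => rho c k (M u)) u :=
  (isOpenEmbedding_jetVal.isInducing.continuousAt_iff).2
    (analyticOnNhd_rho hVo hΛo hc hM u hu).continuousAt

theorem continuousAt_phaseShift_zpow (hVo : IsOpen V) (hΛo : IsOpen Λ) (hc : ∀ p, c p ∈ Λ)
    (hM : ∀ i j : Fin d, AnalyticOnNhd ℂ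
      (fun q : (Fin N → ℂ) × ℂ => (M q.1 q.2 : Matrix (Fin d) (Fin d) ℂ) i j) (V ×ˢ Λ))
    (j : ℤ) {x : Phase N d k} (hx : ∀ l, x.2 l ∈ V) :
    ContinuousAt (phaseShift M c k ^ j : Equiv.Perm (Phase N d k)) x := by
  have h2 : ∀ (j : ℤ), ∀ l, ((phaseShift M c k ^ j) x).2 l ∈ V := fun j l => by
    rw [phaseShift_zpow_snd]
    exact hx _
  have hfwd : ∀ y : Phase N d k, (∀ l, y.2 l ∈ V) → ContinuousAt (phaseShift M c k) y := by
    intro y hy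
    have h3 : ContinuousAt (fun y : Phase N d k => rho c k (M (y.2 0))) y :=
      (continuousAt_rho hVo hΛo hc hM (hy 0)).comp_of_eq (f := fun y : Phase N d k => y.2 0)
        (by fun_prop) rfl
    exact (h3.mul continuousAt_fst).prodMk
      ((continuous_seqShift 1).continuousAt.comp continuousAt_snd)
  have hbwd : ∀ y : Phase N d k, (∀ l, y.2 l ∈ V) → ContinuousAt (phaseShift M c k).symm y := by
    intro y hy
    have h3 : ContinuousAt (fun y : Phase N d k => rho c k (M (y.2 (-1)))) y :=
      (continuousAt_rho hVo hΛo hc hM (hy (-1))).comp_of_eq (f := fun y : Phase N d k => y.2 (-1))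
        (by fun_prop) rfl
    exact (h3.inv.mul continuousAt_fst).prodMk
      ((continuous_seqShift (-1)).continuousAt.comp continuousAt_snd)
  induction j using Int.induction_on with
  | zero => exact continuousAt_id
  | succ n ih =>
    have heq : ((phaseShift M c k ^ ((n : ℤ) + 1) : Equiv.Perm (Phase N d k)) : _ → _) =
        phaseShift M c k ∘ (phaseShift M c k ^ (n : ℤ) : Equiv.Perm (Phase N d k)) := by
      funext y
      rw [add_comm, phaseShift_zpow_add, zpow_one]
      rfl
    rw [heq]
    exact (hfwd _ (h2 _)).comp ih
  | pred n ih =>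
    have heq : ((phaseShift M c k ^ (-(n : ℤ) - 1) : Equiv.Perm (Phase N d k)) : _ → _) =
        (phaseShift M c k).symm ∘ (phaseShift M c k ^ (-(n : ℤ)) : Equiv.Perm (Phase N d k)) := by
      funext y
      rw [sub_eq_add_neg, add_comm, phaseShift_zpow_add, zpow_neg_one]
      rfl
    rw [heq]
    exact (hbwd _ (h2 _)).comp ih

theorem eventually_zDefined (hVo : IsOpen V) (hΛo : IsOpen Λ) (hc : ∀ p, c p ∈ Λ)
    (hM : ∀ i j : Fin d, AnalyticOnNhd ℂ
      (fun q : (Fin N → ℂ) × ℂ => (M q.1 q.2 : Matrix (Fin d) (Fin d) ℂ) i j) (V ×ˢ Λ))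
    {D : Set (JetGroup d k ⧸ H)} (hDo : IsOpen D) {j : ℤ} {x : Phase N d k}
    (hx : ∀ l, x.2 l ∈ V) (hD : ZDefined M c D j x) : ∀ᶠ y in 𝓝 x, ZDefined M c D j y := by
  have h1 : ContinuousAt (fun y : Phase N d k =>
      ((((phaseShift M c k ^ j) y).1 : JetGroup d k) : JetGroup d k ⧸ H)) x :=
    ContinuousAt.comp (f := fun y : Phase N d k => ((phaseShift M c k ^ j) y).1)
      QuotientGroup.continuous_mk.continuousAt
      (continuousAt_phaseShift_zpow hVo hΛo hc hM j hx).fst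
  exact h1.eventually (hDo.mem_nhds hD)

end Shift

/-! ### Right-invariant functions and the tangent spaces of the cosets -/

section Cosets

variable {m d : ℕ} {k : Fin m → ℕ} {H : Subgroup (JetGroup d k)}

/-- A function on `G/H`, pulled back to `G` and written in the coordinates of `G`. -/
noncomputable def pullback (y : JetGroup d k ⧸ H → ℂ) : JetAlg d k → ℂ :=
  inCoords fun g : JetGroup d k => y (g : JetGroup d k ⧸ H)

theorem pullback_coe (y : JetGroup d k ⧸ H → ℂ) (g : JetGroup d k) :
    pullback y (g : JetAlg d k) = y (g : JetGroup d k ⧸ H) :=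
  inCoords_coe _ _

theorem pullback_mul_right (y : JetGroup d k ⧸ H → ℂ) {h : JetGroup d k} (hh : h ∈ H)
    (A : JetAlg d k) : pullback y (A * (h : JetAlg d k)) = pullback y A := by
  by_cases hA : IsUnit A
  · obtain ⟨g, rfl⟩ := hA
    rw [← Units.val_mul, pullback_coe, pullback_coe, QuotientGroup.mk_mul_of_mem g hh]
  · have h2 : ¬ ∃ g : JetGroup d k, (g : JetAlg d k) = A := fun ⟨g, hg⟩ => hA ⟨g, hg⟩
    have h3 : ¬ ∃ g : JetGroup d k, (g : JetAlg d k) = A * (h : JetAlg d k) := by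
      rintro ⟨g, hg⟩
      refine h2 ⟨g * h⁻¹, ?_⟩
      rw [Units.val_mul, hg, mul_assoc, Units.mul_inv, mul_one]
    rw [pullback, inCoords, Function.extend_apply' _ _ _ h2, Function.extend_apply' _ _ _ h3]
    rfl

/-- `L` defines the tangent space of `H` at `1`: its kernel translated by `g` is killed by the
differential at `g` of every function that is constant on `g H`. -/
def IsTangentMap (H : Subgroup (JetGroup d k)) {r : ℕ} (L : JetAlg d k →L[ℂ] (Fin r → ℂ)) : Prop :=
  Function.Surjective L ∧ ∀ (F : Type) [NormedAddCommGroup F] [NormedSpace ℂ F] (W : JetAlg d k → F)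
    (g : JetGroup d k), DifferentiableAt ℂ W (g : JetAlg d k) →
    (∀ h ∈ H, W ((g : JetAlg d k) * (h : JetAlg d k)) = W g) →
    ∀ X, L X = 0 → fderiv ℂ W (g : JetAlg d k) ((g : JetAlg d k) * X) = 0

/-- The implicit function theorem gives curves in `H` with prescribed tangent vectors. -/
theorem exists_isTangentMap {r : ℕ} (hH : HasCodim H r) :
    ∃ L : JetAlg d k →L[ℂ] (Fin r → ℂ), IsTangentMap H L := by
  obtain ⟨O, φ, hO, h1O, hφ, hsurj, hiff⟩ := hH 1 H.one_mem
  have : CompleteSpace (JetAlg d k) := FiniteDimensional.complete ℂ _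
  have hstr : HasStrictFDerivAt φ (fderiv ℂ φ ((1 : JetGroup d k) : JetAlg d k))
      ((1 : JetGroup d k) : JetAlg d k) := (hφ _ h1O).hasStrictFDerivAt
  have hrange : (fderiv ℂ φ ((1 : JetGroup d k) : JetAlg d k)).range = ⊤ :=
    LinearMap.range_eq_top.2 hsurj
  have hφ1 : φ ((1 : JetGroup d k) : JetAlg d k) = 0 := (hiff 1 h1O).1 H.one_mem
  refine ⟨fderiv ℂ φ ((1 : JetGroup d k) : JetAlg d k), hsurj, ?_⟩
  intro F _ _ W g hW hinv X hX
  set K := (fderiv ℂ φ ((1 : JetGroup d k) : JetAlg d k)).ker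
  let γ : K → JetAlg d k := hstr.implicitFunction φ _ hrange (φ ((1 : JetGroup d k) : JetAlg d k))
  have hγ0 : γ 0 = ((1 : JetGroup d k) : JetAlg d k) :=
    hstr.implicitFunction_apply_image hrange
  have hγ : HasFDerivAt γ K.subtypeL 0 := (hstr.to_implicitFunction hrange).hasFDerivAt
  have hcurve : ∀ᶠ κ in 𝓝 (0 : K), φ (γ κ) = φ ((1 : JetGroup d k) : JetAlg d k) := by
    have h2 := hstr.map_implicitFunction_eq hrange
    have h3 : Tendsto (fun κ : K => (φ ((1 : JetGroup d k) : JetAlg d k), κ)) (𝓝 0)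
        (𝓝 (φ ((1 : JetGroup d k) : JetAlg d k), (0 : K))) :=
      tendsto_const_nhds.prodMk_nhds tendsto_id
    exact h3.eventually h2
  have hconst : ∀ᶠ κ in 𝓝 (0 : K), W ((g : JetAlg d k) * γ κ) = W g := by
    have hO' : ∀ᶠ κ in 𝓝 (0 : K), γ κ ∈ O :=
      hγ.continuousAt.eventually (hO.mem_nhds (by rw [hγ0]; exact h1O))
    have hU : ∀ᶠ κ in 𝓝 (0 : K), IsUnit (γ κ) :=
      hγ.continuousAt.eventually (isOpen_isUnit_jetAlg.mem_nhds (by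
        rw [hγ0]
        exact Units.isUnit 1))
    filter_upwards [hO', hU, hcurve] with κ h4 h5 h6
    obtain ⟨h, hh⟩ := h5
    rw [← hh] at h4 h6 ⊢
    exact hinv h ((hiff h h4).2 (h6.trans hφ1))
  have hg : HasFDerivAt (fun κ : K => (g : JetAlg d k) * γ κ)
      ((jetMul (g : JetAlg d k)).comp K.subtypeL) 0 := (jetMul (g : JetAlg d k)).hasFDerivAt.comp 0 hγ
  have hg0 : (g : JetAlg d k) * γ 0 = g := by rw [hγ0, ← Units.val_mul, mul_one]
  have hc1 : HasFDerivAt (fun κ : K => W ((g : JetAlg d k) * γ κ))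
      ((fderiv ℂ W (g : JetAlg d k)).comp ((jetMul (g : JetAlg d k)).comp K.subtypeL)) 0 :=
    HasFDerivAt.comp (g := W) (0 : K) (by rw [hg0]; exact hW.hasFDerivAt) hg
  have hc2 : HasFDerivAt (fun κ : K => W ((g : JetAlg d k) * γ κ)) (0 : K →L[ℂ] F) 0 :=
    (hasFDerivAt_const (W g) (0 : K)).congr_of_eventuallyEq hconst
  exact congrArg (fun T : K →L[ℂ] F => T ⟨X, hX⟩) (hc1.unique hc2)

variable {r : ℕ} {L : JetAlg d k →L[ℂ] (Fin r → ℂ)} {ι : Type} [Fintype ι]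

/-- If `r = codim H` functions that are constant on `g H` have independent differentials at `g`,
the common kernel of the differentials is the tangent space of `g H`. -/
theorem IsTangentMap.apply_eq_zero (hL : IsTangentMap H L) (hr : Fintype.card ι = r)
    {ζ : JetAlg d k → ι → ℂ} {g : JetGroup d k} (hζ : DifferentiableAt ℂ ζ (g : JetAlg d k))
    (hinv : ∀ h ∈ H, ζ ((g : JetAlg d k) * (h : JetAlg d k)) = ζ g)
    (hs : Function.Surjective (fderiv ℂ ζ (g : JetAlg d k))) {X : JetAlg d k}
    (hX : fderiv ℂ ζ (g : JetAlg d k) X = 0) : L ((↑g⁻¹ : JetAlg d k) * X) = 0 := by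
  let A₁ : JetAlg d k →ₗ[ℂ] (Fin r → ℂ) := (L.comp (jetMul (↑g⁻¹ : JetAlg d k)) : _ →L[ℂ] _)
  let A₂ : JetAlg d k →ₗ[ℂ] (ι → ℂ) := (fderiv ℂ ζ (g : JetAlg d k) : _ →L[ℂ] _)
  have hcancel : ∀ Y : JetAlg d k, (g : JetAlg d k) * ((↑g⁻¹ : JetAlg d k) * Y) = Y := fun Y => by
    rw [← mul_assoc, Units.mul_inv, one_mul]
  have hle : A₁.ker ≤ A₂.ker := by
    intro Y hY
    have := hL.2 _ ζ g hζ hinv ((↑g⁻¹ : JetAlg d k) * Y) hY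
    rw [hcancel] at this
    exact this
  have h1 : Function.Surjective A₁ := by
    intro w
    obtain ⟨Y, rfl⟩ := hL.1 w
    refine ⟨(g : JetAlg d k) * Y, ?_⟩
    change L ((↑g⁻¹ : JetAlg d k) * ((g : JetAlg d k) * Y)) = L Y
    rw [← mul_assoc, Units.inv_mul, one_mul]
  have hf1 := A₁.finrank_range_add_finrank_ker
  have hf2 := A₂.finrank_range_add_finrank_ker
  rw [LinearMap.range_eq_top.2 h1, finrank_top, Module.finrank_fin_fun] at hf1
  rw [LinearMap.range_eq_top.2 hs, finrank_top, Module.finrank_fintype_fun_eq_card, hr] at hf2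
  have heq : A₁.ker = A₂.ker := Submodule.eq_of_le_of_finrank_eq hle (by omega)
  have hmem : X ∈ A₂.ker := hX
  rw [← heq] at hmem
  exact hmem

/-- A right-invariant function, depending on parameters, is locally a function of the parameters
and of any `r = codim H` independent right-invariant functions. -/
theorem IsTangentMap.exists_factor (hL : IsTangentMap H L) (hr : Fintype.card ι = r)
    {ζ : JetAlg d k → ι → ℂ} {g₀ : JetGroup d k} (hζ : AnalyticAt ℂ ζ (g₀ : JetAlg d k))
    (hinv : ∀ g : JetGroup d k, ∀ h ∈ H, ζ ((g : JetAlg d k) * (h : JetAlg d k)) = ζ g)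
    (hs : Function.Surjective (fderiv ℂ ζ (g₀ : JetAlg d k)))
    {P F : Type} [NormedAddCommGroup P] [NormedSpace ℂ P] [FiniteDimensional ℂ P]
    [NormedAddCommGroup F] [NormedSpace ℂ F] [CompleteSpace F] {p₀ : P} {W : JetAlg d k × P → F}
    (hW : AnalyticAt ℂ W ((g₀ : JetAlg d k), p₀))
    (hWinv : ∀ᶠ y in 𝓝 ((g₀ : JetAlg d k), p₀), ∀ g : JetGroup d k, (g : JetAlg d k) = y.1 →
      ∀ h ∈ H, W ((g : JetAlg d k) * (h : JetAlg d k), y.2) = W (g, y.2)) :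
    ∃ Φ : (ι → ℂ) × P → F, AnalyticAt ℂ Φ (ζ g₀, p₀) ∧
      ∀ᶠ y in 𝓝 ((g₀ : JetAlg d k), p₀), W y = Φ (ζ y.1, y.2) := by
  have hfst : Tendsto Prod.fst (𝓝 ((g₀ : JetAlg d k), p₀)) (𝓝 (g₀ : JetAlg d k)) :=
    continuousAt_fst
  -- apply the submersion lemma to `ζ` with the parameters adjoined
  let φ : JetAlg d k × P → (ι → ℂ) × P := fun y => (ζ y.1, y.2)
  have hφa : AnalyticAt ℂ φ ((g₀ : JetAlg d k), p₀) :=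
    (hζ.comp_of_eq analyticAt_fst rfl).prod analyticAt_snd
  have hφd : ∀ y : JetAlg d k × P, AnalyticAt ℂ ζ y.1 → ∀ v, fderiv ℂ φ y v =
      (fderiv ℂ ζ y.1 v.1, v.2) := by
    intro y hy v
    have h1 : HasFDerivAt (fun y : JetAlg d k × P => ζ y.1)
        ((fderiv ℂ ζ y.1).comp (ContinuousLinearMap.fst ℂ _ _)) y :=
      hy.differentiableAt.hasFDerivAt.comp y hasFDerivAt_fst
    rw [(h1.prodMk hasFDerivAt_snd).fderiv]
    rfl
  have hφs : Function.Surjective (fderiv ℂ φ ((g₀ : JetAlg d k), p₀)) := by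
    rintro ⟨w, p⟩
    obtain ⟨X, hX⟩ := hs w
    exact ⟨(X, p), by rw [hφd _ hζ, hX]⟩
  obtain ⟨σ, hσ, hσ0, -, hfac⟩ := exists_analytic_section hφa hφs
  refine ⟨W ∘ σ, hW.comp_of_eq hσ hσ0, hfac F W hW ?_⟩
  filter_upwards [hfst.eventually hζ.eventually_analyticAt,
    hfst.eventually (hζ.eventually_surjective_fderiv hs),
    hfst.eventually (isOpen_isUnit_jetAlg.mem_nhds g₀.isUnit), hWinv, hW.eventually_analyticAt]
    with y h1 h2 h3 h4 h5 v hv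
  obtain ⟨A, p⟩ := y
  obtain ⟨g, rfl⟩ := h3
  rw [hφd _ h1] at hv
  have hv2 : v.2 = 0 := congrArg Prod.snd hv
  have hv1 : L ((↑g⁻¹ : JetAlg d k) * v.1) = 0 :=
    hL.apply_eq_zero hr h1.differentiableAt (hinv g) h2 (congrArg Prod.fst hv)
  have h6 : HasFDerivAt (fun B : JetAlg d k => W (B, p))
      ((fderiv ℂ W ((g : JetAlg d k), p)).comp (ContinuousLinearMap.inl ℂ _ _)) (g : JetAlg d k) :=
    h5.differentiableAt.hasFDerivAt.comp (f := fun B => (B, p)) (g : JetAlg d k)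
      (hasFDerivAt_prodMk_left _ _)
  have h7 := hL.2 F (fun B => W (B, p)) g h6.differentiableAt (h4 g rfl) _ hv1
  rw [h6.fderiv, ← mul_assoc, Units.mul_inv, one_mul] at h7
  have : v = (v.1, 0) := Prod.ext rfl hv2
  rw [this]
  exact h7

end Cosets

/-! ### The local formulas for the shift and the total derivative -/

section Formulas

variable {m N d : ℕ} {c : Fin m → ℂ} {k : Fin m → ℕ} {H : Subgroup (JetGroup d k)}
  {V : Set (Fin N → ℂ)} {Λ : Set ℂ} {α β a b : ℤ} {E : LatticeFun N α β}
  {R : DarbouxLax d V Λ E a b} {δ : Fin N → ℕ} {D : Set (JetGroup d k ⧸ H)}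
  {z : Fin N → JetGroup d k ⧸ H → ℂ} {r : ℕ}

/-- The standing assumptions on the functions `z^i` and the Darboux-Lax representation. -/
structure InvariantSystem (R : DarbouxLax d V Λ E a b) (c : Fin m → ℂ) (δ : Fin N → ℕ)
    (D : Set (JetGroup d k ⧸ H)) (z : Fin N → JetGroup d k ⧸ H → ℂ) : Prop where
  isOpen_V : IsOpen V
  isOpen_Λ : IsOpen Λ
  mem_Λ : ∀ p, c p ∈ Λ
  isOpen_D : IsOpen D
  analytic : ∀ i, IsAnalyticOn (z i) D
  invariant : ∀ i, IsLeftInvariant c (laxGroup V R.M (δ i)) (z i) D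

/-- The functions `𝒮^j(z^i)`, `0 ≤ j ≤ d_i`, for given values of the `u_l`, in the coordinates
of `G`. -/
noncomputable def lowCoord (M : (Fin N → ℂ) → ℂ → GL (Fin d) ℂ) (c : Fin m → ℂ) (δ : Fin N → ℕ)
    (z : Fin N → JetGroup d k ⧸ H → ℂ) (u : LatticeVar N) (A : JetAlg d k) :
    (Σ i : Fin N, Fin (δ i + 1)) → ℂ :=
  fun q => pullback (z q.1) ((transfer M c k q.2 u : JetAlg d k) * A)

/-- The functions `𝒮^{d_i+1}(z^i)`, for given values of the `u_l`, in the coordinates of `G`. -/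
noncomputable def topCoord (M : (Fin N → ℂ) → ℂ → GL (Fin d) ℂ) (c : Fin m → ℂ) (δ : Fin N → ℕ)
    (z : Fin N → JetGroup d k ⧸ H → ℂ) (u : LatticeVar N) (A : JetAlg d k) : Fin N → ℂ :=
  fun i => pullback (z i) ((transfer M c k (δ i + 1) u : JetAlg d k) * A)

theorem card_lowIndex (δ : Fin N → ℕ) (hδ : ∑ i, δ i + N = r) :
    Fintype.card (Σ i : Fin N, Fin (δ i + 1)) = r := by
  simp [Finset.sum_add_distrib, ← hδ]

theorem inCoords_zs (M : (Fin N → ℂ) → ℂ → GL (Fin d) ℂ) (c : Fin m → ℂ)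
    (z : Fin N → JetGroup d k ⧸ H → ℂ) (i : Fin N) (j : ℕ) (u : LatticeVar N) :
    (inCoords fun g => zs M c z i j (g, u)) =
      fun A => pullback (z i) ((transfer M c k j u : JetAlg d k) * A) := by
  rw [pullback, ← inCoords_mul_left]
  simp only [zs_natCast]

theorem zs_eq_pullback (M : (Fin N → ℂ) → ℂ → GL (Fin d) ℂ) (c : Fin m → ℂ)
    (z : Fin N → JetGroup d k ⧸ H → ℂ) (i : Fin N) (j : ℕ) (x : Phase N d k) :
    zs M c z i j x = pullback (z i) ((transfer M c k j x.2 : JetAlg d k) * (x.1 : JetAlg d k)) := by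
  rw [zs_natCast, ← Units.val_mul, pullback_coe]

theorem zLow_eq_lowCoord (M : (Fin N → ℂ) → ℂ → GL (Fin d) ℂ) (c : Fin m → ℂ)
    (z : Fin N → JetGroup d k ⧸ H → ℂ) (x : Phase N d k) :
    zLow M c δ z x = lowCoord M c δ z x.2 x.1 :=
  funext fun q => zs_eq_pullback M c z q.1 q.2 x

theorem lowCoord_mul_right (M : (Fin N → ℂ) → ℂ → GL (Fin d) ℂ) (c : Fin m → ℂ)
    (z : Fin N → JetGroup d k ⧸ H → ℂ) (u : LatticeVar N) (A : JetAlg d k) {h : JetGroup d k}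
    (hh : h ∈ H) : lowCoord M c δ z u (A * h) = lowCoord M c δ z u A := by
  funext q
  rw [lowCoord, lowCoord, ← mul_assoc, pullback_mul_right _ hh]

theorem topCoord_mul_right (M : (Fin N → ℂ) → ℂ → GL (Fin d) ℂ) (c : Fin m → ℂ)
    (z : Fin N → JetGroup d k ⧸ H → ℂ) (u : LatticeVar N) (A : JetAlg d k) {h : JetGroup d k}
    (hh : h ∈ H) : topCoord M c δ z u (A * h) = topCoord M c δ z u A := by
  funext q
  rw [topCoord, topCoord, ← mul_assoc, pullback_mul_right _ hh]

theorem eventually_mem_of_isOpen (hVo : IsOpen V) {x : Phase N d k} (hx : ∀ l, x.2 l ∈ V)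
    (p q : ℤ) : ∀ᶠ y in 𝓝 x, ∀ l : ℤ, p ≤ l → l < q → y.2 l ∈ V := by
  have h : ∀ᶠ y in 𝓝 x, ∀ l ∈ Set.Ico p q, y.2 l ∈ V := by
    refine (Filter.eventually_all_finite (Set.finite_Ico p q)).2 fun l _ => ?_
    have hc : ContinuousAt (fun y : Phase N d k => y.2 l) x := by fun_prop
    exact hc.eventually (hVo.mem_nhds (hx l))
  filter_upwards [h] with y hy l h1 h2 using hy l ⟨h1, h2⟩

namespace InvariantSystem

theorem analyticAt_pullback (S : InvariantSystem R c δ D z) (i : Fin N) {g : JetGroup d k}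
    (hg : (g : JetGroup d k ⧸ H) ∈ D) : AnalyticAt ℂ (pullback (z i)) (g : JetAlg d k) :=
  S.analytic i g hg

theorem analyticAt_comp (S : InvariantSystem R c δ D z) (i : Fin N) {X : Type}
    [NormedAddCommGroup X] [NormedSpace ℂ X] {j : ℕ} {u : X → LatticeVar N} {γ : X → JetAlg d k}
    {x : X} {g : JetGroup d k} (hg : γ x = g) (hγ : AnalyticAt ℂ γ x)
    (hu : ∀ l : ℤ, 0 ≤ l → l < j → u x l ∈ V)
    (hua : ∀ l : ℤ, 0 ≤ l → l < j → AnalyticAt ℂ (fun x => u x l) x)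
    (hD : ZDefined R.M c D j (g, u x)) :
    AnalyticAt ℂ (fun x => pullback (z i) ((transfer R.M c k j (u x) : JetAlg d k) * γ x)) x := by
  rw [zDefined_natCast] at hD
  refine (S.analyticAt_pullback i hD).comp_of_eq
    ((analyticAt_transfer S.isOpen_V S.isOpen_Λ S.mem_Λ R.analytic_M hu hua).jetMul hγ) ?_
  rw [hg, Units.val_mul]

theorem eventually_zDefined (S : InvariantSystem R c δ D z) {j : ℤ} {x : Phase N d k}
    (hx : ∀ l, x.2 l ∈ V) (hD : ZDefined R.M c D j x) : ∀ᶠ y in 𝓝 x, ZDefined R.M c D j y :=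
  _root_.eventually_zDefined S.isOpen_V S.isOpen_Λ S.mem_Λ R.analytic_M S.isOpen_D hx hD

theorem continuousAt_zs (S : InvariantSystem R c δ D z) (i : Fin N) {j : ℤ} {x : Phase N d k}
    (hx : ∀ l, x.2 l ∈ V) (hD : ZDefined R.M c D j x) : ContinuousAt (zs R.M c z i j) x := by
  have h1 : zs R.M c z i j = fun y =>
      pullback (z i) (((phaseShift R.M c k ^ j) y).1 : JetAlg d k) := by
    funext y
    rw [pullback_coe, zs]
  rw [h1]
  have h2 := (continuousAt_phaseShift_zpow (k := k) S.isOpen_V S.isOpen_Λ S.mem_Λ R.analytic_M j hx).fst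
  refine ContinuousAt.comp (g := pullback (z i))
    (f := fun y => (((phaseShift R.M c k ^ j) y).1 : JetAlg d k))
    (S.analyticAt_pullback i hD).continuousAt ?_
  exact ContinuousAt.comp (g := fun g : JetGroup d k => (g : JetAlg d k))
    Units.continuous_val.continuousAt h2

/-- Near a point, `𝒮^j(z^i)` with `j ≤ d_i` is a function of the coordinates of `G` only. -/
theorem eventually_zs_eq (S : InvariantSystem R c δ D z) {i : Fin N} {j : ℕ} (hj : j ≤ δ i)
    {x : Phase N d k} (hx : ∀ l, x.2 l ∈ V) (hD : ZDefined R.M c D j x) :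
    ∀ᶠ y in 𝓝 x, zs R.M c z i j y =
      pullback (z i) ((transfer R.M c k j x.2 : JetAlg d k) * (y.1 : JetAlg d k)) := by
  have h1 : Tendsto (fun y : Phase N d k => (y.1, x.2)) (𝓝 x) (𝓝 x) := by
    have : ContinuousAt (fun y : Phase N d k => (y.1, x.2)) x := by fun_prop
    exact this
  filter_upwards [S.eventually_zDefined hx hD, h1.eventually (S.eventually_zDefined hx hD),
    eventually_mem_of_isOpen S.isOpen_V hx 0 j] with y h2 h3 h4
  rw [zs_indep R S.mem_Λ (S.invariant i) hj (g := y.1) (u := y.2) (u' := x.2) h4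
    (fun l _ _ => hx l) h2 h3, zs_eq_pullback]

/-- Near a point, `𝒮^{d_i+1}(z^i)` depends on the `u_l` only through `u_0`. -/
theorem eventually_zs_succ_eq (S : InvariantSystem R c δ D z) (i : Fin N)
    {x : Phase N d k} (hx : ∀ l, x.2 l ∈ V) (hD : ZDefined R.M c D ((δ i : ℤ) + 1) x) :
    ∀ᶠ y in 𝓝 x, zs R.M c z i ((δ i : ℤ) + 1) y =
      topCoord R.M c δ z (Function.update x.2 0 (y.2 0)) y.1 i := by
  have h1 : Tendsto (fun y : Phase N d k => (y.1, Function.update x.2 0 (y.2 0))) (𝓝 x) (𝓝 x) := by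
    have : ContinuousAt (fun y : Phase N d k => (y.1, Function.update x.2 0 (y.2 0))) x :=
      continuousAt_fst.prodMk (continuousAt_const.update 0 (by fun_prop))
    simpa [ContinuousAt] using this
  filter_upwards [S.eventually_zDefined hx hD, h1.eventually (S.eventually_zDefined hx hD),
    eventually_mem_of_isOpen S.isOpen_V hx 0 ((δ i : ℤ) + 1)] with y h2 h3 h4
  have hshift : ∀ u : LatticeVar N, phaseShift R.M c k (y.1, u) =
      (rho c k (R.M (u 0)) * y.1, seqShift 1 u) := fun u => rfl
  have h5 : zs R.M c z i ((δ i : ℤ) + 1) y =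
      zs R.M c z i ((δ i : ℤ) + 1) (y.1, Function.update x.2 0 (y.2 0)) := by
    rw [zs_add, zs_add, zpow_one]
    rw [zDefined_add, zpow_one] at h2 h3
    rw [show y = (y.1, y.2) from rfl, hshift] at h2 ⊢
    rw [hshift] at h3 ⊢
    rw [Function.update_self] at h3 ⊢
    refine zs_indep R S.mem_Λ (S.invariant i) le_rfl (fun l h0 hl => h4 _ (by omega) (by omega))
      (fun l h0 hl => ?_) h2 h3
    rw [seqShift, Function.update_of_ne (by omega)]
    exact hx _
  rw [h5]
  have := zs_eq_pullback R.M c z i (δ i + 1) (y.1, Function.update x.2 0 (y.2 0))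
  push_cast at this
  exact this

theorem eventually_zLow_eq (S : InvariantSystem R c δ D z) {x : Phase N d k} (hx : ∀ l, x.2 l ∈ V)
    (hD : ∀ i : Fin N, ∀ j : ℕ, j ≤ δ i → ZDefined R.M c D j x) :
    ∀ᶠ y in 𝓝 x, zLow R.M c δ z y = lowCoord R.M c δ z x.2 y.1 := by
  have h : ∀ᶠ y in 𝓝 x, ∀ q : Σ i : Fin N, Fin (δ i + 1), zs R.M c z q.1 ((q.2 : ℕ) : ℤ) y =
      pullback (z q.1) ((transfer R.M c k q.2 x.2 : JetAlg d k) * (y.1 : JetAlg d k)) :=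
    eventually_all.2 fun q => S.eventually_zs_eq (Nat.lt_succ_iff.1 q.2.2) hx
      (hD _ _ (Nat.lt_succ_iff.1 q.2.2))
  filter_upwards [h] with y hy
  exact funext hy

theorem analyticAt_lowCoord (S : InvariantSystem R c δ D z) {x : Phase N d k}
    (hx : ∀ l, x.2 l ∈ V) (hD : ∀ i : Fin N, ∀ j : ℕ, j ≤ δ i → ZDefined R.M c D j x) :
    AnalyticAt ℂ (lowCoord R.M c δ z x.2) (x.1 : JetAlg d k) :=
  analyticAt_pi_iff.2 fun q => S.analyticAt_comp q.1 (u := fun _ => x.2) rfl analyticAt_id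
    (fun l _ _ => hx l) (fun _ _ _ => analyticAt_const) (hD _ _ (Nat.lt_succ_iff.1 q.2.2))

theorem analyticAt_topCoord (S : InvariantSystem R c δ D z) {x : Phase N d k}
    (hx : ∀ l, x.2 l ∈ V) (hD : ∀ i : Fin N, ZDefined R.M c D ((δ i : ℤ) + 1) x) :
    AnalyticAt ℂ (fun y : JetAlg d k × (Fin N → ℂ) =>
      topCoord R.M c δ z (Function.update x.2 0 y.2) y.1) ((x.1 : JetAlg d k), x.2 0) := by
  refine analyticAt_pi_iff.2 fun i => S.analyticAt_comp i (j := δ i + 1) (g := x.1)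
    (u := fun y : JetAlg d k × (Fin N → ℂ) => Function.update x.2 0 y.2) rfl analyticAt_fst
    (fun l _ _ => ?_) (fun l _ _ => ?_) ?_
  · simpa using hx l
  · rcases eq_or_ne l 0 with rfl | hl
    · simpa using analyticAt_snd
    · simpa [Function.update_of_ne hl] using analyticAt_const
  · simpa using hD i

theorem surjective_fderiv_lowCoord (S : InvariantSystem R c δ D z) {x : Phase N d k}
    (hx : ∀ l, x.2 l ∈ V) (hC : CoordAt R.M c δ D z x) :
    Function.Surjective (fderiv ℂ (lowCoord R.M c δ z x.2) (x.1 : JetAlg d k)) := by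
  refine surjective_pi_of_linearIndependent ?_
  have h := hC.2
  have ha := (S.analyticAt_lowCoord hx hC.1).differentiableAt.hasFDerivAt
  convert h using 2 with q
  rw [inCoords_zs]
  exact ((ContinuousLinearMap.proj (R := ℂ) (φ := fun _ => ℂ) q).hasFDerivAt.comp _ ha).fderiv.symm

/-- Locally `𝒮^{d_i+1}(z^i)` is an analytic function of the `z^{i'}_{k'}` and `u`, as functions
on `G × V`. -/
theorem exists_top_germ (S : InvariantSystem R c δ D z) (hH : HasCodim H r)
    (hδ : ∑ i, δ i + N = r) {x : Phase N d k} (hx : ∀ l, x.2 l ∈ V)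
    (hC : CoordAt R.M c δ D z x) (hD : ∀ i : Fin N, ZDefined R.M c D ((δ i : ℤ) + 1) x) :
    ∃ Φ : ((Σ i : Fin N, Fin (δ i + 1)) → ℂ) × (Fin N → ℂ) → Fin N → ℂ,
      AnalyticAt ℂ Φ (zLow R.M c δ z x, x.2 0) ∧
      ∀ᶠ y in 𝓝 ((x.1 : JetAlg d k), x.2 0),
        topCoord R.M c δ z (Function.update x.2 0 y.2) y.1 =
          Φ (lowCoord R.M c δ z x.2 y.1, y.2) := by
  obtain ⟨L, hL⟩ := exists_isTangentMap hH
  rw [zLow_eq_lowCoord]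
  exact hL.exists_factor (card_lowIndex δ hδ) (S.analyticAt_lowCoord hx hC.1)
    (fun g h hh => lowCoord_mul_right _ _ _ _ _ hh) (S.surjective_fderiv_lowCoord hx hC)
    (W := fun y : JetAlg d k × (Fin N → ℂ) =>
      topCoord R.M c δ z (Function.update x.2 0 y.2) y.1) (S.analyticAt_topCoord hx hD)
    (Eventually.of_forall fun y g _ h hh => topCoord_mul_right _ _ _ _ _ hh)

theorem tendsto_coords (x : Phase N d k) :
    Tendsto (fun y : Phase N d k => ((y.1 : JetAlg d k), y.2 0)) (𝓝 x)
      (𝓝 ((x.1 : JetAlg d k), x.2 0)) := by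
  have : ContinuousAt (fun y : Phase N d k => ((y.1 : JetAlg d k), y.2 0)) x :=
    (Units.continuous_val.continuousAt.comp continuousAt_fst).prodMk (by fun_prop)
  exact this

theorem continuousAt_zLow (S : InvariantSystem R c δ D z) {x : Phase N d k}
    (hx : ∀ l, x.2 l ∈ V) (hD : ∀ i : Fin N, ∀ j : ℕ, j ≤ δ i → ZDefined R.M c D j x) :
    ContinuousAt (zLow R.M c δ z) x :=
  continuousAt_pi.2 fun q => S.continuousAt_zs q.1 hx (hD _ _ (Nat.lt_succ_iff.1 q.2.2))

theorem eventually_zs_succ_eq_germ (S : InvariantSystem R c δ D z) {x : Phase N d k}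
    (hx : ∀ l, x.2 l ∈ V) (hC : CoordAt R.M c δ D z x)
    (hD : ∀ i : Fin N, ZDefined R.M c D ((δ i : ℤ) + 1) x)
    {Φ : ((Σ i : Fin N, Fin (δ i + 1)) → ℂ) × (Fin N → ℂ) → Fin N → ℂ}
    (hΦ : ∀ᶠ y in 𝓝 ((x.1 : JetAlg d k), x.2 0),
      topCoord R.M c δ z (Function.update x.2 0 y.2) y.1 = Φ (lowCoord R.M c δ z x.2 y.1, y.2)) :
    ∀ᶠ y in 𝓝 x, ∀ i, zs R.M c z i ((δ i : ℤ) + 1) y = Φ (zLow R.M c δ z y, y.2 0) i := by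
  filter_upwards [(tendsto_coords x).eventually hΦ, S.eventually_zLow_eq hx hC.1,
    eventually_all.2 fun i => S.eventually_zs_succ_eq i hx (hD i)] with y h1 h2 h3 i
  rw [h3, h2, h1]

theorem exists_shiftFormula (S : InvariantSystem R c δ D z) (hH : HasCodim H r)
    (hδ : ∑ i, δ i + N = r) {x : Phase N d k} (hx : ∀ l, x.2 l ∈ V)
    (hC : CoordAt R.M c δ D z x) (hD : ∀ i : Fin N, ZDefined R.M c D ((δ i : ℤ) + 1) x) :
    ∃ F, ShiftFormula R.M c δ z F x := by
  obtain ⟨Φ, hΦa, hΦ⟩ := S.exists_top_germ hH hδ hx hC hD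
  refine ⟨AnalyticFun.ofFun Φ, ?_⟩
  have hcont : ContinuousAt (fun y : Phase N d k => (zLow R.M c δ z y, y.2 0)) x :=
    (S.continuousAt_zLow hx hC.1).prodMk (by fun_prop)
  filter_upwards [S.eventually_zs_succ_eq_germ hx hC hD hΦ,
    hcont.eventually hΦa.eventually_analyticAt] with y h1 h2 using ⟨h2, h1⟩

end InvariantSystem

end Formulas

/-! ### The total derivative and the solution for the lattice variables -/

section Solutions

variable {m N d : ℕ} {c : Fin m → ℂ} {k : Fin m → ℕ} {H : Subgroup (JetGroup d k)}
  {V : Set (Fin N → ℂ)} {Λ : Set ℂ} {α β a b : ℤ} {E : LatticeFun N α β}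
  {R : DarbouxLax d V Λ E a b} {δ : Fin N → ℕ} {D : Set (JetGroup d k ⧸ H)}
  {z : Fin N → JetGroup d k ⧸ H → ℂ} {r : ℕ}

theorem totalDeriv_const (E : LatticeFun N α β) (w : ℂ) (u : LatticeVar N) :
    totalDeriv E (fun _ => w) u = 0 := by
  simp [totalDeriv, pd]

theorem phaseDeriv_eq (R : DarbouxLax d V Λ E a b) (c : Fin m → ℂ)
    (z : Fin N → JetGroup d k ⧸ H → ℂ) (i : Fin N) (y : Phase N d k) :
    phaseDeriv R c (fun y => z i (y.1 : JetGroup d k ⧸ H)) y =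
      fderiv ℂ (pullback (z i)) (y.1 : JetAlg d k)
        (jet c k (R.U (win a b y.2)) * (y.1 : JetAlg d k)) := by
  change _ + totalDeriv E (fun _ => z i (y.1 : JetGroup d k ⧸ H)) y.2 = _
  rw [totalDeriv_const, add_zero]
  rfl

theorem continuous_win (p q : ℤ) : Continuous (win (N := N) p q) :=
  continuous_pi fun l => continuous_apply (l : ℤ)

/-- The `w^i_k`, `0 ≤ k ≤ d_i`, among the `w^i_k`, `0 ≤ k ≤ d_i + 1`. -/
def fullLow (w : (Σ i : Fin N, Fin (δ i + 2)) → ℂ) : (Σ i : Fin N, Fin (δ i + 1)) → ℂ :=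
  fun q => w ⟨q.1, q.2.castSucc⟩

/-- The `w^i_{d_i+1}` among the `w^i_k`, `0 ≤ k ≤ d_i + 1`. -/
def fullTop (w : (Σ i : Fin N, Fin (δ i + 2)) → ℂ) : Fin N → ℂ :=
  fun i => w ⟨i, Fin.last _⟩

theorem analyticAt_fullLow_fullTop (w : (Σ i : Fin N, Fin (δ i + 2)) → ℂ) :
    AnalyticAt ℂ (fun w : (Σ i : Fin N, Fin (δ i + 2)) → ℂ => (fullLow w, fullTop w)) w := by
  refine AnalyticAt.prod (analyticAt_pi_iff.2 fun q => ?_) (analyticAt_pi_iff.2 fun q => ?_)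
  · exact (ContinuousLinearMap.proj (R := ℂ) (φ := fun _ => ℂ) _).analyticAt w
  · exact (ContinuousLinearMap.proj (R := ℂ) (φ := fun _ => ℂ) _).analyticAt w

theorem fullLow_zFull (M : (Fin N → ℂ) → ℂ → GL (Fin d) ℂ) (c : Fin m → ℂ)
    (z : Fin N → JetGroup d k ⧸ H → ℂ) (x : Phase N d k) :
    fullLow (zFull M c δ z x) = zLow M c δ z x := rfl

theorem fullTop_zFull (M : (Fin N → ℂ) → ℂ → GL (Fin d) ℂ) (c : Fin m → ℂ)
    (z : Fin N → JetGroup d k ⧸ H → ℂ) (x : Phase N d k) (i : Fin N) :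
    fullTop (zFull M c δ z x) i = zs M c z i ((δ i : ℤ) + 1) x := by
  simp [fullTop, zFull]

theorem full_ext {w w' : (Σ i : Fin N, Fin (δ i + 2)) → ℂ} (h : fullLow w = fullLow w')
    (h' : fullTop w = fullTop w') : w = w' := by
  funext ⟨i, q⟩
  induction q using Fin.lastCases with
  | last => exact congrFun h' i
  | cast q => exact congrFun h ⟨i, q⟩

namespace InvariantSystem

/-- The function `D_t(z^i)` is right-invariant because the vector field `W ↦ U W` is. -/
theorem exists_derivFormula (S : InvariantSystem R c δ D z) (hN : 0 < N) (hH : HasCodim H r)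
    (hδ : ∑ i, δ i + N = r) {x : Phase N d k} (hx : ∀ l, x.2 l ∈ V)
    (hC : CoordAt R.M c δ D z x) (hU : win a b x.2 ∈ R.domU) : ∃ Q, DerivFormula c δ R z Q x := by
  obtain ⟨L, hL⟩ := exists_isTangentMap hH
  have hx1 : ((x.1 : JetGroup d k) : JetGroup d k ⧸ H) ∈ D := by
    have := hC.1 ⟨0, hN⟩ 0 (Nat.zero_le _)
    rw [zDefined_natCast] at this
    simpa [transfer] using this
  let W : JetAlg d k × Win N a b → Fin N → ℂ := fun y i =>
    fderiv ℂ (pullback (z i)) y.1 (jet c k (R.U y.2) * y.1)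
  have hW : AnalyticAt ℂ W ((x.1 : JetAlg d k), win a b x.2) := by
    refine analyticAt_pi_iff.2 fun i => ?_
    have h1 : AnalyticAt ℂ (fun y : JetAlg d k × Win N a b => fderiv ℂ (pullback (z i)) y.1)
        ((x.1 : JetAlg d k), win a b x.2) :=
      (S.analyticAt_pullback i hx1).fderiv.comp_of_eq analyticAt_fst rfl
    have h2 : AnalyticAt ℂ (fun y : JetAlg d k × Win N a b => jet c k (R.U y.2))
        ((x.1 : JetAlg d k), win a b x.2) :=
      (analyticOnNhd_jet R.isOpen_domU S.isOpen_Λ S.mem_Λ R.analytic_U _ hU).comp_of_eq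
        analyticAt_snd rfl
    exact ((ContinuousLinearMap.id ℂ (JetAlg d k →L[ℂ] ℂ)).analyticAt_bilinear _).comp_of_eq
      (h1.prod (h2.jetMul analyticAt_fst)) rfl
  have hWinv : ∀ᶠ y in 𝓝 ((x.1 : JetAlg d k), win a b x.2), ∀ g : JetGroup d k,
      (g : JetAlg d k) = y.1 → ∀ h ∈ H,
      W ((g : JetAlg d k) * (h : JetAlg d k), y.2) = W (g, y.2) := by
    have h1 : Tendsto Prod.fst (𝓝 ((x.1 : JetAlg d k), win a b x.2)) (𝓝 (x.1 : JetAlg d k)) :=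
      continuousAt_fst
    have h2 : ∀ᶠ A in 𝓝 (x.1 : JetAlg d k), ∀ i, AnalyticAt ℂ (pullback (z i)) A :=
      eventually_all.2 fun i => (S.analyticAt_pullback i hx1).eventually_analyticAt
    filter_upwards [h1.eventually h2] with y hy g hg h hh
    funext i
    have hcancel : ∀ B : JetAlg d k, B * (h : JetAlg d k) * (↑h⁻¹ : JetAlg d k) = B := fun B => by
      rw [mul_assoc, Units.mul_inv, mul_one]
    have hd : HasFDerivAt (pullback (z i)) (fderiv ℂ (pullback (z i)) g)
        ((g : JetAlg d k) * (h : JetAlg d k) * (↑h⁻¹ : JetAlg d k)) := by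
      rw [hcancel, hg]
      exact (hy i).differentiableAt.hasFDerivAt
    have h3 := hd.comp ((g : JetAlg d k) * (h : JetAlg d k))
      (((jetMul (d := d) (k := k)).flip (↑h⁻¹ : JetAlg d k)).hasFDerivAt)
    have h4 : (pullback (z i) ∘ fun A : JetAlg d k => (jetMul (d := d) (k := k)).flip
        (↑h⁻¹ : JetAlg d k) A) = pullback (z i) :=
      funext fun A => pullback_mul_right (z i) (H.inv_mem hh) A
    change fderiv ℂ (pullback (z i)) ((g : JetAlg d k) * h) (jet c k (R.U y.2) * (g * h)) =
      fderiv ℂ (pullback (z i)) g (jet c k (R.U y.2) * g)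
    have h5 : fderiv ℂ (pullback (z i)) ((g : JetAlg d k) * h) =
        (fderiv ℂ (pullback (z i)) (g : JetAlg d k)).comp
          ((jetMul (d := d) (k := k)).flip (↑h⁻¹ : JetAlg d k)) := by
      rw [← h3.fderiv]
      exact congrArg (fun f => fderiv ℂ f ((g : JetAlg d k) * h)) h4.symm
    rw [h5]
    change fderiv ℂ (pullback (z i)) (g : JetAlg d k)
      (jet c k (R.U y.2) * ((g : JetAlg d k) * h) * (↑h⁻¹ : JetAlg d k)) = _
    rw [← mul_assoc, hcancel]
  obtain ⟨Q, hQa, hQ⟩ := hL.exists_factor (card_lowIndex δ hδ) (S.analyticAt_lowCoord hx hC.1)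
    (fun g h hh => lowCoord_mul_right _ _ _ _ _ hh) (S.surjective_fderiv_lowCoord hx hC) hW hWinv
  rw [← zLow_eq_lowCoord] at hQa
  have hcont : ContinuousAt (fun y : Phase N d k => (zLow R.M c δ z y, win a b y.2)) x :=
    (S.continuousAt_zLow hx hC.1).prodMk ((continuous_win a b).continuousAt.comp continuousAt_snd)
  have hcont' : ContinuousAt (fun y : Phase N d k => ((y.1 : JetAlg d k), win a b y.2)) x :=
    (Units.continuous_val.continuousAt.comp continuousAt_fst).prodMk
      ((continuous_win a b).continuousAt.comp continuousAt_snd)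
  refine ⟨AnalyticFun.ofFun Q, ?_⟩
  filter_upwards [hcont.eventually hQa.eventually_analyticAt, hcont'.eventually hQ,
    S.eventually_zLow_eq hx hC.1] with y h1 h2 h3
  refine ⟨h1, fun i => ?_⟩
  rw [phaseDeriv_eq]
  change W ((y.1 : JetAlg d k), win a b y.2) i = Q _ i
  rw [h2, h3]

/-- The Jacobian matrix is the partial differential in `u` of the `𝒮^{d_i+1}(z^i)`. -/
theorem jacobian_mulVec (S : InvariantSystem R c δ D z) {x : Phase N d k} (hx : ∀ l, x.2 l ∈ V)
    (hD : ∀ i : Fin N, ZDefined R.M c D ((δ i : ℤ) + 1) x) (e : Fin N → ℂ) :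
    (jacobian R.M c δ z x).mulVec e =
      fderiv ℂ (fun w => topCoord R.M c δ z (Function.update x.2 0 w) x.1) (x.2 0) e := by
  have ha : AnalyticAt ℂ (fun w => topCoord R.M c δ z (Function.update x.2 0 w) x.1) (x.2 0) :=
    (S.analyticAt_topCoord hx hD).comp_of_eq (f := fun w => ((x.1 : JetAlg d k), w))
      (analyticAt_const.prod analyticAt_id) rfl
  have hcol : ∀ i j, jacobian R.M c δ z x i j =
      fderiv ℂ (fun w => topCoord R.M c δ z (Function.update x.2 0 w) x.1) (x.2 0)
        (Pi.single j 1) i := by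
    intro i j
    have h1 : HasDerivAt (fun s : ℂ => Function.update (x.2 0) j s) (Pi.single j 1) (x.2 0 j) :=
      hasDerivAt_update (x.2 0) j (x.2 0 j)
    have h2 : HasFDerivAt (fun w => topCoord R.M c δ z (Function.update x.2 0 w) x.1)
        (fderiv ℂ (fun w => topCoord R.M c δ z (Function.update x.2 0 w) x.1) (x.2 0))
        (Function.update (x.2 0) j (x.2 0 j)) := by
      rw [Function.update_eq_self]
      exact ha.differentiableAt.hasFDerivAt
    have h3 := hasDerivAt_pi.1 (h2.comp_hasDerivAt _ h1) i
    rw [← h3.deriv]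
    have h4 : ∀ u : LatticeVar N, zs R.M c z i ((δ i : ℤ) + 1) (x.1, u) =
        topCoord R.M c δ z u x.1 i := fun u => by
      have := zs_eq_pullback R.M c z i (δ i + 1) (x.1, u)
      push_cast at this
      exact this
    simp only [jacobian, pd, Matrix.of_apply, h4]
    rfl
  funext i
  have he : e = ∑ j, e j • (Pi.single j 1 : Fin N → ℂ) := by
    rw [← Finset.univ_sum_single e]
    refine Finset.sum_congr rfl fun j _ => ?_
    rw [← Pi.single_smul, smul_eq_mul, mul_one, Finset.univ_sum_single]
  conv_rhs => rw [he]
  simp only [Matrix.mulVec, dotProduct, hcol, map_sum, map_smul, Finset.sum_apply, Pi.smul_apply,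
    smul_eq_mul, mul_comm]

/-- The germs expressing `𝒮^{d_i+1}(z^i)` through the `z^{i'}_{k'}` and `u`, and `u` through the
`z^{i'}_{k'}`. -/
theorem exists_solution_germ (S : InvariantSystem R c δ D z) (hH : HasCodim H r)
    (hδ : ∑ i, δ i + N = r) {x : Phase N d k} (hx : SolvableAt R.M c δ V D z x) :
    ∃ Φ f₀ : ((Σ i : Fin N, Fin (δ i + 1)) → ℂ) × (Fin N → ℂ) → Fin N → ℂ,
      (∀ᶠ y in 𝓝 x, ∀ i, zs R.M c z i ((δ i : ℤ) + 1) y = Φ (zLow R.M c δ z y, y.2 0) i) ∧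
      AnalyticAt ℂ f₀ (zLow R.M c δ z x, fullTop (zFull R.M c δ z x)) ∧
      (∀ᶠ y in 𝓝 x, y.2 0 = f₀ (zLow R.M c δ z y, fullTop (zFull R.M c δ z y))) ∧
      ∀ᶠ y in 𝓝 (zLow R.M c δ z x, fullTop (zFull R.M c δ z x)), Φ (y.1, f₀ y) = y.2 := by
  obtain ⟨hxV, hD, hC, hdet⟩ := hx
  obtain ⟨Φ, hΦa, hΦ⟩ := S.exists_top_germ hH hδ hxV hC hD
  have hgerm := S.eventually_zs_succ_eq_germ hxV hC hD hΦ
  have htop : fullTop (zFull R.M c δ z x) = Φ (zLow R.M c δ z x, x.2 0) := by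
    funext i
    rw [fullTop_zFull]
    exact hgerm.self_of_nhds i
  have hinj : ∀ e, fderiv ℂ Φ (zLow R.M c δ z x, x.2 0) (0, e) = 0 → e = 0 := by
    intro e he
    refine Matrix.eq_zero_of_mulVec_eq_zero hdet ?_
    rw [S.jacobian_mulVec hxV hD, ← he]
    have h1 : (fun w => topCoord R.M c δ z (Function.update x.2 0 w) x.1) =ᶠ[𝓝 (x.2 0)]
        fun w => Φ (zLow R.M c δ z x, w) := by
      have h2 : Tendsto (fun w : Fin N → ℂ => ((x.1 : JetAlg d k), w)) (𝓝 (x.2 0))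
          (𝓝 ((x.1 : JetAlg d k), x.2 0)) := tendsto_const_nhds.prodMk_nhds tendsto_id
      filter_upwards [h2.eventually hΦ] with w hw
      rw [hw, zLow_eq_lowCoord]
    have h3 := hΦa.differentiableAt.hasFDerivAt.comp (f := fun w => (zLow R.M c δ z x, w)) (x.2 0)
      (hasFDerivAt_prodMk_right _ _)
    rw [h1.fderiv_eq]
    exact congrArg (fun T : (Fin N → ℂ) →L[ℂ] (Fin N → ℂ) => T e) h3.fderiv
  obtain ⟨f₀, hfa, -, hfl, hfr⟩ := exists_analytic_solution hΦa hinj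
  rw [← htop] at hfa hfr
  refine ⟨Φ, f₀, hgerm, hfa, ?_, hfr⟩
  have hcont : ContinuousAt (fun y : Phase N d k => (zLow R.M c δ z y, y.2 0)) x :=
    (S.continuousAt_zLow hxV hC.1).prodMk (by fun_prop)
  filter_upwards [hgerm, hcont.eventually hfl] with y h1 h2
  have h3 : fullTop (zFull R.M c δ z y) = Φ (zLow R.M c δ z y, y.2 0) := by
    funext i
    rw [fullTop_zFull]
    exact h1 i
  rw [h3]
  exact h2.symm

theorem continuousAt_zFull (S : InvariantSystem R c δ D z) {x : Phase N d k}
    (hx : SolvableAt R.M c δ V D z x) : ContinuousAt (zFull R.M c δ z) x := by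
  refine continuousAt_pi.2 fun ⟨i, q⟩ => S.continuousAt_zs i hx.1 ?_
  induction q using Fin.lastCases with
  | last => simpa using hx.2.1 i
  | cast q => exact hx.2.2.1.1 i q (Nat.lt_succ_iff.1 q.2)

theorem exists_solvedFormula (S : InvariantSystem R c δ D z) (hH : HasCodim H r)
    (hδ : ∑ i, δ i + N = r) {x : Phase N d k} (hx : SolvableAt R.M c δ V D z x) :
    ∃ f, SolvedFormula R.M c δ z f x := by
  obtain ⟨Φ, f₀, -, hfa, hf, -⟩ := S.exists_solution_germ hH hδ hx
  refine ⟨AnalyticFun.ofFun fun w => f₀ (fullLow w, fullTop w), ?_⟩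
  have h1 : AnalyticAt ℂ (fun w => f₀ (fullLow w, fullTop w)) (zFull R.M c δ z x) :=
    hfa.comp_of_eq (analyticAt_fullLow_fullTop _) rfl
  filter_upwards [(S.continuousAt_zFull hx).eventually h1.eventually_analyticAt, hf] with y h2 h3
  exact ⟨h2, h3⟩

/-- If `u = f(z)` near a solvable point, then `f` is the inverse of the map given by the formula
for the `𝒮^{d_i+1}(z^i)` near the values of the `z^i_k` at this point. -/
theorem eventually_top_eq (S : InvariantSystem R c δ D z) (hH : HasCodim H r)
    (hδ : ∑ i, δ i + N = r) {x : Phase N d k} (hx : SolvableAt R.M c δ V D z x)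
    {f : ((Σ i : Fin N, Fin (δ i + 2)) → ℂ) → Fin N → ℂ}
    (hf : ∀ᶠ y in 𝓝 x, y.2 0 = f (zFull R.M c δ z y)) :
    ∃ Φ : ((Σ i : Fin N, Fin (δ i + 1)) → ℂ) × (Fin N → ℂ) → Fin N → ℂ,
      (∀ᶠ y in 𝓝 x, ∀ i, zs R.M c z i ((δ i : ℤ) + 1) y = Φ (zLow R.M c δ z y, y.2 0) i) ∧
      ∀ᶠ w in 𝓝 (zFull R.M c δ z x), Φ (fullLow w, f w) = fullTop w := by
  obtain ⟨Φ, f₀, hΦ, hfa, hf₀, hinv⟩ := S.exists_solution_germ hH hδ hx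
  refine ⟨Φ, hΦ, ?_⟩
  obtain ⟨σ, hσa, hσ0, hσ, -⟩ := exists_analytic_section
    (S.analyticAt_lowCoord hx.1 hx.2.2.1.1) (S.surjective_fderiv_lowCoord hx.1 hx.2.2.1)
  rw [← zLow_eq_lowCoord] at hσa hσ0 hσ
  have hlt := (analyticAt_fullLow_fullTop (zFull R.M c δ z x)).continuousAt.tendsto
  have hl : Tendsto fullLow (𝓝 (zFull R.M c δ z x)) (𝓝 (zLow R.M c δ z x)) :=
    (continuousAt_fst.tendsto).comp hlt
  have hg : Tendsto (fun w => σ (fullLow w)) (𝓝 (zFull R.M c δ z x)) (𝓝 (x.1 : JetAlg d k)) := by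
    have := hσa.continuousAt.tendsto.comp hl
    rwa [hσ0] at this
  -- a point near `x` at which the `z^i_k` have the values `w`
  let Y : ((Σ i : Fin N, Fin (δ i + 2)) → ℂ) → Phase N d k := fun w =>
    (toJetGroup (σ (fullLow w)), Function.update x.2 0 (f₀ (fullLow w, fullTop w)))
  have hY : Tendsto Y (𝓝 (zFull R.M c δ z x)) (𝓝 x) := by
    have h1 : Tendsto (fun w => toJetGroup (σ (fullLow w))) (𝓝 (zFull R.M c δ z x)) (𝓝 x.1) := by
      have := (continuousAt_toJetGroup x.1).tendsto.comp hg
      rwa [toJetGroup_coe] at this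
    have h2 : Tendsto (fun w => f₀ (fullLow w, fullTop w)) (𝓝 (zFull R.M c δ z x)) (𝓝 (x.2 0)) := by
      rw [hf₀.self_of_nhds]
      exact hfa.continuousAt.tendsto.comp hlt
    have h3 : Tendsto (fun w => Function.update x.2 0 (f₀ (fullLow w, fullTop w)))
        (𝓝 (zFull R.M c δ z x)) (𝓝 x.2) := by
      have := (tendsto_const_nhds (x := x.2)).update (0 : ℤ) h2
      rwa [Function.update_eq_self] at this
    exact h1.prodMk_nhds h3
  filter_upwards [hY.eventually hf, hY.eventually hΦ,
    hY.eventually (S.eventually_zLow_eq hx.1 hx.2.2.1.1), hl.eventually hσ, hlt.eventually hinv,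
    hg.eventually (eventually_toJetGroup x.1)] with w h1 h2 h3 h4 h5 h6
  have h7 : zLow R.M c δ z (Y w) = fullLow w := by
    rw [h3, ← h4]
    change lowCoord R.M c δ z x.2 (toJetGroup (σ (fullLow w)) : JetAlg d k) = _
    rw [h6]
  have h8 : (Y w).2 0 = f₀ (fullLow w, fullTop w) := by simp [Y]
  have h9 : zFull R.M c δ z (Y w) = w := by
    refine full_ext h7 ?_
    funext i
    rw [fullTop_zFull, h2, h7, h8, h5]
  rw [h9, h8] at h1
  rw [← h1, h5]

end InvariantSystem

end Solutions

/-! ### The total derivative along a curve -/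

section Flow

variable {m N d : ℕ} {c : Fin m → ℂ} {k : Fin m → ℕ} {H : Subgroup (JetGroup d k)}
  {V : Set (Fin N → ℂ)} {Λ : Set ℂ} {α β a b : ℤ} {E : LatticeFun N α β}
  {R : DarbouxLax d V Λ E a b} {δ : Fin N → ℕ} {D : Set (JetGroup d k ⧸ H)}
  {z : Fin N → JetGroup d k ⧸ H → ℂ} {r : ℕ}

/-- The chain rule for the total derivative of a function of finitely many lattice variables. -/
theorem totalDeriv_comp {ι : Type} [Fintype ι] (E : LatticeFun N α β) (l : ι → ℤ) (γ : ι → Fin N)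
    {h : (ι → ℂ) → ℂ} {u : LatticeVar N} (hh : DifferentiableAt ℂ h fun q => u (l q) (γ q)) :
    totalDeriv E (fun u => h fun q => u (l q) (γ q)) u =
      fderiv ℂ h (fun q => u (l q) (γ q)) fun q => E.toFun (win α β (seqShift (l q) u)) (γ q) := by
  classical
  set T := fderiv ℂ h fun q => u (l q) (γ q) with hT
  -- the tangent vector of the variation of one variable: a variable may occur several times
  let I : ℤ × Fin N → ι → ℂ := fun p q => if (l q, γ q) = p then 1 else 0
  have hpd : ∀ p : ℤ × Fin N, pd (fun u => h fun q => u (l q) (γ q)) p.1 p.2 u = T (I p) := by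
    rintro ⟨l₀, γ₀⟩
    have h1 : HasDerivAt (fun s : ℂ => fun q =>
        (Function.update u l₀ (Function.update (u l₀) γ₀ s)) (l q) (γ q)) (I (l₀, γ₀)) (u l₀ γ₀) := by
      refine hasDerivAt_pi.2 fun q => ?_
      by_cases hl : l q = l₀
      · by_cases hγ : γ q = γ₀
        · simpa [I, hl, hγ] using hasDerivAt_id' (u l₀ γ₀)
        · simpa [I, hl, hγ] using hasDerivAt_const (u l₀ γ₀) (u l₀ (γ q))
      · simpa [I, hl] using hasDerivAt_const (u l₀ γ₀) (u (l q) (γ q))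
    have h2 : HasFDerivAt h T (fun q =>
        (Function.update u l₀ (Function.update (u l₀) γ₀ (u l₀ γ₀))) (l q) (γ q)) := by
      simpa using hh.hasFDerivAt
    exact (h2.comp_hasDerivAt _ h1).deriv
  have hsupp : Function.support (fun p : ℤ × Fin N => E.toFun (win α β (seqShift p.1 u)) p.2 *
      pd (fun u => h fun q => u (l q) (γ q)) p.1 p.2 u) ⊆
      (Finset.univ.image fun q => (l q, γ q) : Finset (ℤ × Fin N)) := by
    intro p hp
    by_contra hnot
    have hI : I p = 0 := by
      funext q
      have : (l q, γ q) ≠ p := fun h => hnot (Finset.mem_coe.2 (h ▸ Finset.mem_image_of_mem _ (Finset.mem_univ q)))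
      simp [I, this]
    exact hp (by simp [hpd, hI])
  rw [totalDeriv, finsum_eq_sum_of_support_subset _ hsupp]
  simp only [hpd]
  have hvec : (fun q => E.toFun (win α β (seqShift (l q) u)) (γ q)) =
      ∑ p ∈ Finset.univ.image fun q => (l q, γ q), E.toFun (win α β (seqShift p.1 u)) p.2 • I p := by
    funext q
    rw [Finset.sum_apply, Finset.sum_eq_single (l q, γ q)]
    · simp [I]
    · intro p _ hp
      simp [I, hp.symm]
    · intro hq
      exact absurd (Finset.mem_image_of_mem _ (Finset.mem_univ q)) hq
  rw [hvec, map_sum]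
  simp only [map_smul, smul_eq_mul]

/-- The curve in the space of the `u_l` with the velocity `𝒮^l(F)` for `0 ≤ l ≤ n`. -/
def flowCurve (E : LatticeFun N α β) (n : ℕ) (u : LatticeVar N) (s : ℂ) : LatticeVar N :=
  fun l => if 0 ≤ l ∧ l ≤ n then u l + s • E.toFun (win α β (seqShift l u)) else u l

theorem flowCurve_zero (E : LatticeFun N α β) (n : ℕ) (u : LatticeVar N) :
    flowCurve E n u 0 = u := by
  funext l
  simp [flowCurve]

theorem hasDerivAt_flowCurve (E : LatticeFun N α β) {n : ℕ} (u : LatticeVar N) {l : ℤ} (h0 : 0 ≤ l)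
    (hl : l ≤ n) : HasDerivAt (fun s => flowCurve E n u s l)
      (E.toFun (win α β (seqShift l u))) 0 := by
  have : HasDerivAt (fun s : ℂ => u l + s • E.toFun (win α β (seqShift l u)))
      ((1 : ℂ) • E.toFun (win α β (seqShift l u))) 0 :=
    ((hasDerivAt_id (0 : ℂ)).smul_const _).const_add _
  rw [one_smul] at this
  simpa only [flowCurve, h0, hl, and_self, if_true] using this

theorem continuous_flowCurve (E : LatticeFun N α β) (n : ℕ) (u : LatticeVar N) :
    Continuous (flowCurve E n u) := by
  refine continuous_pi fun l => ?_
  unfold flowCurve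
  split_ifs <;> fun_prop

namespace InvariantSystem

/-- The Lax equation for the jets: `D_t(M) = 𝒮(U) M - M U`. -/
theorem fderiv_rho (S : InvariantSystem R c δ D z) {u : LatticeVar N} (hu : ∀ l, u l ∈ V)
    (hE : win α β u ∈ E.dom) (hU : win a b u ∈ R.domU) (hU' : win a b (seqShift 1 u) ∈ R.domU) :
    fderiv ℂ (fun w => (rho c k (R.M w) : JetAlg d k)) (u 0) (E.toFun (win α β u)) =
      jet c k (R.U (win a b (seqShift 1 u))) * (rho c k (R.M (u 0)) : JetAlg d k) -
        (rho c k (R.M (u 0)) : JetAlg d k) * jet c k (R.U (win a b u)) := by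
  have hM : ∀ p i j, AnalyticAt ℂ (fun lam => (R.M (u 0) lam : Matrix (Fin d) (Fin d) ℂ) i j) (c p) :=
    fun p i j => (R.analytic_M i j (u 0, c p) ⟨hu 0, S.mem_Λ p⟩).comp_of_eq
      (f := fun lam : ℂ => (u 0, lam)) (analyticAt_const.prod analyticAt_id) rfl
  have hUa : ∀ w ∈ R.domU, ∀ p i j, AnalyticAt ℂ (fun lam => R.U w lam i j) (c p) :=
    fun w hw p i j => (R.analytic_U i j (w, c p) ⟨hw, S.mem_Λ p⟩).comp_of_eq
      (f := fun lam : ℂ => (w, lam)) (analyticAt_const.prod analyticAt_id) rfl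
  have h1 := fderiv_jet (c := c) (k := k)
    (B := fun w lam => (R.M w lam : Matrix (Fin d) (Fin d) ℂ)) S.isOpen_V S.isOpen_Λ S.mem_Λ
    R.analytic_M (hu 0)
    (E.toFun (win α β u))
  simp only [rho_coe]
  have hmul : ∀ {A B : ℂ → Matrix (Fin d) (Fin d) ℂ} {p : Fin m},
      (∀ i j, AnalyticAt ℂ (fun lam => A lam i j) (c p)) →
      (∀ i j, AnalyticAt ℂ (fun lam => B lam i j) (c p)) →
      ∀ i j, AnalyticAt ℂ (fun lam => (A lam * B lam) i j) (c p) := by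
    intro A B p hA hB i j
    simp only [Matrix.mul_apply]
    exact Finset.analyticAt_fun_sum _ fun l _ => (hA i l).mul (hB l j)
  rw [h1, ← jet_mul (hUa _ hU') hM, ← jet_mul hM (hUa _ hU),
    ← jet_sub (fun p => hmul (hUa _ hU' p) (hM p)) (fun p => hmul (hM p) (hUa _ hU p))]
  refine jet_congr fun p => ?_
  filter_upwards [S.isOpen_Λ.mem_nhds (S.mem_Λ p)] with lam hlam
  rw [← R.lax u hu hE hU hU' lam hlam]
  ext i j
  have hdiff : DifferentiableAt ℂ (fun w => (R.M w lam : Matrix (Fin d) (Fin d) ℂ) i j) (u 0) :=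
    ((R.analytic_M i j (u 0, lam) ⟨hu 0, hlam⟩).comp_of_eq (f := fun w => (w, lam))
      (analyticAt_id.prod analyticAt_const) rfl).differentiableAt
  have h2 := totalDeriv_comp E (fun _ : Fin N => 0) id (u := u) hdiff
  simp only [seqShift_zero] at h2
  exact h2.symm

/-- Along the flow the `G`-component of `𝒮^j` has the velocity `𝒮^j(U) 𝒮^j(W)`: the operators `D_t`
and `𝒮` commute. -/
theorem hasDerivAt_transfer (S : InvariantSystem R c δ D z) {n : ℕ} {g : JetGroup d k}
    {u : LatticeVar N} (hu : ∀ l, u l ∈ V)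
    (hE : ∀ l : ℤ, 0 ≤ l → l ≤ n → win α β (seqShift l u) ∈ E.dom)
    (hU : ∀ l : ℤ, 0 ≤ l → l ≤ n → win a b (seqShift l u) ∈ R.domU) {j : ℕ} (hj : j ≤ n) :
    HasDerivAt (fun s : ℂ => (transfer R.M c k j (flowCurve E n u s) : JetAlg d k) *
        ((g : JetAlg d k) + s • (jet c k (R.U (win a b u)) * (g : JetAlg d k))))
      (jet c k (R.U (win a b (seqShift j u))) *
        ((transfer R.M c k j u : JetAlg d k) * (g : JetAlg d k))) 0 := by
  induction j with
  | zero =>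
    have : HasDerivAt (fun s : ℂ => (g : JetAlg d k) + s • (jet c k (R.U (win a b u)) * (g : JetAlg d k)))
        ((1 : ℂ) • (jet c k (R.U (win a b u)) * (g : JetAlg d k))) 0 :=
      ((hasDerivAt_id (0 : ℂ)).smul_const _).const_add _
    simpa [transfer, seqShift_zero] using this
  | succ j ih =>
    have h0 : (0 : ℤ) ≤ j := by positivity
    have hjn : (j : ℤ) ≤ n := by omega
    have h1 : HasDerivAt (fun s => (rho c k (R.M (flowCurve E n u s j)) : JetAlg d k))
        (fderiv ℂ (fun w => (rho c k (R.M w) : JetAlg d k)) (u j)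
          (E.toFun (win α β (seqShift j u)))) 0 := by
      have hd : HasFDerivAt (fun w => (rho c k (R.M w) : JetAlg d k))
          (fderiv ℂ (fun w => (rho c k (R.M w) : JetAlg d k)) (u j)) (flowCurve E n u 0 j) := by
        rw [flowCurve_zero]
        exact (analyticOnNhd_rho S.isOpen_V S.isOpen_Λ S.mem_Λ R.analytic_M _
          (hu j)).differentiableAt.hasFDerivAt
      exact hd.comp_hasDerivAt _ (hasDerivAt_flowCurve E u h0 hjn)
    have hlax := S.fderiv_rho (k := k) (u := seqShift j u) (fun l => hu _) (hE j h0 hjn) (hU j h0 hjn)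
      (by
        rw [seqShift_seqShift]
        exact hU _ (by omega) (by omega))
    have hsj : seqShift j u 0 = u j := by simp [seqShift]
    rw [hsj, seqShift_seqShift] at hlax
    have h2 := h1.jetMul (ih (by omega))
    rw [hlax] at h2
    simp only [flowCurve_zero, zero_smul, add_zero] at h2
    simp only [transfer, Units.val_mul, mul_assoc]
    convert h2 using 1
    rw [JetAlg.sub_mul]
    push_cast
    simp only [mul_assoc, add_comm (j : ℤ) 1]
    abel

/-- If `u = f(z)` near `x`, the derivatives of both sides along the flow agree. -/
theorem solved_flow (S : InvariantSystem R c δ D z) {x : Phase N d k} (hx : ∀ l, x.2 l ∈ V)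
    (hE : ∀ l : ℤ, 0 ≤ l → l ≤ topShift δ → win α β (seqShift l x.2) ∈ E.dom)
    (hU : ∀ l : ℤ, 0 ≤ l → l ≤ topShift δ → win a b (seqShift l x.2) ∈ R.domU)
    (hD : ∀ q : Σ i : Fin N, Fin (δ i + 2), ZDefined R.M c D ((q.2 : ℕ) : ℤ) x)
    {f : AnalyticFun ((Σ i : Fin N, Fin (δ i + 2)) → ℂ) (Fin N → ℂ)}
    (hf : SolvedFormula R.M c δ z f x) :
    E.toFun (win α β x.2) = fderiv ℂ f.toFun (zFull R.M c δ z x) fun q =>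
      phaseDeriv R c (fun y => z q.1 (y.1 : JetGroup d k ⧸ H))
        ((phaseShift R.M c k ^ ((q.2 : ℕ) : ℤ)) x) := by
  obtain ⟨g, u⟩ := x
  -- `Y` is a curve through `(g, u)` with the velocity `D_t`, as far as the relevant variables go
  let A : ℂ → JetAlg d k := fun s => (g : JetAlg d k) + s • (jet c k (R.U (win a b u)) * (g : JetAlg d k))
  have hA0 : A 0 = g := by simp [A]
  have hAc : Continuous A := by fun_prop
  have hA : Tendsto A (𝓝 0) (𝓝 (g : JetAlg d k)) := by
    have := hAc.tendsto 0
    rwa [hA0] at this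
  let B : (Σ i : Fin N, Fin (δ i + 2)) → ℂ → ℂ := fun q s =>
    pullback (z q.1) ((transfer R.M c k q.2 (flowCurve E (topShift δ) u s) : JetAlg d k) * A s)
  let Y : ℂ → Phase N d k := fun s => (toJetGroup (A s), flowCurve E (topShift δ) u s)
  have hY : Tendsto Y (𝓝 0) (𝓝 (g, u)) := by
    have h1 : Tendsto (fun s => toJetGroup (A s)) (𝓝 0) (𝓝 g) := by
      have := (continuousAt_toJetGroup g).tendsto.comp hA
      rwa [toJetGroup_coe] at this
    have h2 := (continuous_flowCurve E (topShift δ) u).tendsto 0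
    rw [flowCurve_zero] at h2
    exact h1.prodMk_nhds h2
  have hBY : ∀ s, (toJetGroup (A s) : JetAlg d k) = A s → (fun q => B q s) = zFull R.M c δ z (Y s) := by
    intro s hs
    funext q
    rw [zFull, zs_eq_pullback]
    simp only [Y, hs, B]
  have hB0 : (fun q => B q 0) = zFull R.M c δ z (g, u) := by
    funext q
    rw [zFull, zs_eq_pullback]
    simp only [B, hA0, flowCurve_zero]
  have hBd : HasDerivAt (fun s q => B q s) (fun q =>
      phaseDeriv R c (fun y => z q.1 (y.1 : JetGroup d k ⧸ H))
        ((phaseShift R.M c k ^ ((q.2 : ℕ) : ℤ)) (g, u))) 0 := by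
    refine hasDerivAt_pi.2 fun q => ?_
    rw [phaseDeriv_eq, phaseShift_natCast]
    have hq := (mem_window_f q).2
    have h1 := S.hasDerivAt_transfer (g := g) hx hE hU (j := q.2) (by omega)
    have h2 : HasFDerivAt (pullback (z q.1)) (fderiv ℂ (pullback (z q.1))
        ((transfer R.M c k q.2 u : JetAlg d k) * (g : JetAlg d k)))
        ((transfer R.M c k q.2 (flowCurve E (topShift δ) u 0) : JetAlg d k) * A 0) := by
      have h3 := hD q
      rw [zDefined_natCast] at h3
      have h4 := (S.analyticAt_pullback q.1 h3).differentiableAt.hasFDerivAt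
      rw [flowCurve_zero, hA0]
      rwa [Units.val_mul] at h4
    have h5 := h2.comp_hasDerivAt _ h1
    rw [← Units.val_mul] at h5
    exact h5
  have hfd : HasFDerivAt f.toFun (fderiv ℂ f.toFun (zFull R.M c δ z (g, u))) (fun q => B q 0) := by
    rw [hB0]
    exact (f.analytic _ hf.self_of_nhds.1).differentiableAt.hasFDerivAt
  have hd1 := hfd.comp_hasDerivAt (0 : ℂ) hBd
  have hd2 := hasDerivAt_flowCurve E u (l := 0) (n := topShift δ) le_rfl (by positivity)
  rw [seqShift_zero] at hd2
  -- both sides of `u = f(z)` along the curve have the same derivative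
  refine hd2.unique (hd1.congr_of_eventuallyEq ?_)
  filter_upwards [hY.eventually hf, hA.eventually (eventually_toJetGroup g)] with s h1 h2
  simp only [Function.comp, hBY s h2]
  exact h1.2

end InvariantSystem

end Flow

/-! ### Points with prescribed values of the invariants -/

section Miura

variable {m N d : ℕ} {c : Fin m → ℂ} {k : Fin m → ℕ} {H : Subgroup (JetGroup d k)}
  {V : Set (Fin N → ℂ)} {Λ : Set ℂ} {α β a b : ℤ} {E : LatticeFun N α β}
  {R : DarbouxLax d V Λ E a b} {δ : Fin N → ℕ} {D : Set (JetGroup d k ⧸ H)}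
  {z : Fin N → JetGroup d k ⧸ H → ℂ} {r : ℕ}

/-- The variables `v^i_{l+k}`, `0 ≤ k ≤ d_i + 1`, on which `𝒮^l(f)` depends. -/
def fullAt (δ : Fin N → ℕ) (l : ℤ) (v : LatticeVar N) : (Σ i : Fin N, Fin (δ i + 2)) → ℂ :=
  fun q => v ((q.2 : ℕ) + l) q.1

/-- The values of all the `𝒮^l(z^i)` at a point. -/
noncomputable def zAll (M : (Fin N → ℂ) → ℂ → GL (Fin d) ℂ) (c : Fin m → ℂ)
    (z : Fin N → JetGroup d k ⧸ H → ℂ) (x : Phase N d k) : LatticeVar N :=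
  fun l i => zs M c z i l x

theorem continuous_fullAt (l : ℤ) : Continuous (fullAt δ l) := by
  unfold fullAt
  fun_prop

theorem fullAt_zAll (M : (Fin N → ℂ) → ℂ → GL (Fin d) ℂ) (c : Fin m → ℂ)
    (z : Fin N → JetGroup d k ⧸ H → ℂ) (l : ℤ) (x : Phase N d k) :
    fullAt δ l (zAll M c z x) = zFull M c δ z ((phaseShift M c k ^ l) x) := by
  funext q
  rw [fullAt, zAll, zs_add]
  rfl

theorem fullAt_seqShift (l j : ℤ) (v : LatticeVar N) :
    fullAt δ l (seqShift j v) = fullAt δ (l + j) v := by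
  funext q
  simp only [fullAt, seqShift, add_assoc]

namespace InvariantSystem

/-- Near a point `x` the `𝒮^l(z^i)` with `0 ≤ l ≤ d_i + n` are independent, if `𝒮^j x` is solvable
for `0 ≤ j < n`: every nearby system of values is attained at a point given by `u_j = 𝒮^j(f)`. -/
theorem exists_point_aux (S : InvariantSystem R c δ D z) (hH : HasCodim H r)
    (hδ : ∑ i, δ i + N = r) {n : ℕ} (hn : 0 < n) {x : Phase N d k}
    (hx : ∀ j : ℕ, j < n → SolvableAt R.M c δ V D z ((phaseShift R.M c k ^ (j : ℤ)) x))
    {f : AnalyticFun ((Σ i : Fin N, Fin (δ i + 2)) → ℂ) (Fin N → ℂ)}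
    (hf : ∀ j : ℕ, j < n → SolvedFormula R.M c δ z f ((phaseShift R.M c k ^ (j : ℤ)) x)) :
    ∃ Y : LatticeVar N → Phase N d k, Tendsto Y (𝓝 (zAll R.M c z x)) (𝓝 x) ∧
      ∀ᶠ v in 𝓝 (zAll R.M c z x), (∀ l, (Y v).2 l ∈ V) ∧
        ∀ i, ∀ t : ℕ, t ≤ δ i + n → zs R.M c z i t (Y v) = v t i := by
  have hx0 : SolvableAt R.M c δ V D z x := by simpa using hx 0 hn
  set v₀ := zAll R.M c z x with hv₀
  obtain ⟨σ, hσa, hσ0, hσ, -⟩ := exists_analytic_section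
    (S.analyticAt_lowCoord hx0.1 hx0.2.2.1.1) (S.surjective_fderiv_lowCoord hx0.1 hx0.2.2.1)
  have hlow0 : fullLow (fullAt δ 0 v₀) = lowCoord R.M c δ z x.2 x.1 := by
    rw [fullAt_zAll, zpow_zero, Equiv.Perm.one_apply, fullLow_zFull, zLow_eq_lowCoord]
  have hlc : ∀ w : (Σ i : Fin N, Fin (δ i + 2)) → ℂ, ContinuousAt fullLow w := fun w =>
    (analyticAt_fullLow_fullTop w).continuousAt.fst
  have hlt : Tendsto (fun v => fullLow (fullAt δ 0 v)) (𝓝 v₀) (𝓝 (lowCoord R.M c δ z x.2 x.1)) := by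
    rw [← hlow0]
    exact (hlc _).tendsto.comp ((continuous_fullAt 0).tendsto v₀)
  have hA : Tendsto (fun v => σ (fullLow (fullAt δ 0 v))) (𝓝 v₀) (𝓝 (x.1 : JetAlg d k)) := by
    have := hσa.continuousAt.tendsto.comp hlt
    rwa [hσ0] at this
  -- the component in `G` is given by a section of the `z^i_k`, `k ≤ d_i`, the `u_l` by `𝒮^l(f)`
  let W : LatticeVar N → LatticeVar N := fun v l =>
    if 0 ≤ l ∧ l < n then f.toFun (fullAt δ l v) else x.2 l
  have hWl : ∀ l, Tendsto (fun v => W v l) (𝓝 v₀) (𝓝 (x.2 l)) := by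
    intro l
    by_cases hl : 0 ≤ l ∧ l < n
    · simp only [W, if_pos hl]
      obtain ⟨j, rfl⟩ := Int.eq_ofNat_of_zero_le hl.1
      have h1 := (hf j (by omega)).self_of_nhds
      rw [← fullAt_zAll] at h1
      have h2 : x.2 (j : ℤ) = f.toFun (fullAt δ j v₀) := by
        rw [← h1.2, phaseShift_zpow_snd, seqShift, zero_add]
      rw [h2]
      exact (f.analytic _ h1.1).continuousAt.tendsto.comp ((continuous_fullAt _).tendsto v₀)
    · simp only [W, if_neg hl]
      exact tendsto_const_nhds
  let Y : LatticeVar N → Phase N d k := fun v => (toJetGroup (σ (fullLow (fullAt δ 0 v))), W v)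
  have hY : Tendsto Y (𝓝 v₀) (𝓝 x) := by
    have h1 := (continuousAt_toJetGroup x.1).tendsto.comp hA
    rw [toJetGroup_coe] at h1
    exact h1.prodMk_nhds (tendsto_pi_nhds.2 hWl)
  refine ⟨Y, hY, ?_⟩
  have hV : ∀ᶠ v in 𝓝 v₀, ∀ l, (Y v).2 l ∈ V := by
    filter_upwards [hY.eventually (eventually_mem_of_isOpen S.isOpen_V hx0.1 0 n)] with v hv l
    by_cases hl : 0 ≤ l ∧ l < n
    · exact hv l hl.1 hl.2
    · change W v l ∈ V
      simp only [W, if_neg hl]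
      exact hx0.1 l
  refine hV.and ?_
  -- `z^i_{d_i+s+1}` is determined by the `z^{i'}_{k'+s}` and `u_s`, and `f` inverts this relation
  have hind : ∀ s : ℕ, s ≤ n → ∀ᶠ v in 𝓝 v₀, ∀ i, ∀ t : ℕ, t ≤ δ i + s →
      zs R.M c z i t (Y v) = v t i := by
    intro s
    induction s with
    | zero =>
      intro _
      filter_upwards [hY.eventually (S.eventually_zLow_eq hx0.1 hx0.2.2.1.1), hlt.eventually hσ,
        hA.eventually (eventually_toJetGroup x.1)] with v h1 h2 h3 i t ht
      have h4 : zLow R.M c δ z (Y v) = fullLow (fullAt δ 0 v) := by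
        rw [h1, ← h2]
        change lowCoord R.M c δ z x.2 (toJetGroup (σ (fullLow (fullAt δ 0 v))) : JetAlg d k) = _
        rw [h3, h2]
      have h5 := congrFun h4 ⟨i, ⟨t, by omega⟩⟩
      simpa [zLow, fullLow, fullAt] using h5
    | succ s ih =>
      intro hs
      have hxs := hx s (by omega)
      have hYs : Tendsto (fun v => (phaseShift R.M c k ^ (s : ℤ)) (Y v)) (𝓝 v₀)
          (𝓝 ((phaseShift R.M c k ^ (s : ℤ)) x)) :=
        (continuousAt_phaseShift_zpow S.isOpen_V S.isOpen_Λ S.mem_Λ R.analytic_M s hx0.1).tendsto.comp hY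
      obtain ⟨Φ, hΦ, hinv⟩ := S.eventually_top_eq hH hδ hxs
        ((hf s (by omega)).mono fun y hy => hy.2)
      rw [← fullAt_zAll] at hinv
      filter_upwards [ih (by omega), hYs.eventually hΦ,
        ((continuous_fullAt s).tendsto v₀).eventually hinv] with v h1 h2 h3 i t ht
      rcases Nat.lt_or_ge t (δ i + (s + 1)) with hlt | hge
      · exact h1 i t (by omega)
      · obtain rfl : t = δ i + (s + 1) := by omega
        have h4 := h2 i
        rw [← zs_add] at h4
        have h5 : zLow R.M c δ z ((phaseShift R.M c k ^ (s : ℤ)) (Y v)) = fullLow (fullAt δ s v) := by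
          funext q
          have hq := q.2.2
          have h6 := h1 q.1 (q.2 + s) (by omega)
          push_cast at h6
          rw [zs_add] at h6
          exact h6
        have h7 : ((phaseShift R.M c k ^ (s : ℤ)) (Y v)).2 0 = f.toFun (fullAt δ s v) := by
          rw [phaseShift_zpow_snd, seqShift, zero_add]
          have : (0 : ℤ) ≤ s ∧ (s : ℤ) < n := ⟨by omega, by omega⟩
          simp only [Y, W, if_pos this]
        rw [h5, h7, h3] at h4
        push_cast
        rw [← add_assoc, add_right_comm, h4]
        simp only [fullTop, fullAt, Fin.val_last]
        push_cast
        congr 1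
  exact hind n le_rfl

/-- The form of `exists_point_aux` for shifts by `p ≤ j ≤ q`, obtained by moving the base point to
`𝒮^p x`. -/
theorem exists_point (S : InvariantSystem R c δ D z) (hH : HasCodim H r)
    (hδ : ∑ i, δ i + N = r) {p q : ℤ} (hpq : p ≤ q) {x : Phase N d k}
    (hx : ∀ j ∈ Set.Icc p q, SolvableAt R.M c δ V D z ((phaseShift R.M c k ^ j) x))
    {f : AnalyticFun ((Σ i : Fin N, Fin (δ i + 2)) → ℂ) (Fin N → ℂ)}
    (hf : ∀ j ∈ Set.Icc p q, SolvedFormula R.M c δ z f ((phaseShift R.M c k ^ j) x)) :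
    ∃ Y : LatticeVar N → Phase N d k, Tendsto Y (𝓝 (zAll R.M c z x)) (𝓝 x) ∧
      ∀ᶠ v in 𝓝 (zAll R.M c z x), (∀ l, (Y v).2 l ∈ V) ∧
        ∀ j ∈ Set.Icc p q, zFull R.M c δ z ((phaseShift R.M c k ^ j) (Y v)) = fullAt δ j v := by
  set x₀ := (phaseShift R.M c k ^ p) x with hx₀
  have hmem : ∀ j : ℕ, j < (q - p + 1).toNat → (j : ℤ) + p ∈ Set.Icc p q := fun j hj =>
    ⟨by omega, by omega⟩
  obtain ⟨Y₀, hY₀, hev⟩ := S.exists_point_aux hH hδ (n := (q - p + 1).toNat) (by omega) (x := x₀)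
    (fun j hj => by
      rw [hx₀, ← phaseShift_zpow_add]
      exact hx _ (hmem j hj))
    (f := f) (fun j hj => by
      rw [hx₀, ← phaseShift_zpow_add]
      exact hf _ (hmem j hj))
  have hx₀V : ∀ l, x₀.2 l ∈ V := (hx p ⟨le_rfl, hpq⟩).1
  have hzAll : zAll R.M c z x₀ = seqShift p (zAll R.M c z x) := by
    funext l i
    simp only [zAll, seqShift, zs_add, hx₀]
  have hshift : Tendsto (seqShift p) (𝓝 (zAll R.M c z x)) (𝓝 (zAll R.M c z x₀)) := by
    rw [hzAll]
    exact (continuous_seqShift p).tendsto _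
  have hback : (phaseShift R.M c k ^ (-p)) x₀ = x := by
    rw [hx₀, ← phaseShift_zpow_add, neg_add_cancel, zpow_zero, Equiv.Perm.one_apply]
  refine ⟨fun v => (phaseShift R.M c k ^ (-p)) (Y₀ (seqShift p v)), ?_, ?_⟩
  · have := (continuousAt_phaseShift_zpow (k := k) S.isOpen_V S.isOpen_Λ S.mem_Λ R.analytic_M (-p)
      hx₀V).tendsto.comp (hY₀.comp hshift)
    rwa [hback] at this
  · filter_upwards [hshift.eventually hev] with v hv
    refine ⟨fun l => ?_, fun j hj => ?_⟩
    · rw [phaseShift_zpow_snd]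
      exact hv.1 _
    · funext s
      have hs := s.2.2
      obtain ⟨t, ht⟩ := Int.eq_ofNat_of_zero_le (show 0 ≤ ((s.2 : ℕ) : ℤ) + (j - p) by
        have := hj.1
        omega)
      have h1 := hv.2 s.1 t (by
        have := hj.2
        omega)
      rw [zFull, ← phaseShift_zpow_add, ← zs_add,
        show ((s.2 : ℕ) : ℤ) + (j + -p) = t by rw [← sub_eq_add_neg, ht], h1, seqShift, fullAt]
      congr 1
      have : (t : ℤ) = ((s.2 : ℕ) : ℤ) + (j - p) := ht.symm
      omega

end InvariantSystem

end Miura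

/-! ### The defining identity of the transformation -/

section Identity

variable {m N d : ℕ} {c : Fin m → ℂ} {k : Fin m → ℕ} {H : Subgroup (JetGroup d k)}
  {V : Set (Fin N → ℂ)} {Λ : Set ℂ} {α β a b : ℤ} {E : LatticeFun N α β}
  {R : DarbouxLax d V Λ E a b} {δ : Fin N → ℕ} {D : Set (JetGroup d k ⧸ H)}
  {z : Fin N → JetGroup d k ⧸ H → ℂ} {r : ℕ}
  {f : AnalyticFun ((Σ i : Fin N, Fin (δ i + 2)) → ℂ) (Fin N → ℂ)}
  {Q : AnalyticFun (((Σ i : Fin N, Fin (δ i + 1)) → ℂ) × Win N a b) (Fin N → ℂ)}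

theorem miuraFun_win (v : LatticeVar N) :
    (miuraFun f).toFun (win 0 (topShift δ) v) = f.toFun (fullAt δ 0 v) := by
  have : (fun q : Σ i : Fin N, Fin (δ i + 2) =>
      win (0 : ℤ) (topShift δ) v ⟨_, mem_window_f q⟩ q.1) = fullAt δ 0 v := by
    funext q
    simp only [win, fullAt, add_zero]
  exact congrArg f.toFun this

theorem mem_miuraFun_dom (v : LatticeVar N) :
    win 0 (topShift δ) v ∈ (miuraFun f).dom ↔ fullAt δ 0 v ∈ f.dom := by
  have : (fun q : Σ i : Fin N, Fin (δ i + 2) =>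
      win (0 : ℤ) (topShift δ) v ⟨_, mem_window_f q⟩ q.1) = fullAt δ 0 v := by
    funext q
    simp only [win, fullAt, add_zero]
  change _ ∈ f.dom ↔ _
  rw [this]

theorem vLow_win (v : LatticeVar N) :
    vLow a b (win (min 0 a) (max 0 b + topShift δ) v) = fullLow (fullAt δ 0 v) := by
  funext q
  simp only [vLow, win, fullLow, fullAt, add_zero, Fin.val_castSucc]

theorem modifiedEq_win (v : LatticeVar N) :
    (modifiedEq Q f).toFun (win (min 0 a) (max 0 b + topShift δ) v) =
      Q.toFun (fullLow (fullAt δ 0 v), fun j : Set.Icc a b => f.toFun (fullAt δ j v)) := by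
  rw [← vLow_win (a := a) (b := b)]
  rfl

theorem mem_modifiedEq_dom (v : LatticeVar N) :
    win (min 0 a) (max 0 b + topShift δ) v ∈ (modifiedEq Q f).dom ↔
      (∀ j : Set.Icc a b, fullAt δ j v ∈ f.dom) ∧
      (fullLow (fullAt δ 0 v), fun j : Set.Icc a b => f.toFun (fullAt δ j v)) ∈ Q.dom := by
  rw [← vLow_win (a := a) (b := b)]
  rfl

/-- The left-hand side of the identity, expressed through the chain rule. -/
theorem totalDeriv_miuraFun {p' q' : ℤ} (E' : LatticeFun N p' q') {v : LatticeVar N}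
    (hv : fullAt δ 0 v ∈ f.dom) (i : Fin N) :
    totalDeriv E' (fun v => (miuraFun f).toFun (win 0 (topShift δ) v) i) v =
      fderiv ℂ f.toFun (fullAt δ 0 v)
        (fun q => E'.toFun (win p' q' (seqShift ((q.2 : ℕ) : ℤ) v)) q.1) i := by
  have hd := (f.analytic _ hv).differentiableAt
  have hdi : HasFDerivAt (fun w => f.toFun w i)
      ((ContinuousLinearMap.proj (R := ℂ) (φ := fun _ : Fin N => ℂ) i).comp
        (fderiv ℂ f.toFun (fullAt δ 0 v))) (fullAt δ 0 v) :=
    (ContinuousLinearMap.proj (R := ℂ) (φ := fun _ : Fin N => ℂ) i).hasFDerivAt.comp _ hd.hasFDerivAt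
  have hz : ∀ v : LatticeVar N, fullAt δ 0 v =
      fun q : Σ i : Fin N, Fin (δ i + 2) => v ((q.2 : ℕ) : ℤ) q.1 := fun v => by
    funext q
    simp only [fullAt, add_zero]
  have h := totalDeriv_comp E' (fun q : Σ i : Fin N, Fin (δ i + 2) => ((q.2 : ℕ) : ℤ))
    (fun q => q.1) (h := fun w => f.toFun w i) (u := v) (by
      rw [← hz]
      exact hdi.differentiableAt)
  rw [← hz, hdi.fderiv] at h
  simp only [miuraFun_win, hz] at h ⊢
  exact h

theorem isOpen_miuraDom {p' q' p q : ℤ} (E' : LatticeFun N p' q') (E : LatticeFun N α β)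
    (f : LatticeFun N p q) : IsOpen (miuraDom E' E f) := by
  have hw : ∀ (p q l : ℤ), Continuous fun v : LatticeVar N => win p q (seqShift l v) :=
    fun p q l => (continuous_win p q).comp (continuous_seqShift l)
  have h1 : IsOpen {v : LatticeVar N | win p q v ∈ f.dom} :=
    f.isOpen_dom.preimage (continuous_win p q)
  have h2 : IsOpen {v : LatticeVar N | ∀ l ∈ Set.Icc p q, win p' q' (seqShift l v) ∈ E'.dom} := by
    simp only [Set.ofPred_forall]
    exact (Set.finite_Icc p q).isOpen_biInter fun l _ => E'.isOpen_dom.preimage (hw _ _ l)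
  have h3 : IsOpen {v : LatticeVar N | ∀ l ∈ Set.Icc α β, win p q (seqShift l v) ∈ f.dom} := by
    simp only [Set.ofPred_forall]
    exact (Set.finite_Icc α β).isOpen_biInter fun l _ => f.isOpen_dom.preimage (hw _ _ l)
  have h4 : ContinuousOn (fun v : LatticeVar N =>
      (fun l : Set.Icc α β => f.toFun (win p q (seqShift l v))))
      {v : LatticeVar N | ∀ l ∈ Set.Icc α β, win p q (seqShift l v) ∈ f.dom} :=
    continuousOn_pi.2 fun l => f.analytic.continuousOn.comp (hw _ _ l).continuousOn
      fun v hv => hv l l.2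
  exact h1.inter (h2.inter (h4.isOpen_inter_preimage h3 E.isOpen_dom))

namespace InvariantSystem

theorem mem_shiftRange_of_top {l : ℤ} (h0 : 0 ≤ l) (h1 : l ≤ topShift δ) :
    l ∈ shiftRange δ α β a b := ⟨by omega, by omega⟩

/-- At a point near which `u = f(z)` and `D_t(z^i) = Q^i(z, u_a, …, u_b)` along its orbit, the
defining identity of the transformation holds for every `v` that has the same relevant variables
as the point. -/
theorem identity_at_point (S : InvariantSystem R c δ D z) {x : Phase N d k} (hx : ∀ l, x.2 l ∈ V)
    (hE : ∀ l : ℤ, 0 ≤ l → l ≤ topShift δ → win α β (seqShift l x.2) ∈ E.dom)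
    (hU : ∀ l : ℤ, 0 ≤ l → l ≤ topShift δ → win a b (seqShift l x.2) ∈ R.domU)
    (hD : ∀ q : Σ i : Fin N, Fin (δ i + 2), ZDefined R.M c D ((q.2 : ℕ) : ℤ) x)
    (hf : ∀ᶠ y in 𝓝 x, zFull R.M c δ z y ∈ f.dom ∧ y.2 0 = f.toFun (zFull R.M c δ z y))
    (hfj : ∀ j ∈ shiftRange δ α β a b, ((phaseShift R.M c k ^ j) x).2 0 =
      f.toFun (zFull R.M c δ z ((phaseShift R.M c k ^ j) x)))
    (hQ : ∀ j ∈ shiftRange δ α β a b, ∀ i,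
      phaseDeriv R c (fun y => z i (y.1 : JetGroup d k ⧸ H)) ((phaseShift R.M c k ^ j) x) =
        Q.toFun (zLow R.M c δ z ((phaseShift R.M c k ^ j) x),
          win a b ((phaseShift R.M c k ^ j) x).2) i)
    {v : LatticeVar N} (hv : ∀ j ∈ shiftRange δ α β a b,
      zFull R.M c δ z ((phaseShift R.M c k ^ j) x) = fullAt δ j v) (i : Fin N) :
    totalDeriv (modifiedEq Q f) (fun v => (miuraFun f).toFun (win 0 (topShift δ) v) i) v =
      E.toFun (fun l : Set.Icc α β => (miuraFun f).toFun (win 0 (topShift δ) (seqShift l v))) i := by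
  have h0 : zFull R.M c δ z x = fullAt δ 0 v := by
    have := hv 0 (mem_shiftRange_of_top le_rfl (by positivity))
    rwa [zpow_zero, Equiv.Perm.one_apply] at this
  have huj : ∀ j ∈ shiftRange δ α β a b, f.toFun (fullAt δ j v) = x.2 j := by
    intro j hj
    rw [← hv j hj, ← hfj j hj, phaseShift_zpow_snd, seqShift, zero_add]
  have hflow := S.solved_flow hx hE hU hD (f := f) hf
  rw [totalDeriv_miuraFun _ (by rw [← h0]; exact hf.self_of_nhds.1)]
  have hright : (fun l : Set.Icc α β =>
      (miuraFun f).toFun (win 0 (topShift δ) (seqShift l v))) = win α β x.2 := by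
    funext l
    rw [miuraFun_win, fullAt_seqShift, zero_add, huj]
    · rfl
    · have h1 := l.2.1
      have h2 := l.2.2
      exact ⟨by omega, by omega⟩
  have hleft : (fun q : Σ i : Fin N, Fin (δ i + 2) => (modifiedEq Q f).toFun
      (win (min 0 a) (max 0 b + topShift δ) (seqShift ((q.2 : ℕ) : ℤ) v)) q.1) = fun q =>
      phaseDeriv R c (fun y => z q.1 (y.1 : JetGroup d k ⧸ H))
        ((phaseShift R.M c k ^ ((q.2 : ℕ) : ℤ)) x) := by
    funext q
    have hq := (mem_window_f q).2
    have hmem : ((q.2 : ℕ) : ℤ) ∈ shiftRange δ α β a b := mem_shiftRange_of_top (by positivity) hq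
    rw [modifiedEq_win, hQ _ hmem, fullAt_seqShift, zero_add, ← hv _ hmem, fullLow_zFull]
    have hwin : (fun j : Set.Icc a b => f.toFun (fullAt δ j (seqShift ((q.2 : ℕ) : ℤ) v))) =
        win a b ((phaseShift R.M c k ^ ((q.2 : ℕ) : ℤ)) x).2 := ?_
    · rw [hwin]
    funext j
    have h1 := j.2.1
    have h2 := j.2.2
    rw [fullAt_seqShift, huj _ ⟨by omega, by omega⟩, phaseShift_zpow_snd]
    rfl
  rw [hright, hleft, hflow, h0]

theorem zDefined_of_solvableAt {x : Phase N d k} (hx : SolvableAt R.M c δ V D z x)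
    (q : Σ i : Fin N, Fin (δ i + 2)) : ZDefined R.M c D ((q.2 : ℕ) : ℤ) x := by
  obtain ⟨i, q⟩ := q
  induction q using Fin.lastCases with
  | last => simpa using hx.2.1 i
  | cast q => exact hx.2.2.1.1 i q (Nat.lt_succ_iff.1 q.2)

/-- The defining identity holds near the values of the `𝒮^l(z^i)` at a regular point. -/
theorem eventually_identity (S : InvariantSystem R c δ D z) (hH : HasCodim H r)
    (hδ : ∑ i, δ i + N = r) {x : Phase N d k} (hx : RegularOrbit c δ R D z x)
    (hfQ : Compatible c δ R z f Q x) :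
    ∀ᶠ v in 𝓝 (zAll R.M c z x), ∀ i,
      totalDeriv (modifiedEq Q f) (fun v => (miuraFun f).toFun (win 0 (topShift δ) v) i) v =
        E.toFun (fun l : Set.Icc α β =>
          (miuraFun f).toFun (win 0 (topShift δ) (seqShift l v))) i := by
  have h0mem : (0 : ℤ) ∈ shiftRange δ α β a b := mem_shiftRange_of_top le_rfl (by positivity)
  have hx0 := hx 0 h0mem
  rw [zpow_zero, Equiv.Perm.one_apply] at hx0
  have hxV : ∀ l, x.2 l ∈ V := hx0.1.1
  obtain ⟨Y, hY, hev⟩ := S.exists_point hH hδ (h0mem.1.trans h0mem.2) (x := x)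
    (fun j hj => (hx j hj).1) (f := f) (fun j hj => (hfQ j hj).1)
  have hfin : (shiftRange δ α β a b).Finite := Set.finite_Icc _ _
  have hsc : ∀ j : ℤ, Tendsto (phaseShift R.M c k ^ j : Equiv.Perm (Phase N d k)) (𝓝 x)
      (𝓝 ((phaseShift R.M c k ^ j) x)) := fun j =>
    continuousAt_phaseShift_zpow S.isOpen_V S.isOpen_Λ S.mem_Λ R.analytic_M j hxV
  have hgood : ∀ᶠ y in 𝓝 x, ∀ j ∈ shiftRange δ α β a b,
      (∀ᶠ y' in 𝓝 ((phaseShift R.M c k ^ j) y), zFull R.M c δ z y' ∈ f.dom ∧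
        y'.2 0 = f.toFun (zFull R.M c δ z y')) ∧
      (∀ i, phaseDeriv R c (fun y => z i (y.1 : JetGroup d k ⧸ H)) ((phaseShift R.M c k ^ j) y) =
        Q.toFun (zLow R.M c δ z ((phaseShift R.M c k ^ j) y),
          win a b ((phaseShift R.M c k ^ j) y).2) i) ∧
      win α β (seqShift j y.2) ∈ E.dom ∧ win a b (seqShift j y.2) ∈ R.domU := by
    refine (Filter.eventually_all_finite hfin).2 fun j hj => ?_
    have hw : ∀ p q : ℤ, Tendsto (fun y : Phase N d k => win p q (seqShift j y.2)) (𝓝 x)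
        (𝓝 (win p q (seqShift j x.2))) := fun p q =>
      (((continuous_win p q).comp (continuous_seqShift j)).comp continuous_snd).tendsto x
    refine ((hsc j).eventually (hfQ j hj).1.eventually_nhds).and
      (((hsc j).eventually (hfQ j hj).2).mono (fun y hy => hy.2) |>.and ?_)
    exact ((hw α β).eventually (E.isOpen_dom.mem_nhds (hx j hj).2.1)).and
      ((hw a b).eventually (R.isOpen_domU.mem_nhds (hx j hj).2.2))
  have hDef : ∀ᶠ y in 𝓝 x, ∀ q : Σ i : Fin N, Fin (δ i + 2),
      ZDefined R.M c D ((q.2 : ℕ) : ℤ) y :=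
    eventually_all.2 fun q => S.eventually_zDefined hxV (zDefined_of_solvableAt hx0.1 q)
  filter_upwards [hev, hY.eventually hgood, hY.eventually hDef] with v h1 h2 h3 i
  refine S.identity_at_point h1.1 (fun l hl hl' => (h2 l (mem_shiftRange_of_top hl hl')).2.2.1)
    (fun l hl hl' => (h2 l (mem_shiftRange_of_top hl hl')).2.2.2) h3 ?_
    (fun j hj => (h2 j hj).1.self_of_nhds.2) (fun j hj => (h2 j hj).2.1) h1.2 i
  have := (h2 0 h0mem).1
  rwa [zpow_zero, Equiv.Perm.one_apply] at this

/-- The range `shiftRange` is chosen so that all functions occurring in the identity are evaluated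
along the orbit at points where the formulas hold. -/
theorem zAll_mem_miuraDom {x : Phase N d k} (hx : RegularOrbit c δ R D z x)
    (hfQ : Compatible c δ R z f Q x) :
    zAll R.M c z x ∈ miuraDom (modifiedEq Q f) E (miuraFun f) := by
  have hfull : ∀ j ∈ shiftRange δ α β a b, fullAt δ j (zAll R.M c z x) ∈ f.dom ∧
      f.toFun (fullAt δ j (zAll R.M c z x)) = x.2 j := by
    intro j hj
    have h1 := (hfQ j hj).1.self_of_nhds
    rw [← fullAt_zAll, phaseShift_zpow_snd, seqShift, zero_add] at h1
    exact ⟨h1.1, h1.2.symm⟩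
  refine ⟨?_, fun l hl => ?_, fun l hl => ?_, ?_⟩
  · rw [mem_miuraFun_dom]
    exact (hfull 0 (mem_shiftRange_of_top le_rfl (by positivity))).1
  · have hl' : l ∈ shiftRange δ α β a b := mem_shiftRange_of_top hl.1 hl.2
    have hj : ∀ j : Set.Icc a b, (j : ℤ) + l ∈ shiftRange δ α β a b := fun j => by
      have h1 := j.2.1
      have h2 := j.2.2
      have h3 := hl.1
      have h4 := hl.2
      exact ⟨by omega, by omega⟩
    rw [mem_modifiedEq_dom]
    refine ⟨fun j => ?_, ?_⟩
    · rw [fullAt_seqShift]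
      exact (hfull _ (hj j)).1
    · have h1 := (hfQ l hl').2.self_of_nhds.1
      rw [← fullLow_zFull, ← fullAt_zAll, phaseShift_zpow_snd] at h1
      convert h1 using 2
      · rw [fullAt_seqShift, zero_add]
      · funext j
        rw [fullAt_seqShift, (hfull _ (hj j)).2]
        rfl
  · rw [mem_miuraFun_dom, fullAt_seqShift, zero_add]
    have h1 := hl.1
    have h2 := hl.2
    exact (hfull l ⟨by omega, by omega⟩).1
  · have hαβ0 : ∀ l : Set.Icc α β, (l : ℤ) ∈ shiftRange δ α β a b := fun l => by
      have h1 := l.2.1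
      have h2 := l.2.2
      exact ⟨by omega, by omega⟩
    have heq : (fun l : Set.Icc α β => (miuraFun f).toFun
        (win 0 (topShift δ) (seqShift l (zAll R.M c z x)))) = win α β x.2 := by
      funext l
      rw [miuraFun_win, fullAt_seqShift, zero_add, (hfull _ (hαβ0 l)).2]
      rfl
    rw [heq]
    have := (hx 0 (mem_shiftRange_of_top le_rfl (by positivity))).2.1
    rwa [seqShift_zero] at this

end InvariantSystem

/-- A lattice point with prescribed variables in a window and those of `v₀` outside of it. -/
noncomputable def extendWin (p q : ℤ) (v₀ : LatticeVar N) (w : Win N p q) : LatticeVar N :=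
  fun l => if h : l ∈ Set.Icc p q then w ⟨l, h⟩ else v₀ l

theorem extendWin_win {p q l : ℤ} (hp : p ≤ l) (hq : l ≤ q) (v₀ v : LatticeVar N) :
    extendWin p q v₀ (win p q v) l = v l := by
  have h : l ∈ Set.Icc p q := ⟨hp, hq⟩
  simp only [win, extendWin, dif_pos h]

theorem analyticAt_extendWin (p q l : ℤ) (v₀ : LatticeVar N) (w : Win N p q) (i : Fin N) :
    AnalyticAt ℂ (fun w => extendWin p q v₀ w l i) w := by
  by_cases h : l ∈ Set.Icc p q
  · simp only [extendWin, dif_pos h]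
    exact ((ContinuousLinearMap.proj (R := ℂ) (φ := fun _ : Fin N => ℂ) i).comp
      (ContinuousLinearMap.proj (R := ℂ) (φ := fun _ : Set.Icc p q => Fin N → ℂ)
        ⟨_, h⟩)).analyticAt w
  · simp only [extendWin, dif_neg h]
    exact analyticAt_const

theorem continuous_extendWin (p q : ℤ) (v₀ : LatticeVar N) : Continuous (extendWin p q v₀) := by
  refine continuous_pi fun l => ?_
  unfold extendWin
  split_ifs <;> fun_prop

theorem extendWin_win_self (p q : ℤ) (v₀ : LatticeVar N) : extendWin p q v₀ (win p q v₀) = v₀ := by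
  funext l
  simp only [extendWin, win]
  split_ifs <;> rfl

/-- The identity theorem for the defining identity of a Miura-type transformation: both sides
depend analytically on finitely many variables. -/
theorem isMiuraOn_connectedComponentIn (E' : LatticeFun N (min 0 a) (max 0 b + topShift δ))
    (E : LatticeFun N α β) {v₀ : LatticeVar N} (hv₀ : v₀ ∈ miuraDom E' E (miuraFun f))
    (hev : ∀ᶠ v in 𝓝 v₀, ∀ i,
      totalDeriv E' (fun v => (miuraFun f).toFun (win 0 (topShift δ) v) i) v =
        E.toFun (fun l : Set.Icc α β =>
          (miuraFun f).toFun (win 0 (topShift δ) (seqShift l v))) i) :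
    IsMiuraOn E' E (miuraFun f) (connectedComponentIn (miuraDom E' E (miuraFun f)) v₀) := by
  set C := connectedComponentIn (miuraDom E' E (miuraFun f)) v₀ with hC
  have hCsub : C ⊆ miuraDom E' E (miuraFun f) := connectedComponentIn_subset _ _
  refine ⟨(isOpen_miuraDom _ _ _).connectedComponentIn, ⟨v₀, mem_connectedComponentIn hv₀⟩,
    hCsub, ?_⟩
  -- the variables `v_l` with `P ≤ l ≤ q` are all that occur in the identity
  obtain ⟨P, hP⟩ : ∃ P : ℤ, P = min 0 (min a α) := ⟨_, rfl⟩
  obtain ⟨q, hq⟩ : ∃ q : ℤ, q = max 0 (max b β) + 2 * topShift δ := ⟨_, rfl⟩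
  let e : Win N P q → LatticeVar N := extendWin P q v₀
  -- the difference of both sides, as a function of finitely many variables
  let T : LatticeVar N → Fin N → ℂ := fun v =>
    fderiv ℂ f.toFun (fullAt δ 0 v)
        (fun l => E'.toFun (win _ _ (seqShift ((l.2 : ℕ) : ℤ) v)) l.1) -
      E.toFun (fun l : Set.Icc α β => f.toFun (fullAt δ l v))
  have hT : ∀ v : LatticeVar N, fullAt δ 0 v ∈ f.dom → ∀ i,
      totalDeriv E' (fun v => (miuraFun f).toFun (win 0 (topShift δ) v) i) v -
        E.toFun (fun l : Set.Icc α β =>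
          (miuraFun f).toFun (win 0 (topShift δ) (seqShift l v))) i = T v i := by
    intro v hv i
    rw [totalDeriv_miuraFun E' hv i]
    simp only [miuraFun_win, fullAt_seqShift, zero_add, T, Pi.sub_apply]
  have hfull : ∀ (l : ℤ) (v : LatticeVar N), P ≤ l → l + topShift δ ≤ q →
      fullAt δ l (e (win P q v)) = fullAt δ l v := by
    intro l v hl hl'
    funext s
    have h1 := (mem_window_f s).2
    simp only [fullAt]
    exact congrFun (extendWin_win (by omega) (by omega) _ _) _
  have hwin : ∀ (l : ℤ) (v : LatticeVar N), 0 ≤ l → l ≤ topShift δ →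
      win (min 0 a) (max 0 b + topShift δ) (seqShift l (e (win P q v))) =
        win (min 0 a) (max 0 b + topShift δ) (seqShift l v) := by
    intro l v hl hl'
    funext s
    have h1 := s.2.1
    have h2 := s.2.2
    simp only [win, seqShift]
    exact extendWin_win (by omega) (by omega) _ _
  have hTe : ∀ v, T (e (win P q v)) = T v := by
    intro v
    have h1 : (fun l : Σ i : Fin N, Fin (δ i + 2) => E'.toFun (win (min 0 a) (max 0 b + topShift δ)
        (seqShift ((l.2 : ℕ) : ℤ) (e (win P q v)))) l.1) =
        fun l => E'.toFun (win _ _ (seqShift ((l.2 : ℕ) : ℤ) v)) l.1 := by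
      funext l
      rw [hwin _ _ (by positivity) (mem_window_f l).2]
    have h2 : (fun l : Set.Icc α β => f.toFun (fullAt δ l (e (win P q v)))) =
        fun l : Set.Icc α β => f.toFun (fullAt δ l v) := by
      funext l
      have h3 := l.2.1
      have h4 := l.2.2
      rw [hfull _ _ (by omega) (by omega)]
    simp only [T, h1, h2, hfull 0 v (by omega) (by omega)]
  have hfa : ∀ (l : ℤ) (w : Win N P q), AnalyticAt ℂ (fun w => fullAt δ l (e w)) w := fun l w =>
    analyticAt_pi_iff.2 fun s => analyticAt_extendWin _ _ _ _ _ _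
  have hTa : AnalyticOnNhd ℂ (fun w => T (e w)) (win P q '' C) := by
    rintro _ ⟨v, hv, rfl⟩
    obtain ⟨hd1, hd2, hd3, hd4⟩ := hCsub hv
    rw [mem_miuraFun_dom] at hd1
    have hderiv : AnalyticAt ℂ (fun w => fderiv ℂ f.toFun (fullAt δ 0 (e w))) (win P q v) :=
      (f.analytic _ hd1).fderiv.comp_of_eq (hfa 0 _) (hfull 0 v (by omega) (by omega))
    have hE' : AnalyticAt ℂ (fun w => fun l : Σ i : Fin N, Fin (δ i + 2) =>
        E'.toFun (win _ _ (seqShift ((l.2 : ℕ) : ℤ) (e w))) l.1) (win P q v) := by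
      refine analyticAt_pi_iff.2 fun l => ?_
      have hl := mem_window_f l
      have h1 : AnalyticAt ℂ (fun w => win (min 0 a) (max 0 b + topShift δ)
          (seqShift ((l.2 : ℕ) : ℤ) (e w))) (win P q v) :=
        analyticAt_pi_iff.2 fun s => analyticAt_pi_iff.2 fun i => analyticAt_extendWin _ _ _ _ _ _
      have h2 := (E'.analytic _ (hd2 _ hl)).comp_of_eq h1 (hwin _ _ hl.1 hl.2)
      exact analyticAt_pi_iff.1 h2 l.1
    have hE : AnalyticAt ℂ (fun w => E.toFun (fun l : Set.Icc α β => f.toFun (fullAt δ l (e w))))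
        (win P q v) := by
      have h5 : ∀ l : Set.Icc α β, fullAt δ l (e (win P q v)) = fullAt δ l v := fun l => by
        have h3 := l.2.1
        have h4 := l.2.2
        exact hfull _ _ (by omega) (by omega)
      have h1 : AnalyticAt ℂ (fun w => fun l : Set.Icc α β => f.toFun (fullAt δ l (e w)))
          (win P q v) := by
        refine analyticAt_pi_iff.2 fun l => ?_
        have h6 := hd3 l l.2
        rw [mem_miuraFun_dom, fullAt_seqShift, zero_add] at h6
        exact (f.analytic _ h6).comp_of_eq (hfa l _) (h5 l)
      refine (E.analytic _ hd4).comp_of_eq h1 ?_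
      funext l
      rw [h5, miuraFun_win, fullAt_seqShift, zero_add]
    refine AnalyticAt.sub ?_ hE
    exact ((ContinuousLinearMap.id ℂ
      (((Σ i : Fin N, Fin (δ i + 2)) → ℂ) →L[ℂ] (Fin N → ℂ))).analyticAt_bilinear _).comp_of_eq
      (hderiv.prod hE') rfl
  have hpre : IsPreconnected (win P q '' C) :=
    isPreconnected_connectedComponentIn.image _ (continuous_win P q).continuousOn
  have hnear : (fun w => T (e w)) =ᶠ[𝓝 (win P q v₀)] 0 := by
    have h1 : Tendsto e (𝓝 (win P q v₀)) (𝓝 v₀) := by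
      have := (continuous_extendWin P q v₀).tendsto (win P q v₀)
      rwa [extendWin_win_self] at this
    have h2 := (isOpen_miuraDom E' E (miuraFun f)).mem_nhds hv₀
    filter_upwards [h1.eventually hev, h1.eventually h2] with w hw hw'
    funext i
    rw [← hT _ ((mem_miuraFun_dom _).1 hw'.1), hw i, sub_self]
    rfl
  have hzero := hTa.eqOn_zero_of_preconnected_of_eventuallyEq_zero hpre
    ⟨v₀, mem_connectedComponentIn hv₀, rfl⟩ hnear
  intro v hv i
  have h1 := hzero ⟨v, hv, rfl⟩
  simp only [hTe] at h1
  have h2 := hT v ((mem_miuraFun_dom _).1 (hCsub hv).1) i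
  rw [h1] at h2
  exact sub_eq_zero.1 h2

end Identity

/-! ### The rank of the action of `M(u, lam)` on `G/H` -/

section Rank

variable {m N d : ℕ} {c : Fin m → ℂ} {k : Fin m → ℕ} {H : Subgroup (JetGroup d k)}
  {V : Set (Fin N → ℂ)} {Λ : Set ℂ} {α β a b : ℤ} {E : LatticeFun N α β}
  {R : DarbouxLax d V Λ E a b} {δ : Fin N → ℕ} {D : Set (JetGroup d k ⧸ H)}
  {z : Fin N → JetGroup d k ⧸ H → ℂ} {r : ℕ} {L : JetAlg d k →L[ℂ] (Fin r → ℂ)}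

/-- The derivative in the direction `e` of the map `u ↦ M(u, lam) A` into `G`, translated to the
tangent space at `1`. -/
noncomputable def velocity (M : (Fin N → ℂ) → ℂ → GL (Fin d) ℂ) (c : Fin m → ℂ) (A : JetAlg d k)
    (u : Fin N → ℂ) (e : Fin N → ℂ) : JetAlg d k :=
  jetInv ((rho c k (M u) : JetAlg d k) * A) *
    (fderiv ℂ (fun w => (rho c k (M w) : JetAlg d k)) u e * A)

theorem velocity_coe (M : (Fin N → ℂ) → ℂ → GL (Fin d) ℂ) (g : JetGroup d k) (u e : Fin N → ℂ) :
    velocity M c (g : JetAlg d k) u e = (↑(rho c k (M u) * g)⁻¹ : JetAlg d k) *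
      (fderiv ℂ (fun w => (rho c k (M w) : JetAlg d k)) u e * (g : JetAlg d k)) := by
  rw [velocity, ← Units.val_mul, jetInv_coe]

theorem velocity_sum (M : (Fin N → ℂ) → ℂ → GL (Fin d) ℂ) (A : JetAlg d k) (u e : Fin N → ℂ) :
    velocity M c A u e = ∑ j, e j • velocity M c A u (Pi.single j 1) := by
  have h : velocity M c A u = ((jetMul (jetInv ((rho c k (M u) : JetAlg d k) * A))).comp
      (((jetMul (d := d) (k := k)).flip A).comp
        (fderiv ℂ (fun w => (rho c k (M w) : JetAlg d k)) u)) : (Fin N → ℂ) →L[ℂ] JetAlg d k) := rfl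
  have he : e = ∑ j, e j • (Pi.single j 1 : Fin N → ℂ) := by
    rw [← Finset.univ_sum_single e]
    refine Finset.sum_congr rfl fun j _ => ?_
    rw [← Pi.single_smul, smul_eq_mul, mul_one, Finset.univ_sum_single]
  rw [h]
  conv_lhs => rw [he]
  rw [map_sum]
  simp only [map_smul]

theorem exists_linearMap_velocity (M : (Fin N → ℂ) → ℂ → GL (Fin d) ℂ) (c : Fin m → ℂ)
    (L : JetAlg d k →L[ℂ] (Fin r → ℂ)) (A : JetAlg d k) (u : Fin N → ℂ) :
    ∃ B : (Fin N → ℂ) →ₗ[ℂ] (Fin r → ℂ), ∀ e, B e = L (velocity M c A u e) :=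
  ⟨((L.comp ((jetMul (jetInv ((rho c k (M u) : JetAlg d k) * A))).comp
      (((jetMul (d := d) (k := k)).flip A).comp
        (fderiv ℂ (fun w => (rho c k (M w) : JetAlg d k)) u))) :
          (Fin N → ℂ) →L[ℂ] (Fin r → ℂ)) : (Fin N → ℂ) →ₗ[ℂ] (Fin r → ℂ)), fun _ => rfl⟩

theorem topCoord_update (M : (Fin N → ℂ) → ℂ → GL (Fin d) ℂ) (c : Fin m → ℂ)
    (z : Fin N → JetGroup d k ⧸ H → ℂ) (u : LatticeVar N) (w : Fin N → ℂ) (A : JetAlg d k)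
    (i : Fin N) : topCoord M c δ z (Function.update u 0 w) A i =
      lowCoord M c δ z (seqShift 1 u) ((rho c k (M w) : JetAlg d k) * A) ⟨i, Fin.last _⟩ := by
  have h : transfer M c k (δ i) (seqShift 1 (Function.update u 0 w)) =
      transfer M c k (δ i) (seqShift 1 u) := by
    refine transfer_congr fun l h0 _ => ?_
    rw [seqShift, seqShift, Function.update_of_ne (by omega)]
  simp only [topCoord, lowCoord, transfer_succ', h, Function.update_self, Units.val_mul,
    Fin.val_last, mul_assoc]

namespace InvariantSystem

theorem hasFDerivAt_rho_mul (S : InvariantSystem R c δ D z) (A : JetAlg d k) {u : Fin N → ℂ}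
    (hu : u ∈ V) : HasFDerivAt (fun w => (rho c k (R.M w) : JetAlg d k) * A)
      (((jetMul (d := d) (k := k)).flip A).comp
        (fderiv ℂ (fun w => (rho c k (R.M w) : JetAlg d k)) u)) u :=
  ((jetMul (d := d) (k := k)).flip A).hasFDerivAt.comp u
    (analyticOnNhd_rho S.isOpen_V S.isOpen_Λ S.mem_Λ R.analytic_M u hu).differentiableAt.hasFDerivAt

theorem mk_phaseShift (x : Phase N d k) :
    phaseShift R.M c k x = (rho c k (R.M (x.2 0)) * x.1, seqShift 1 x.2) := rfl

/-- The Jacobian determinant is non-zero only if the map `u ↦ M(u, lam) g H` is an immersion. -/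
theorem velocity_injective_of_det (S : InvariantSystem R c δ D z) (hL : IsTangentMap H L)
    {x : Phase N d k} (hx : ∀ l, x.2 l ∈ V) (hD : ∀ i : Fin N, ZDefined R.M c D ((δ i : ℤ) + 1) x)
    (hdet : (jacobian R.M c δ z x).det ≠ 0) {e : Fin N → ℂ}
    (he : L (velocity R.M c (x.1 : JetAlg d k) (x.2 0) e) = 0) : e = 0 := by
  refine Matrix.eq_zero_of_mulVec_eq_zero hdet ?_
  rw [S.jacobian_mulVec hx hD]
  set g : JetGroup d k := rho c k (R.M (x.2 0)) * x.1 with hg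
  let κ : JetAlg d k → Fin N → ℂ := fun B i =>
    lowCoord R.M c δ z (seqShift 1 x.2) B ⟨i, Fin.last _⟩
  have hκ : AnalyticAt ℂ κ (g : JetAlg d k) := by
    refine analyticAt_pi_iff.2 fun i => ?_
    refine S.analyticAt_comp i (u := fun _ => seqShift 1 x.2) rfl analyticAt_id
      (fun l _ _ => hx _) (fun _ _ _ => analyticAt_const) ?_
    have := hD i
    rw [zDefined_add, zpow_one, mk_phaseShift] at this
    simpa using this
  have hfun : (fun w => topCoord R.M c δ z (Function.update x.2 0 w) (x.1 : JetAlg d k)) =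
      fun w => κ ((rho c k (R.M w) : JetAlg d k) * x.1) :=
    funext fun w => funext fun i => topCoord_update _ _ _ _ _ _ _
  have hd := HasFDerivAt.comp (g := κ) (x.2 0) (f := fun w => (rho c k (R.M w) : JetAlg d k) * x.1)
    (by rw [← Units.val_mul]; exact hκ.differentiableAt.hasFDerivAt)
    (S.hasFDerivAt_rho_mul (x.1 : JetAlg d k) (hx 0))
  rw [hfun]
  refine (congrArg (fun T : (Fin N → ℂ) →L[ℂ] (Fin N → ℂ) => T e) hd.fderiv).trans ?_
  have h1 := hL.2 _ κ g hκ.differentiableAt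
    (fun h hh => funext fun i => congrFun (lowCoord_mul_right R.M c z _ _ hh) _) _ he
  rw [velocity_coe, ← mul_assoc, ← hg, Units.mul_inv, one_mul] at h1
  exact h1

/-- Conversely, if `u ↦ M(u, lam) g H` is an immersion and the `z^i_k` are local coordinates at
`𝒮(x)`, the Jacobian determinant is non-zero: of these coordinates, only the `z^i_{d_i}` vary with
`u` along the map. -/
theorem det_ne_zero_of_velocity (S : InvariantSystem R c δ D z) (hL : IsTangentMap H L)
    (hδ : ∑ i, δ i + N = r) {x : Phase N d k} (hx : ∀ l, x.2 l ∈ V)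
    (hD : ∀ i : Fin N, ZDefined R.M c D ((δ i : ℤ) + 1) x)
    (hC : CoordAt R.M c δ D z (phaseShift R.M c k x))
    (hinj : ∀ e, L (velocity R.M c (x.1 : JetAlg d k) (x.2 0) e) = 0 → e = 0) :
    (jacobian R.M c δ z x).det ≠ 0 := by
  intro h0
  obtain ⟨e, he0, he⟩ := Matrix.exists_mulVec_eq_zero_iff.2 h0
  refine he0 (hinj e ?_)
  rw [S.jacobian_mulVec hx hD] at he
  set g : JetGroup d k := rho c k (R.M (x.2 0)) * x.1 with hg
  have hC' := hC
  rw [mk_phaseShift, ← hg] at hC'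
  have hSx : ∀ l, ((g, seqShift 1 x.2) : Phase N d k).2 l ∈ V := fun l => hx _
  have hζa := S.analyticAt_lowCoord hSx hC'.1
  have hζs := S.surjective_fderiv_lowCoord hSx hC'
  dsimp only at hζa hζs
  set ζ := lowCoord R.M c δ z (seqShift 1 x.2) with hζ
  set ρ' := fderiv ℂ (fun w => (rho c k (R.M w) : JetAlg d k)) (x.2 0) e with hρ'
  have hcomp : ∀ q, fderiv ℂ (fun w => ζ ((rho c k (R.M w) : JetAlg d k) * x.1) q) (x.2 0) e =
      fderiv ℂ ζ (g : JetAlg d k) (ρ' * x.1) q := fun q => by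
    have h2 := HasFDerivAt.comp (g := ζ) (x.2 0)
      (f := fun w => (rho c k (R.M w) : JetAlg d k) * x.1)
      (by rw [← Units.val_mul]; exact hζa.differentiableAt.hasFDerivAt)
      (S.hasFDerivAt_rho_mul (x.1 : JetAlg d k) (hx 0))
    have h3 := (hasFDerivAt_pi'.1 h2 q).fderiv
    exact congrArg (fun T : (Fin N → ℂ) →L[ℂ] ℂ => T e) h3
  rw [velocity_coe, ← hg, ← hρ']
  have hζi : ∀ h ∈ H, ζ ((g : JetAlg d k) * (h : JetAlg d k)) = ζ g :=
    fun h hh => lowCoord_mul_right _ _ _ _ _ hh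
  clear_value ρ'
  suffices h0 : fderiv ℂ ζ (g : JetAlg d k) (ρ' * (x.1 : JetAlg d k)) = 0 from
    hL.apply_eq_zero (card_lowIndex δ hδ) hζa.differentiableAt hζi hζs h0
  funext q
  obtain ⟨i, j⟩ := q
  suffices h : fderiv ℂ (fun w => ζ ((rho c k (R.M w) : JetAlg d k) * x.1) ⟨i, j⟩) (x.2 0) e = 0 from
    (hcomp ⟨i, j⟩).symm.trans h
  -- the derivatives of the `z^i_{d_i}` vanish by the choice of `e`, the other `z^i_j` are constant
  -- along the map because `z^i_{j+1}`, `j + 1 ≤ d_i`, does not depend on the `u_l`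
  induction j using Fin.lastCases with
  | last =>
    have ha : DifferentiableAt ℂ
        (fun w => topCoord R.M c δ z (Function.update x.2 0 w) (x.1 : JetAlg d k)) (x.2 0) :=
      ((S.analyticAt_topCoord hx hD).comp_of_eq (f := fun w => ((x.1 : JetAlg d k), w))
        (analyticAt_const.prod analyticAt_id) rfl).differentiableAt
    have h1 := (hasFDerivAt_pi'.1 ha.hasFDerivAt i).fderiv
    simp only [topCoord_update] at h1 he
    rw [h1]
    exact congrFun he i
  | cast j =>
    have hj := j.2
    have hDj : ZDefined R.M c D ((j + 1 : ℕ) : ℤ) x := by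
      have := hC.1 i j (by omega)
      rw [← zpow_one (phaseShift R.M c k), ← zDefined_add] at this
      exact_mod_cast this
    have hT : Tendsto (fun w => ((x.1, Function.update x.2 0 w) : Phase N d k)) (𝓝 (x.2 0))
        (𝓝 x) := by
      have : ContinuousAt (fun w => ((x.1, Function.update x.2 0 w) : Phase N d k)) (x.2 0) :=
        continuousAt_const.prodMk (continuousAt_const.update 0 continuousAt_id)
      simpa [ContinuousAt] using this
    have hev := hT.eventually (S.eventually_zs_eq (i := i) (j := j + 1) (by omega) hx hDj)
    have hconst : (fun w => ζ ((rho c k (R.M w) : JetAlg d k) * x.1) ⟨i, j.castSucc⟩) =ᶠ[𝓝 (x.2 0)]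
        fun _ => pullback (z i) ((transfer R.M c k (j + 1) x.2 : JetAlg d k) * (x.1 : JetAlg d k)) := by
      filter_upwards [hev] with w hw
      rw [← hw, zs_eq_pullback, transfer_succ']
      have h2 : transfer R.M c k j (seqShift 1 (Function.update x.2 0 w)) =
          transfer R.M c k j (seqShift 1 x.2) := by
        refine transfer_congr fun l h0 _ => ?_
        rw [seqShift, seqShift, Function.update_of_ne (by omega)]
      simp only [hζ, lowCoord, h2, Function.update_self, Units.val_mul, Fin.val_castSucc, mul_assoc]
    rw [hconst.fderiv_eq]
    simp

/-- The map `u ↦ M(u, lam) g H` is an immersion if a certain analytic function on the connected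
manifold `G × V` does not vanish, and this function is not identically zero. -/
theorem exists_rank_function (S : InvariantSystem R c δ D z) (hVc : IsPreconnected V)
    (hL : IsTangentMap H L) {x : Phase N d k} (hx : ∀ l, x.2 l ∈ V)
    (hD : ∀ i : Fin N, ZDefined R.M c D ((δ i : ℤ) + 1) x)
    (hdet : (jacobian R.M c δ z x).det ≠ 0) :
    ∃ φ : JetAlg d k × (Fin N → ℂ) → ℂ,
      (∀ g : JetGroup d k, ∀ u ∈ V, AnalyticAt ℂ φ ((g : JetAlg d k), u)) ∧
      (∀ g : JetGroup d k, ∀ u ∈ V, ∃ᶠ y in 𝓝 ((g : JetAlg d k), u), φ y ≠ 0) ∧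
      ∀ y, φ y ≠ 0 → ∀ e, L (velocity R.M c y.1 y.2 e) = 0 → e = 0 := by
  obtain ⟨B, hB⟩ := exists_linearMap_velocity R.M c L (x.1 : JetAlg d k) (x.2 0)
  have hBker : LinearMap.ker B = ⊥ := LinearMap.ker_eq_bot'.2 fun e he =>
    S.velocity_injective_of_det hL hx hD hdet ((hB e).symm.trans he)
  -- a left inverse of the velocity map at the given point turns it into a square matrix elsewhere
  obtain ⟨P, hP⟩ := B.exists_leftInverse_of_injective hBker
  let P' : (Fin r → ℂ) →L[ℂ] (Fin N → ℂ) := LinearMap.toContinuousLinearMap P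
  let Mat : JetAlg d k × (Fin N → ℂ) → Matrix (Fin N) (Fin N) ℂ := fun y =>
    Matrix.of fun i j => P' (L (velocity R.M c y.1 y.2 (Pi.single j 1))) i
  have hMat : ∀ y e, (Mat y).mulVec e = P' (L (velocity R.M c y.1 y.2 e)) := by
    intro y e
    rw [velocity_sum]
    simp only [map_sum, map_smul]
    funext i
    simp only [Matrix.mulVec, dotProduct, Mat, Matrix.of_apply, Finset.sum_apply, Pi.smul_apply,
      smul_eq_mul, mul_comm]
  have hana : ∀ g : JetGroup d k, ∀ u ∈ V,
      AnalyticAt ℂ (fun y => (Mat y).det) ((g : JetAlg d k), u) := by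
    intro g u hu
    refine AnalyticAt.matrix_det fun i j => ?_
    have hrho := analyticOnNhd_rho (k := k) S.isOpen_V S.isOpen_Λ S.mem_Λ R.analytic_M u hu
    have h1 : AnalyticAt ℂ (fun y : JetAlg d k × (Fin N → ℂ) => (rho c k (R.M y.2) : JetAlg d k))
        ((g : JetAlg d k), u) := hrho.comp_of_eq analyticAt_snd rfl
    have h2 : AnalyticAt ℂ (fun y : JetAlg d k × (Fin N → ℂ) =>
        fderiv ℂ (fun w => (rho c k (R.M w) : JetAlg d k)) y.2 (Pi.single j 1))
        ((g : JetAlg d k), u) :=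
      ((ContinuousLinearMap.apply ℂ (JetAlg d k) (Pi.single j (1 : ℂ) : Fin N → ℂ)).analyticAt
        _).comp (hrho.fderiv.comp_of_eq analyticAt_snd rfl)
    have h3 : AnalyticAt ℂ (fun y : JetAlg d k × (Fin N → ℂ) =>
        jetInv ((rho c k (R.M y.2) : JetAlg d k) * y.1)) ((g : JetAlg d k), u) :=
      (analyticAt_jetInv (rho c k (R.M u) * g)).comp_of_eq (h1.jetMul analyticAt_fst)
        (Units.val_mul _ _).symm
    exact (((ContinuousLinearMap.proj (R := ℂ) (φ := fun _ : Fin N => ℂ) i).comp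
      (P'.comp L)).analyticAt _).comp (h3.jetMul (h2.jetMul analyticAt_fst))
  refine ⟨fun y => (Mat y).det, hana, ?_, ?_⟩
  · intro g u hu hzero
    have hpre : IsPreconnected ({A : JetAlg d k | IsUnit A} ×ˢ V) :=
      isPreconnected_isUnit_jetAlg.prod hVc
    have han : AnalyticOnNhd ℂ (fun y => (Mat y).det) ({A : JetAlg d k | IsUnit A} ×ˢ V) := by
      rintro ⟨A, w⟩ ⟨⟨g', rfl⟩, hw⟩
      exact hana g' w hw
    have h1 := han.eqOn_zero_of_preconnected_of_eventuallyEq_zero hpre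
      (z₀ := ((g : JetAlg d k), u)) ⟨g.isUnit, hu⟩ (by
        filter_upwards [hzero] with y hy using not_not.1 hy)
    have h2 : (Mat ((x.1 : JetAlg d k), x.2 0)).det = 0 := h1 ⟨x.1.isUnit, hx 0⟩
    have h3 : Mat ((x.1 : JetAlg d k), x.2 0) = 1 := by
      refine Matrix.ext_of_mulVec_single fun j => ?_
      rw [hMat, ← hB, Matrix.one_mulVec]
      exact LinearMap.congr_fun hP _
    rw [h3, Matrix.det_one] at h2
    exact one_ne_zero h2
  · intro y hy e he
    refine Matrix.eq_zero_of_mulVec_eq_zero hy ?_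
    rw [hMat, he, map_zero]

end InvariantSystem

end Rank

/-! ### Generic points -/

section Generic

variable {m N d : ℕ} {c : Fin m → ℂ} {k : Fin m → ℕ} {H : Subgroup (JetGroup d k)}
  {V : Set (Fin N → ℂ)} {Λ : Set ℂ} {α β a b : ℤ} {E : LatticeFun N α β}
  {R : DarbouxLax d V Λ E a b} {δ : Fin N → ℕ} {D : Set (JetGroup d k ⧸ H)}
  {z : Fin N → JetGroup d k ⧸ H → ℂ} {r : ℕ}

/-- The points with all `u_l` in `V`. -/
def pointsOver (d : ℕ) (k : Fin m → ℕ) (V : Set (Fin N → ℂ)) : Set (Phase N d k) :=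
  {x | ∀ l, x.2 l ∈ V}

/-- The property `P` holds on a set that is open and dense in `pointsOver d k V`. -/
def IsGeneric (V : Set (Fin N → ℂ)) (P : Phase N d k → Prop) : Prop :=
  ∀ x ∈ pointsOver d k V, ∃ᶠ y in 𝓝[pointsOver d k V] x, ∀ᶠ y' in 𝓝[pointsOver d k V] y, P y'

theorem frequently_of_frequently_frequently {X : Type*} [TopologicalSpace X] {s : Set X} {x : X}
    {P : X → Prop} (h : ∃ᶠ y in 𝓝[s] x, ∃ᶠ y' in 𝓝[s] y, P y') : ∃ᶠ y in 𝓝[s] x, P y := by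
  intro h'
  refine h ?_
  filter_upwards [eventually_eventually_nhdsWithin.2 h'] with y hy using not_not.2 hy

namespace IsGeneric

theorem mono {P Q : Phase N d k → Prop} (hP : IsGeneric V P)
    (h : ∀ x ∈ pointsOver d k V, P x → Q x) : IsGeneric V Q := fun x hx =>
  (hP x hx).mono fun y hy => by
    filter_upwards [hy, self_mem_nhdsWithin] with y' h1 h2 using h y' h2 h1

/-- To refine a generic property, it is enough to work near the points around which it holds. -/
theorem refine_near {P Q : Phase N d k → Prop} (hP : IsGeneric V P)
    (h : ∀ x ∈ pointsOver d k V, (∀ᶠ y in 𝓝[pointsOver d k V] x, P y) →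
      ∃ᶠ y in 𝓝[pointsOver d k V] x, ∀ᶠ y' in 𝓝[pointsOver d k V] y, Q y') :
    IsGeneric V Q := fun x hx => by
  refine frequently_of_frequently_frequently ?_
  refine ((hP x hx).and_eventually self_mem_nhdsWithin).mono fun y hy => h y hy.2 hy.1

theorem and {P Q : Phase N d k → Prop} (hP : IsGeneric V P) (hQ : IsGeneric V Q) :
    IsGeneric V fun x => P x ∧ Q x :=
  hP.refine_near fun x hx hPx => by
    refine ((hQ x hx).and_eventually (eventually_eventually_nhdsWithin.2 hPx)).mono fun y hy => ?_
    exact hy.2.and hy.1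

theorem true : IsGeneric (k := k) (d := d) V fun _ => True := fun x hx => by
  have := mem_closure_iff_nhdsWithin_neBot.1 (subset_closure hx)
  exact Eventually.frequently (Eventually.of_forall fun _ => Eventually.of_forall fun _ => trivial)

theorem forall_finite {ι : Type*} [Finite ι] {P : ι → Phase N d k → Prop}
    (h : ∀ i, IsGeneric V (P i)) : IsGeneric V fun x => ∀ i, P i x := by
  classical
  have := Fintype.ofFinite ι
  suffices hs : ∀ s : Finset ι, IsGeneric V fun x => ∀ i ∈ s, P i x from
    (hs Finset.univ).mono fun x _ hx i => hx i (Finset.mem_univ i)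
  intro s
  induction s using Finset.induction_on with
  | empty => exact IsGeneric.true.mono fun _ _ _ i hi => absurd hi (Finset.notMem_empty i)
  | insert i s _ ih =>
    refine ((h i).and ih).mono fun x _ hx j hj => ?_
    rcases Finset.mem_insert.1 hj with rfl | hj
    · exact hx.1
    · exact hx.2 j hj

/-- An open condition is generic if it can be met by moving points along suitable maps. -/
theorem of_curve {P : Phase N d k → Prop}
    (hopen : ∀ x ∈ pointsOver d k V, P x → ∀ᶠ y in 𝓝[pointsOver d k V] x, P y)
    (h : ∀ x ∈ pointsOver d k V, ∃ (X : Type) (l : Filter X) (γ : X → Phase N d k),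
      Tendsto γ l (𝓝 x) ∧ ∃ᶠ t in l, γ t ∈ pointsOver d k V ∧ P (γ t)) : IsGeneric V P := by
  intro x hx
  obtain ⟨X, l, γ, hγ, hl⟩ := h x hx
  rw [frequently_nhdsWithin_iff]
  exact hγ.frequently (hl.mono fun t ht => ⟨hopen _ ht.1 ht.2, ht.1⟩)

end IsGeneric

theorem phaseShift_mem_pointsOver (M : (Fin N → ℂ) → ℂ → GL (Fin d) ℂ) (c : Fin m → ℂ) (j : ℤ)
    {x : Phase N d k} (hx : x ∈ pointsOver d k V) :
    (phaseShift M c k ^ j) x ∈ pointsOver d k V := fun l => by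
  rw [phaseShift_zpow_snd]
  exact hx _

theorem isGeneric_coset (hDd : Dense D) (hDo : IsOpen D) :
    IsGeneric V fun x : Phase N d k => (x.1 : JetGroup d k ⧸ H) ∈ D := by
  have hc : Continuous fun x : Phase N d k => (x.1 : JetGroup d k ⧸ H) :=
    continuous_quot_mk.comp continuous_fst
  refine IsGeneric.of_curve (fun x _ hx => ?_) fun x hx => ?_
  · exact nhdsWithin_le_nhds (hc.continuousAt.eventually (hDo.mem_nhds hx))
  · refine ⟨JetGroup d k, 𝓝 x.1, fun g => (g, x.2), ?_, ?_⟩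
    · exact (continuous_id.prodMk continuous_const).tendsto' _ _ rfl
    · have h1 : Dense ((fun g : JetGroup d k => (g : JetGroup d k ⧸ H)) ⁻¹' D) :=
        hDd.preimage QuotientGroup.isOpenMap_coe
      exact (mem_closure_iff_frequently.1 (h1 x.1)).mono fun g hg => ⟨hx, hg⟩

theorem isGeneric_win {p q : ℤ} {dom : Set (Win N p q)} (hd : IsDenseIn V dom)
    (ho : IsOpen dom) : IsGeneric V fun x : Phase N d k => win p q x.2 ∈ dom := by
  have hc : Continuous fun x : Phase N d k => win p q x.2 :=
    (continuous_win p q).comp continuous_snd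
  refine IsGeneric.of_curve (fun x _ hx => ?_) fun x hx => ?_
  · exact nhdsWithin_le_nhds (hc.continuousAt.eventually (ho.mem_nhds hx))
  · refine ⟨Win N p q, 𝓝 (win p q x.2), fun w => (x.1, extendWin p q x.2 w), ?_, ?_⟩
    · refine Continuous.tendsto' (continuous_const.prodMk (continuous_extendWin _ _ _)) _ _ ?_
      rw [extendWin_win_self]
    · refine (mem_closure_iff_frequently.1 (hd.2 fun l => hx l)).mono fun w hw => ⟨fun l => ?_, ?_⟩
      · by_cases h : l ∈ Set.Icc p q
        · simp only [extendWin, dif_pos h]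
          exact hd.1 hw _
        · simp only [extendWin, dif_neg h]
          exact hx l
      · convert hw using 1
        funext l
        simp only [win, extendWin, dif_pos l.2]

theorem tendsto_update_phase (x : Phase N d k) (l : ℤ) :
    Tendsto (fun w => ((x.1, Function.update x.2 l w) : Phase N d k)) (𝓝 (x.2 l)) (𝓝 x) := by
  refine Continuous.tendsto' ?_ _ _ ?_
  · exact continuous_const.prodMk (continuous_const.update l continuous_id)
  · simp

theorem update_mem_pointsOver {x : Phase N d k} (hx : x ∈ pointsOver d k V) (g : JetGroup d k)
    (l : ℤ) {w : Fin N → ℂ} (hw : w ∈ V) :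
    ((g, Function.update x.2 l w) : Phase N d k) ∈ pointsOver d k V := fun l' => by
  by_cases h : l' = l
  · subst h
    simpa using hw
  · simpa [Function.update_of_ne h] using hx l'

theorem isGeneric_ne (hN : 0 < N) (hVo : IsOpen V) {l l' : ℤ} (hl : l ≠ l') :
    IsGeneric V fun x : Phase N d k => x.2 l ≠ x.2 l' := by
  have : Nonempty (Fin N) := ⟨⟨0, hN⟩⟩
  refine IsGeneric.of_curve (fun x _ hx => ?_) fun x hx => ?_
  · have h1 : Continuous fun x : Phase N d k => (x.2 l, x.2 l') := by fun_prop
    exact nhdsWithin_le_nhds (h1.continuousAt.eventually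
      ((isClosed_diagonal.isOpen_compl).mem_nhds hx))
  · refine ⟨_, _, _, tendsto_update_phase x l, ?_⟩
    have h1 : ∃ᶠ w in 𝓝 (x.2 l), w ∈ ({x.2 l'}ᶜ : Set (Fin N → ℂ)) :=
      mem_closure_iff_frequently.1 (dense_compl_singleton _ _)
    refine (h1.and_eventually (hVo.mem_nhds (hx l))).mono fun w hw => ⟨?_, ?_⟩
    · exact update_mem_pointsOver hx _ _ hw.2
    · simpa [Function.update_of_ne hl.symm] using hw.1

/-- A function of the coordinates of `G` and `u` that is analytic and not identically zero near
each point is non-zero at generic points. -/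
theorem isGeneric_ne_zero (hVo : IsOpen V) {φ : JetAlg d k × (Fin N → ℂ) → ℂ}
    (hφ : ∀ g : JetGroup d k, ∀ u ∈ V, AnalyticAt ℂ φ ((g : JetAlg d k), u))
    (hf : ∀ g : JetGroup d k, ∀ u ∈ V, ∃ᶠ y in 𝓝 ((g : JetAlg d k), u), φ y ≠ 0) :
    IsGeneric V fun x : Phase N d k => φ ((x.1 : JetAlg d k), x.2 0) ≠ 0 := by
  refine IsGeneric.of_curve (fun x hx h0 => ?_) fun x hx => ?_
  · exact nhdsWithin_le_nhds ((InvariantSystem.tendsto_coords x).eventually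
      ((hφ x.1 _ (hx 0)).continuousAt.eventually_ne h0))
  · refine ⟨JetAlg d k × (Fin N → ℂ), 𝓝 ((x.1 : JetAlg d k), x.2 0),
      fun y => (toJetGroup y.1, Function.update x.2 0 y.2), ?_, ?_⟩
    · have h1 : Tendsto (fun y : JetAlg d k × (Fin N → ℂ) => toJetGroup y.1)
          (𝓝 ((x.1 : JetAlg d k), x.2 0)) (𝓝 x.1) := by
        have := (continuousAt_toJetGroup x.1).tendsto
        rw [toJetGroup_coe] at this
        exact this.comp continuousAt_fst
      have h2 : Tendsto (fun y : JetAlg d k × (Fin N → ℂ) => Function.update x.2 0 y.2)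
          (𝓝 ((x.1 : JetAlg d k), x.2 0)) (𝓝 x.2) :=
        Continuous.tendsto' (continuous_const.update 0 continuous_snd) _ _ (by simp)
      exact h1.prodMk_nhds h2
    · have h1 : ∀ᶠ y in 𝓝 ((x.1 : JetAlg d k), x.2 0), (toJetGroup y.1 : JetAlg d k) = y.1 :=
        (continuousAt_fst (p := ((x.1 : JetAlg d k), x.2 0))).tendsto.eventually
          (eventually_toJetGroup x.1)
      have h2 : ∀ᶠ y in 𝓝 ((x.1 : JetAlg d k), x.2 0), y.2 ∈ V :=
        continuousAt_snd.eventually (hVo.mem_nhds (hx 0))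
      refine ((hf x.1 _ (hx 0)).and_eventually (h1.and h2)).mono fun y hy => ⟨?_, ?_⟩
      · exact update_mem_pointsOver hx _ _ hy.2.2
      · simpa [hy.2.1] using hy.1

namespace InvariantSystem

theorem tendsto_phaseShift (S : InvariantSystem R c δ D z) (j : ℤ) {x : Phase N d k}
    (hx : x ∈ pointsOver d k V) :
    Tendsto (phaseShift R.M c k ^ j : Equiv.Perm (Phase N d k)) (𝓝[pointsOver d k V] x)
      (𝓝[pointsOver d k V] ((phaseShift R.M c k ^ j) x)) :=
  tendsto_nhdsWithin_of_tendsto_nhds_of_eventually_within _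
    ((continuousAt_phaseShift_zpow S.isOpen_V S.isOpen_Λ S.mem_Λ R.analytic_M j hx).tendsto.mono_left
      nhdsWithin_le_nhds)
    (by filter_upwards [self_mem_nhdsWithin] with y hy using phaseShift_mem_pointsOver _ _ _ hy)

theorem isGeneric_phaseShift (S : InvariantSystem R c δ D z) (j : ℤ) {P : Phase N d k → Prop}
    (hP : IsGeneric V P) : IsGeneric V fun x => P ((phaseShift R.M c k ^ j) x) := by
  intro x hx
  have h1 := S.tendsto_phaseShift (-j) (phaseShift_mem_pointsOver R.M c j hx)
  rw [← phaseShift_zpow_add, neg_add_cancel, zpow_zero, Equiv.Perm.one_apply] at h1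
  refine h1.frequently ?_
  refine ((hP _ (phaseShift_mem_pointsOver R.M c j hx)).and_eventually
    self_mem_nhdsWithin).mono fun y hy => ?_
  have h2 := S.tendsto_phaseShift j (phaseShift_mem_pointsOver R.M c (-j) hy.2)
  rw [← phaseShift_zpow_add, add_neg_cancel, zpow_zero, Equiv.Perm.one_apply] at h2
  exact h2.eventually hy.1

theorem isGeneric_zDefined (S : InvariantSystem R c δ D z) (hDd : Dense D) (j : ℤ) :
    IsGeneric V fun x : Phase N d k => ZDefined R.M c D j x :=
  S.isGeneric_phaseShift j (isGeneric_coset hDd S.isOpen_D)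

/-- Since the `z^i_j`, `0 ≤ j ≤ d_i`, do not depend on the `u_l`, being local coordinates is a
condition on the component in `G` only. -/
theorem coordAt_of_coordAt (S : InvariantSystem R c δ D z) {g : JetGroup d k} {u u' : LatticeVar N}
    (hu : ∀ l, u l ∈ V) (hu' : ∀ l, u' l ∈ V) (hC : CoordAt R.M c δ D z (g, u))
    (hD : ∀ i : Fin N, ∀ j : ℕ, j ≤ δ i → ZDefined R.M c D j (g, u')) :
    CoordAt R.M c δ D z (g, u') := by
  refine ⟨hD, ?_⟩
  convert hC.2 using 1
  funext q
  refine Filter.EventuallyEq.fderiv_eq ?_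
  have hq : (q.2 : ℕ) ≤ δ q.1 := Nat.lt_succ_iff.1 q.2.2
  have hT : ∀ v : LatticeVar N, Tendsto (fun g' : JetGroup d k => ((g', v) : Phase N d k)) (𝓝 g)
      (𝓝 (g, v)) := fun v => (continuous_id.prodMk continuous_const).tendsto' _ _ rfl
  change ∀ᶠ A in 𝓝 (g : JetAlg d k), _
  rw [← isOpenEmbedding_jetVal.map_nhds_eq, eventually_map]
  filter_upwards [(hT u).eventually (S.eventually_zDefined (x := (g, u)) hu (hC.1 q.1 q.2 hq)),
    (hT u').eventually (S.eventually_zDefined (x := (g, u')) hu' (hD q.1 q.2 hq))] with g' h1 h2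
  rw [inCoords_coe, inCoords_coe]
  exact zs_indep R S.mem_Λ (S.invariant q.1) hq (fun l _ _ => hu' l) (fun l _ _ => hu l) h2 h1

end InvariantSystem

end Generic

/-! ### Density of the points with formulas along the orbit -/

section Density

variable {m N d : ℕ} {c : Fin m → ℂ} {k : Fin m → ℕ} {H : Subgroup (JetGroup d k)}
  {V : Set (Fin N → ℂ)} {Λ : Set ℂ} {α β a b : ℤ} {E : LatticeFun N α β}
  {R : DarbouxLax d V Λ E a b} {δ : Fin N → ℕ} {D : Set (JetGroup d k ⧸ H)}
  {z : Fin N → JetGroup d k ⧸ H → ℂ} {r : ℕ}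

namespace InvariantSystem

theorem isGeneric_coordAt (S : InvariantSystem R c δ D z) (hDd : Dense D) {u : LatticeVar N}
    (hu : ∀ l, u l ∈ V) {Y : Set (JetGroup d k ⧸ H)} (hYo : IsOpen Y) (hYd : Dense Y)
    (hY : ∀ g : JetGroup d k, (g : JetGroup d k ⧸ H) ∈ Y → CoordAt R.M c δ D z (g, u)) :
    IsGeneric V (CoordAt R.M c δ D z) := by
  have hD : IsGeneric V fun x : Phase N d k =>
      ∀ q : Σ i : Fin N, Fin (δ i + 1), ZDefined R.M c D ((q.2 : ℕ) : ℤ) x :=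
    IsGeneric.forall_finite fun q => S.isGeneric_zDefined hDd _
  refine ((isGeneric_coset hYd hYo).and hD).mono fun x hx h => ?_
  exact S.coordAt_of_coordAt hu hx (hY x.1 h.1) fun i j hj => h.2 ⟨i, ⟨j, Nat.lt_succ_of_le hj⟩⟩

theorem isGeneric_solvableAt (S : InvariantSystem R c δ D z) (hVc : IsPreconnected V)
    (hH : HasCodim H r) (hδ : ∑ i, δ i + N = r) (hDd : Dense D)
    (hC : IsGeneric V (CoordAt R.M c δ D z)) {x : Phase N d k} (hx : ∀ l, x.2 l ∈ V)
    (hD : ∀ i : Fin N, ZDefined R.M c D ((δ i : ℤ) + 1) x)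
    (hdet : (jacobian R.M c δ z x).det ≠ 0) : IsGeneric V (SolvableAt R.M c δ V D z) := by
  obtain ⟨L, hL⟩ := exists_isTangentMap hH
  obtain ⟨φ, h1, h2, h3⟩ := S.exists_rank_function hVc hL hx hD hdet
  have hD' : IsGeneric V fun x : Phase N d k =>
      ∀ i : Fin N, ZDefined R.M c D ((δ i : ℤ) + 1) x :=
    IsGeneric.forall_finite fun i => S.isGeneric_zDefined hDd _
  have hC' : IsGeneric V fun x : Phase N d k => CoordAt R.M c δ D z (phaseShift R.M c k x) :=
    zpow_one (phaseShift R.M c k) ▸ S.isGeneric_phaseShift 1 hC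
  have hφ : IsGeneric V fun x : Phase N d k => φ ((x.1 : JetAlg d k), x.2 0) ≠ 0 :=
    isGeneric_ne_zero S.isOpen_V h1 h2
  refine ((hC.and hC').and (hD'.and hφ)).mono fun y hy ⟨⟨hy1, hy2⟩, hy3, hy4⟩ => ?_
  have hinj := h3 ((y.1 : JetAlg d k), y.2 0) hy4
  dsimp only at hinj
  exact ⟨hy, hy3, hy1, S.det_ne_zero_of_velocity hL hδ hy hy3 hy2 hinj⟩

/-- At generic points the values of the `z^i_k` at two points of an orbit are distinct: a change of
`u_{j'}` alone does not affect the `z^i_k`, `k ≤ d_i + 1`, at `𝒮^j(x)`, but it does so at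
`𝒮^{j'}(x)`, where `u_{j'}` is a function of them. -/
theorem isGeneric_zFull_ne (S : InvariantSystem R c δ D z) (hN : 0 < N) (hH : HasCodim H r)
    (hδ : ∑ i, δ i + N = r) {j j' : ℤ} (hj : j ≠ j')
    (hG : IsGeneric V (SolvableAt R.M c δ V D z)) :
    IsGeneric V fun x => zFull R.M c δ z ((phaseShift R.M c k ^ j) x) ≠
      zFull R.M c δ z ((phaseShift R.M c k ^ j') x) := by
  have : Nonempty (Fin N) := ⟨⟨0, hN⟩⟩
  refine ((S.isGeneric_phaseShift j hG).and (S.isGeneric_phaseShift j' hG)).refine_near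
    fun x hx hsol => ?_
  have hcont : ∀ {i : ℤ} {y : Phase N d k}, y ∈ pointsOver d k V →
      SolvableAt R.M c δ V D z ((phaseShift R.M c k ^ i) y) →
      Tendsto (fun y => zFull R.M c δ z ((phaseShift R.M c k ^ i) y)) (𝓝[pointsOver d k V] y)
        (𝓝 (zFull R.M c δ z ((phaseShift R.M c k ^ i) y))) := fun {i y} hy h =>
    ((S.continuousAt_zFull h).tendsto.mono_left nhdsWithin_le_nhds).comp (S.tendsto_phaseShift i hy)
  by_contra hcon
  have heq : ∀ᶠ y in 𝓝[pointsOver d k V] x, zFull R.M c δ z ((phaseShift R.M c k ^ j) y) =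
      zFull R.M c δ z ((phaseShift R.M c k ^ j') y) := by
    filter_upwards [not_frequently.1 hcon, hsol, self_mem_nhdsWithin] with y h1 h2 hy
    by_contra hne
    exact h1 (((hcont hy h2.1).prodMk_nhds (hcont hy h2.2)).eventually
      (isClosed_diagonal.isOpen_compl.mem_nhds hne))
  have hsol0 := hsol.self_of_nhdsWithin hx
  have hVt : ∀ᶠ t in 𝓝 (x.2 j'), t ∈ V := S.isOpen_V.mem_nhds (hx j')
  set y := (phaseShift R.M c k ^ j) x with hy
  have hyV : y ∈ pointsOver d k V := phaseShift_mem_pointsOver _ _ _ hx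
  have hyj : y.2 (j' - j) = x.2 j' := by
    rw [hy, phaseShift_zpow_snd, seqShift, sub_add_cancel]
  -- the points over the same point of `G` as `𝒮^j(x)`, with another value of `u_{j'}`
  let η : (Fin N → ℂ) → Phase N d k := fun t => (y.1, Function.update y.2 (j' - j) t)
  have hη : Tendsto η (𝓝 (x.2 j')) (𝓝[pointsOver d k V] y) := by
    refine tendsto_nhdsWithin_of_tendsto_nhds_of_eventually_within _ ?_ ?_
    · rw [← hyj]
      exact tendsto_update_phase y _
    · filter_upwards [hVt] with t ht using update_mem_pointsOver hyV _ _ ht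
  -- the corresponding points near `x`
  let γ : (Fin N → ℂ) → Phase N d k := fun t => (phaseShift R.M c k ^ (-j)) (η t)
  have hγ : Tendsto γ (𝓝 (x.2 j')) (𝓝[pointsOver d k V] x) := by
    have h1 := S.tendsto_phaseShift (-j) hyV
    rw [hy, ← phaseShift_zpow_add, neg_add_cancel, zpow_zero, Equiv.Perm.one_apply] at h1
    exact h1.comp hη
  have hγj : ∀ t, (phaseShift R.M c k ^ j) (γ t) = η t := fun t => by
    rw [← phaseShift_zpow_add, add_neg_cancel, zpow_zero, Equiv.Perm.one_apply]
  have hγu : ∀ t, ((phaseShift R.M c k ^ j') (γ t)).2 0 = t := fun t => by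
    have h1 : (0 : ℤ) + (j' + -j) = j' - j := by ring
    rw [← phaseShift_zpow_add, phaseShift_zpow_snd, seqShift, h1]
    exact Function.update_self _ _ _
  have hη' := hη.mono_right nhdsWithin_le_nhds
  -- since `u_j` is fixed, the `z^i_k`, `k ≤ d_i + 1`, do not change at `𝒮^j`
  have hlow : ∀ᶠ t in 𝓝 (x.2 j'), zFull R.M c δ z (η t) = zFull R.M c δ z y := by
    filter_upwards [hη'.eventually (S.eventually_zLow_eq hyV hsol0.1.2.2.1.1),
      hη'.eventually (eventually_all.2 fun i => S.eventually_zs_succ_eq i hyV (hsol0.1.2.1 i))]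
      with t h1 h2
    have h3 := (S.eventually_zLow_eq hyV hsol0.1.2.2.1.1).self_of_nhds
    have h4 := (eventually_all.2
      fun i => S.eventually_zs_succ_eq i hyV (hsol0.1.2.1 i)).self_of_nhds
    have h0 : (η t).2 0 = y.2 0 := Function.update_of_ne (by omega) _ _
    refine full_ext ?_ (funext fun i => ?_)
    · rw [fullLow_zFull, fullLow_zFull, h1, h3]
    · rw [fullTop_zFull, fullTop_zFull, h2, h4, h0]
  obtain ⟨f, hf⟩ := S.exists_solvedFormula hH hδ hsol0.2
  -- at `𝒮^{j'}` the same values give `u_{j'}`, so this variable cannot change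
  have hconst : ∀ᶠ t in 𝓝 (x.2 j'), t = f.toFun (zFull R.M c δ z y) := by
    have h1 := ((S.tendsto_phaseShift j' hx).mono_right nhdsWithin_le_nhds).comp hγ
    filter_upwards [hlow, hγ.eventually heq, h1.eventually hf] with t h2 h3 h4
    rw [← h2, ← hγj, h3]
    exact (hγu t).symm.trans h4.2
  have h1 : ∃ᶠ t in 𝓝 (x.2 j'), t ∈ ({f.toFun (zFull R.M c δ z y)}ᶜ : Set (Fin N → ℂ)) :=
    mem_closure_iff_frequently.1 (dense_compl_singleton _ _)
  exact h1 (hconst.mono fun t ht => not_not.2 ht)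

theorem solvedFormula_of_germ (S : InvariantSystem R c δ D z) {x : Phase N d k}
    (hx : SolvableAt R.M c δ V D z x)
    {f : AnalyticFun ((Σ i : Fin N, Fin (δ i + 2)) → ℂ) (Fin N → ℂ)}
    (hf : SolvedFormula R.M c δ z f x) {F : ((Σ i : Fin N, Fin (δ i + 2)) → ℂ) → Fin N → ℂ}
    (hF : F =ᶠ[𝓝 (zFull R.M c δ z x)] f.toFun) :
    SolvedFormula R.M c δ z (AnalyticFun.ofFun F) x := by
  have h1 : ∀ᶠ w in 𝓝 (zFull R.M c δ z x), AnalyticAt ℂ F w :=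
    ((f.analytic _ hf.self_of_nhds.1).congr hF.symm).eventually_analyticAt
  have h2 := (S.continuousAt_zFull hx).tendsto
  filter_upwards [hf, h2.eventually h1, h2.eventually hF] with y h3 h4 h5
  exact ⟨h4, h3.2.trans h5.symm⟩

theorem derivFormula_of_germ (S : InvariantSystem R c δ D z) {x : Phase N d k}
    (hx : SolvableAt R.M c δ V D z x)
    {Q : AnalyticFun (((Σ i : Fin N, Fin (δ i + 1)) → ℂ) × Win N a b) (Fin N → ℂ)}
    (hQ : DerivFormula c δ R z Q x)
    {F : ((Σ i : Fin N, Fin (δ i + 1)) → ℂ) × Win N a b → Fin N → ℂ}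
    (hF : F =ᶠ[𝓝 (zLow R.M c δ z x, win a b x.2)] Q.toFun) :
    DerivFormula c δ R z (AnalyticFun.ofFun F) x := by
  have h1 : ∀ᶠ w in 𝓝 (zLow R.M c δ z x, win a b x.2), AnalyticAt ℂ F w :=
    ((Q.analytic _ hQ.self_of_nhds.1).congr hF.symm).eventually_analyticAt
  have h2 : Tendsto (fun y : Phase N d k => (zLow R.M c δ z y, win a b y.2)) (𝓝 x)
      (𝓝 (zLow R.M c δ z x, win a b x.2)) :=
    (S.continuousAt_zLow hx.1 hx.2.2.1.1).tendsto.prodMk_nhds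
      (((continuous_win a b).comp continuous_snd).tendsto x)
  filter_upwards [hQ, h2.eventually h1, h2.eventually hF] with y h3 h4 h5
  exact ⟨h4, fun i => (h3.2 i).trans (congrFun h5.symm i)⟩

/-- If the arguments of the formulas at the points `𝒮^j(x)` are distinct, the local formulas at
these points are restrictions of one pair of functions. -/
theorem exists_compatible (S : InvariantSystem R c δ D z) (hN : 0 < N) (hH : HasCodim H r)
    (hδ : ∑ i, δ i + N = r) (hab : a ≤ b) {x : Phase N d k} (hx : RegularOrbit c δ R D z x)
    (hne : ∀ j j' : shiftRange δ α β a b, j ≠ j' →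
      zFull R.M c δ z ((phaseShift R.M c k ^ (j : ℤ)) x) ≠
        zFull R.M c δ z ((phaseShift R.M c k ^ (j' : ℤ)) x))
    (hne' : ∀ j j' : shiftRange δ α β a b, j ≠ j' → x.2 (a + j) ≠ x.2 (a + j')) :
    ∃ f Q, Compatible c δ R z f Q x := by
  have : Finite (shiftRange δ α β a b) := (Set.finite_Icc _ _).to_subtype
  have h1 : ∀ j : shiftRange δ α β a b, ∃ f,
      SolvedFormula R.M c δ z f ((phaseShift R.M c k ^ (j : ℤ)) x) := fun j =>
    S.exists_solvedFormula hH hδ (hx j j.2).1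
  have h2 : ∀ j : shiftRange δ α β a b, ∃ Q,
      DerivFormula c δ R z Q ((phaseShift R.M c k ^ (j : ℤ)) x) := fun j =>
    S.exists_derivFormula hN hH hδ (hx j j.2).1.1 (hx j j.2).1.2.2.1
      (by rw [phaseShift_zpow_snd]; exact (hx j j.2).2.2)
  choose f hf using h1
  choose Q hQ using h2
  have hp : Function.Injective fun j : shiftRange δ α β a b =>
      zFull R.M c δ z ((phaseShift R.M c k ^ (j : ℤ)) x) := fun j j' h =>
    by_contra fun hjj => hne j j' hjj h
  have hp' : Function.Injective fun j : shiftRange δ α β a b =>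
      (zLow R.M c δ z ((phaseShift R.M c k ^ (j : ℤ)) x),
        win a b ((phaseShift R.M c k ^ (j : ℤ)) x).2) := fun j j' h => by
    by_contra hjj
    have h3 := congrFun (congrArg Prod.snd h) ⟨a, le_rfl, hab⟩
    simp only [phaseShift_zpow_snd] at h3
    exact hne' j j' hjj h3
  obtain ⟨F, hF⟩ := exists_common_germ hp fun j => (f j).toFun
  obtain ⟨P, hP⟩ := exists_common_germ hp' fun j => (Q j).toFun
  exact ⟨AnalyticFun.ofFun F, AnalyticFun.ofFun P, fun j hj =>
    ⟨S.solvedFormula_of_germ (hx j hj).1 (hf ⟨j, hj⟩) (hF ⟨j, hj⟩),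
      S.derivFormula_of_germ (hx j hj).1 (hQ ⟨j, hj⟩) (hP ⟨j, hj⟩)⟩⟩

theorem isGeneric_compatible (S : InvariantSystem R c δ D z) (hN : 0 < N) (hH : HasCodim H r)
    (hδ : ∑ i, δ i + N = r) (hab : a ≤ b) (hE : IsDenseIn V E.dom)
    (hG : IsGeneric V (SolvableAt R.M c δ V D z)) :
    IsGeneric V fun x => RegularOrbit c δ R D z x ∧ ∃ f Q, Compatible c δ R z f Q x := by
  have : Finite (shiftRange δ α β a b) := (Set.finite_Icc _ _).to_subtype
  have hreg : IsGeneric V fun x : Phase N d k => ∀ j : shiftRange δ α β a b,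
      SolvableAt R.M c δ V D z ((phaseShift R.M c k ^ (j : ℤ)) x) ∧
      win α β ((phaseShift R.M c k ^ (j : ℤ)) x).2 ∈ E.dom ∧
      win a b ((phaseShift R.M c k ^ (j : ℤ)) x).2 ∈ R.domU :=
    IsGeneric.forall_finite fun j => S.isGeneric_phaseShift j
      (hG.and ((isGeneric_win hE E.isOpen_dom).and (isGeneric_win R.domU_dense R.isOpen_domU)))
  have hsep : IsGeneric V fun x : Phase N d k =>
      ∀ q : {q : shiftRange δ α β a b × shiftRange δ α β a b // q.1 ≠ q.2},
        zFull R.M c δ z ((phaseShift R.M c k ^ (q.1.1 : ℤ)) x) ≠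
          zFull R.M c δ z ((phaseShift R.M c k ^ (q.1.2 : ℤ)) x) ∧
        x.2 (a + q.1.1) ≠ x.2 (a + q.1.2) :=
    IsGeneric.forall_finite fun q =>
      have hq : (q.1.1 : ℤ) ≠ q.1.2 := fun h => q.2 (Subtype.ext h)
      (S.isGeneric_zFull_ne hN hH hδ hq hG).and
        (isGeneric_ne hN S.isOpen_V fun h => hq (add_left_cancel h))
  refine (hreg.and hsep).mono fun x _ hx => ?_
  have hx' : RegularOrbit c δ R D z x := fun j hj => by
    have := hx.1 ⟨j, hj⟩
    rwa [phaseShift_zpow_snd] at this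
  exact ⟨hx', S.exists_compatible hN hH hδ hab hx' (fun j j' h => (hx.2 ⟨(j, j'), h⟩).1)
    fun j j' h => (hx.2 ⟨(j, j'), h⟩).2⟩

end InvariantSystem

theorem IsGeneric.mem_closure {P : Phase N d k → Prop} (hP : IsGeneric V P) {x : Phase N d k}
    (hx : ∀ l, x.2 l ∈ V) : x ∈ closure {y | P y} := by
  refine mem_closure_iff_frequently.2 ((frequently_nhdsWithin_iff.1
    ((hP x hx).and_eventually self_mem_nhdsWithin)).mono fun y hy => ?_)
  exact hy.1.1.self_of_nhdsWithin hy.2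

end Density

/-! ### Transformations given by Darboux-Lax representations -/

theorem mainTheorem2 {N d m : ℕ} (hN : 0 < N) (hd : 0 < d) (hm : 0 < m)
    -- the ranges of `u` and of the parameter
    (V : Set (Fin N → ℂ)) (hVo : IsOpen V) (hVc : IsConnected V)
    (Λ : Set ℂ) (hΛo : IsOpen Λ) (hΛc : IsConnected Λ)
    -- the equation and its Darboux-Lax representation
    {α β : ℤ} (hαβ : α ≤ β) (E : LatticeFun N α β) (hE : IsDenseIn V E.dom)
    {a b : ℤ} (hab : a ≤ b) (R : DarbouxLax d V Λ E a b)
    -- the group `G` and its subgroup `H`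
    (c : Fin m → ℂ) (hc : ∀ p, c p ∈ Λ) (k : Fin m → ℕ) (hk : ∀ p, 0 < k p)
    (H : Subgroup (JetGroup d k)) (hHclosed : IsClosed (H : Set (JetGroup d k)))
    (hHconn : IsConnected (H : Set (JetGroup d k)))
    (r : ℕ) (hr : 0 < r) (hHcodim : HasCodim H r)
    -- the functions `z^i` on an open dense subset of `G/H`
    (δ : Fin N → ℕ) (hδ : ∑ i, δ i + N = r)
    (D : Set (JetGroup d k ⧸ H)) (hDo : IsOpen D) (hDd : Dense D)
    (z : Fin N → JetGroup d k ⧸ H → ℂ) (hz : ∀ i, IsAnalyticOn (z i) D)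
    (hinv : ∀ i, IsLeftInvariant c (laxGroup V R.M (δ i)) (z i) D)
    -- the `𝒮^j(z^i)`, `j ≤ d_i`, which do not depend on the `u_l`, are local coordinates
    -- almost everywhere (it is enough to ask this for one choice of the values `u_l`)
    (hcoord : ∃ u : LatticeVar N, (∀ l, u l ∈ V) ∧ ∃ Y : Set (JetGroup d k ⧸ H), IsOpen Y ∧ Dense Y ∧
      ∀ g : JetGroup d k, (g : JetGroup d k ⧸ H) ∈ Y → CoordAt R.M c δ D z (g, u))
    -- the Jacobian determinant is not identically zero
    (hdet : ∃ x : Phase N d k, (∀ l, x.2 l ∈ V) ∧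
      (∀ i : Fin N, ZDefined R.M c D ((δ i : ℤ) + 1) x) ∧ (jacobian R.M c δ z x).det ≠ 0) :
    -- the functions `𝒮^j(z^i)`, `j ≤ d_i`, do not depend on the `u_l`
    (∀ i : Fin N, ∀ j : ℕ, j ≤ δ i → ∀ (g : JetGroup d k) (u u' : LatticeVar N),
      (∀ l, u l ∈ V) → (∀ l, u' l ∈ V) → ZDefined R.M c D j (g, u) →
      ZDefined R.M c D j (g, u') → zs R.M c z i j (g, u) = zs R.M c z i j (g, u')) ∧
    -- locally `𝒮^{d_i+1}(z^i) = F^i(z, u)`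
    (∀ x : Phase N d k, (∀ l, x.2 l ∈ V) → CoordAt R.M c δ D z x →
      (∀ i : Fin N, ZDefined R.M c D ((δ i : ℤ) + 1) x) → ∃ F, ShiftFormula R.M c δ z F x) ∧
    -- locally `D_t(z^i) = Q^i(z, u_a, …, u_b)`
    (∀ x : Phase N d k, (∀ l, x.2 l ∈ V) → CoordAt R.M c δ D z x →
      win a b x.2 ∈ R.domU → ∃ Q, DerivFormula c δ R z Q x) ∧
    -- locally one can solve for `u`: `u = f(z)`
    (∀ x : Phase N d k, SolvableAt R.M c δ V D z x → ∃ f, SolvedFormula R.M c δ z f x) ∧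
    -- such formulas exist along the orbit of `x` under `𝒮`, for a dense set of points `x`
    (∀ x : Phase N d k, (∀ l, x.2 l ∈ V) →
      x ∈ closure {y | RegularOrbit c δ R D z y ∧ ∃ f Q, Compatible c δ R z f Q y}) ∧
    -- any such `f` and `Q` give a Miura-type transformation `u = f(v)` from the modified
    -- equation `v^i_t = P^i = Q^i(v, 𝒮^a(f), …, 𝒮^b(f))` to the original equation: the defining
    -- identity holds on the whole connected component of its domain that contains the values
    -- `v^i_l = z^i_l(x)`
    (∀ (x : Phase N d k) (f : AnalyticFun ((Σ i : Fin N, Fin (δ i + 2)) → ℂ) (Fin N → ℂ))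
      (Q : AnalyticFun (((Σ i : Fin N, Fin (δ i + 1)) → ℂ) × Win N a b) (Fin N → ℂ)),
      RegularOrbit c δ R D z x → Compatible c δ R z f Q x →
      (fun l i => zs R.M c z i l x) ∈ miuraDom (modifiedEq Q f) E (miuraFun f) ∧
      IsMiuraOn (modifiedEq Q f) E (miuraFun f)
        (connectedComponentIn (miuraDom (modifiedEq Q f) E (miuraFun f))
          (fun l i => zs R.M c z i l x))) := by
  have S : InvariantSystem R c δ D z := ⟨hVo, hΛo, hc, hDo, hz, hinv⟩
  refine ⟨fun i j hj g u u' hu hu' => zs_indep R hc (hinv i) hj (fun l _ _ => hu l)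
    fun l _ _ => hu' l, fun x hx hC hD => S.exists_shiftFormula hHcodim hδ hx hC hD,
    fun x hx hC hU => S.exists_derivFormula hN hHcodim hδ hx hC hU,
    fun x hx => S.exists_solvedFormula hHcodim hδ hx, fun x hx => ?_, fun x f Q hx hfQ => ?_⟩
  · obtain ⟨u₀, hu₀, Y, hYo, hYd, hY⟩ := hcoord
    obtain ⟨x₀, hx₀, hD₀, hdet₀⟩ := hdet
    have hG := S.isGeneric_solvableAt hVc.isPreconnected hHcodim hδ hDd
      (S.isGeneric_coordAt hDd hu₀ hYo hYd hY) hx₀ hD₀ hdet₀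
    exact (S.isGeneric_compatible hN hHcodim hδ hab hE hG).mem_closure hx
  · have hdom := InvariantSystem.zAll_mem_miuraDom hx hfQ
    exact ⟨hdom, isMiuraOn_connectedComponentIn _ _ hdom (S.eventually_identity hHcodim hδ hx hfQ)⟩
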